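/- All manifolds are smooth, real, finite-dimensional, Hausdorff, second countable and without boundary, and line bundles are real and smooth. Let $\mathbb R^*$ be the multiplicative group of non-zero reals. **Line bundles.** For a line bundle $L\to M$, let $DL$ denote its gauge algebroid: $\Gamma(DL)$ consists of the derivations of $L$, i.e. the $\mathbb R$-linear operators $D:\Gamma(L)\to\Gamma(L)$ for which there is a vector field $X$ on $M$ with $D(f\lambda)=X(f)\lambda+f\,D\lambda$ for all $f\in C^\infty(M)$, $\lambda\in\Gamma(L)$, with the commutator bracket; the fibre $D_xL$ consists of the linear maps $\delta:\Gamma(L)\to L_x$ such that $\delta(f\lambda)=v(f)\lambda_x+f(x)\,\delta\lambda$ for some $v\in T_xM$. A *complex Atiyah structure* on $L$ is a smooth vector bundle endomorphism $K$ of $DL$ with $K^2=-\mathrm{id}$ and $$[KD_1,KD_2]-[D_1,D_2]-K[KD_1,D_2]-K[D_1,KD_2]=0\qquad (D_1,D_2\in\Gamma(DL)).$$ An *odd complex manifold* is a line bundle $L\to M$ with a complex Atiyah structure $K$. A fibrewise invertible line bundle map $F:L_1\to L_2$, covering $\varphi:M_1\to M_2$, induces linear maps $DF:D_xL_1\to D_{\varphi(x)}L_2$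 by $(DF\,\delta)(\lambda)=F_x(\delta(F^*\lambda))$, where $(F^*\lambda)_x=F_x^{-1}(\lambda_{\varphi(x)})$. An *odd holomorphic map* $(L_1,K_1)\to(L_2,K_2)$ is a fibrewise invertible line bundle map $F$ with $DF\circ K_1=K_2\circ DF$. **Homogeneous manifolds.** A *homogeneous manifold* is (the total space of) a principal $\mathbb R^*$-bundle; $h_t$ denotes the action of $t\in\mathbb R^*$. A complex structure on a manifold is a smooth endomorphism $J$ of the tangent bundle with $J^2=-\mathrm{id}$ and vanishing Nijenhuis torsion; a smooth map is holomorphic if its differential intertwines the complex structures. A *homogeneous complex manifold* is a homogeneous manifold with a complex structure $J$ which is homogeneous of degree $0$, i.e. $h_t^*J=J$ for all $t\in\mathbb R^*$. **Lifts.** For a line bundle $L\to M$ let $\widetilde L=L^*\smallsetminus 0$, a homogeneous manifold under fibrewise multiplication, and for $\lambda\in\Gamma(L)$ let $\widetilde\lambda\in C^\infty(\widetilde L)$ be the function $\widetilde\lambda(\varepsilon)=\langle\varepsilon,\lambda_x\rangle$, $\varepsilon\in L_x^*\smallsetminus 0$. **Theorem.** 1. For every line bundle $L$ and every $D\in\Gamma(DL)$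 there is a unique smooth vector field $\widetilde D$ on $\widetilde L$ with $\widetilde D\,\widetilde\lambda=\widetilde{D\lambda}$ for all $\lambda\in\Gamma(L)$. 2. For every complex Atiyah structure $K$ on a line bundle $L$ there is a unique complex structure $\widetilde K$ on $\widetilde L$ with $\widetilde{KD}=\widetilde K\widetilde D$ for all $D\in\Gamma(DL)$. 3. $\widetilde K$ is homogeneous of degree $0$. 4. For every line bundle $L$ and every complex structure $J$ on $\widetilde L$ which is homogeneous of degree $0$ there is a unique complex Atiyah structure $K$ on $L$ with $J=\widetilde K$. Hence $K\mapsto\widetilde K$ is a bijection between the complex Atiyah structures on $L$ and the homogeneous complex structures on $\widetilde L$. 5. For every odd holomorphic map $F:(L_1,K_1)\to(L_2,K_2)$ covering $\varphi$, the $\mathbb R^*$-equivariant map $\widetilde F:\widetilde L_1\to\widetilde L_2$, $L_{1,x}^*\ni\varepsilon\mapsto\varepsilon\circ F_x^{-1}\in L_{2,\varphi(x)}^*$, is holomorphic, and $(L,K)\mapsto(\widetilde L,\widetilde K)$, $F\mapsto\widetilde F$ is an equivalence from the category of odd complex manifolds with odd holomorphic maps to the category of homogeneous complex manifolds with $\mathbb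 R^*$-equivariant holomorphic maps. -/

import Mathlib

open scoped Manifold ContDiff Bundle
open Bundle CategoryTheory VectorField

universe u

noncomputable section

/-- A smooth real manifold: finite-dimensional, without boundary, Hausdorff and second countable. -/
structure SmoothMfd : Type (u + 1) where
  carrier : Type u
  E : Type
  H : Type
  [normE : NormedAddCommGroup E]
  [spaceE : NormedSpace ℝ E]
  [finE : FiniteDimensional ℝ E]
  [topH : TopologicalSpace H]
  I : ModelWithCorners ℝ E H
  [boundaryless : I.Boundaryless]
  [top : TopologicalSpace carrier]
  [charted : ChartedSpace H carrier]
  [mfd : IsManifold I ∞ carrier]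
  [t2 : T2Space carrier]
  [sc : SecondCountableTopology carrier]

attribute [instance] SmoothMfd.normE SmoothMfd.spaceE SmoothMfd.finE SmoothMfd.topH
  SmoothMfd.boundaryless SmoothMfd.top SmoothMfd.charted SmoothMfd.mfd SmoothMfd.t2 SmoothMfd.sc

instance : CoeSort SmoothMfd.{u} (Type u) := ⟨SmoothMfd.carrier⟩

namespace SmoothMfd

/-- Smoothness of a (set-theoretic) vector field. -/
def IsSmoothField (N : SmoothMfd.{u}) (V : ∀ p : N, TangentSpace N.I p) : Prop :=
  ContMDiff N.I N.I.tangent ∞ (fun p => (⟨p, V p⟩ : TangentBundle N.I N))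

end SmoothMfd

/-- A smooth real line bundle over a smooth manifold. -/
structure LineBundle : Type (u + 1) where
  base : SmoothMfd.{u}
  fiber : base → Type u
  [addCommGroup : ∀ x, AddCommGroup (fiber x)]
  [module : ∀ x, Module ℝ (fiber x)]
  [topFiber : ∀ x, TopologicalSpace (fiber x)]
  [topTotal : TopologicalSpace (TotalSpace ℝ fiber)]
  [fiberBundle : FiberBundle ℝ fiber]
  [vectorBundle : VectorBundle ℝ ℝ fiber]
  [smooth : ContMDiffVectorBundle ∞ ℝ fiber base.I]

attribute [instance] LineBundle.addCommGroup LineBundle.module LineBundle.topFiber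
  LineBundle.topTotal LineBundle.fiberBundle LineBundle.vectorBundle LineBundle.smooth

namespace LineBundle

variable (L : LineBundle.{u})

/-- The smooth sections of `L`. -/
abbrev Section : Type u := Cₛ^∞⟮L.base.I; ℝ, L.fiber⟯

/-- The smooth real functions on the base. -/
abbrev Fun : Type u := C^∞⟮L.base.I, L.base; ℝ⟯

/-- The product `f λ` of a function and a section. -/
instance : SMul L.Fun L.Section :=
  ⟨fun f s => ⟨fun x => f x • s x, ContMDiff.smul_section f.contMDiff s.contMDiff⟩⟩

variable {L} in
@[simp] theorem smul_apply (f : L.Fun) (s : L.Section) (x : L.base) : (f • s) x = f x • s x := rfl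

/-- The fibre `L_x^*` of the dual line bundle. -/
abbrev dualFiber (x : L.base) : Type u := L.fiber x →L[ℝ] Bundle.Trivial L.base ℝ x

/-- The total space of the dual line bundle `L^*`. -/
abbrev DualTotal : Type u := TotalSpace (ℝ →L[ℝ] ℝ) L.dualFiber

/-- The model of the manifold `L^*`. -/
abbrev dualModel : ModelWithCorners ℝ (L.base.E × (ℝ →L[ℝ] ℝ)) (ModelProd L.base.H (ℝ →L[ℝ] ℝ)) :=
  L.base.I.prod 𝓘(ℝ, ℝ →L[ℝ] ℝ)

variable {L} in
theorem contMDiff_clm {E H N : Type*} [NormedAddCommGroup E] [NormedSpace ℝ E] [TopologicalSpace H]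
    {I : ModelWithCorners ℝ E H} [TopologicalSpace N] [ChartedSpace H N] {f : N → ℝ →L[ℝ] ℝ} {y : N} :
    ContMDiffAt I 𝓘(ℝ, ℝ →L[ℝ] ℝ) ∞ f y ↔ ContMDiffAt I 𝓘(ℝ, ℝ) ∞ (fun z => f z 1) y := by
  constructor
  · intro h
    exact h.clm_apply contMDiffAt_const
  · intro h
    have : f = fun z => (ContinuousLinearMap.toSpanSingletonCLE (𝕜 := ℝ) (E := ℝ)) (f z 1) := by
      ext z; simp
    rw [this]
    exact (ContinuousLinearEquiv.contDiff _).contDiffAt.comp_contMDiffAt h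

/-- The local frame of `L` over the trivialising neighbourhood of `x₀`. -/
def frame (x₀ x : L.base) : L.fiber x :=
  Trivialization.symmL ℝ (trivializationAt ℝ L.fiber x₀) x 1

theorem frame_eq {x₀ x : L.base} (h : x ∈ (trivializationAt ℝ L.fiber x₀).baseSet) (v : L.fiber x) :
    v = (trivializationAt ℝ L.fiber x₀ ⟨x, v⟩).2 • L.frame x₀ x := by
  have h1 := (trivializationAt ℝ L.fiber x₀).symmL_continuousLinearMapAt (R := ℝ) h v
  conv_lhs => rw [← h1]
  rw [frame, ← map_smul]
  congr 1
  rw [Trivialization.continuousLinearMapAt_apply, Trivialization.linearMapAt_apply, if_pos h]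
  simp

theorem triv_frame {x₀ x : L.base} (h : x ∈ (trivializationAt ℝ L.fiber x₀).baseSet) :
    (trivializationAt ℝ L.fiber x₀ ⟨x, L.frame x₀ x⟩).2 = 1 := by
  rw [frame, Trivialization.symmL_apply _ h, Trivialization.apply_mk_symm _ h]

variable {L} in
theorem dual_contMDiffAt_iff {E H N : Type*} [NormedAddCommGroup E] [NormedSpace ℝ E]
    [TopologicalSpace H] {I : ModelWithCorners ℝ E H} [TopologicalSpace N] [ChartedSpace H N]
    {f : N → L.DualTotal} {y : N} (x₀ : L.base)
    (h : (f y).1 ∈ (trivializationAt ℝ L.fiber x₀).baseSet) :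
    ContMDiffAt I L.dualModel ∞ f y ↔ ContMDiffAt I L.base.I ∞ (fun z => (f z).1) y ∧
      ContMDiffAt I 𝓘(ℝ, ℝ) ∞ (fun z => (f z).2 (L.frame x₀ (f z).1) : N → ℝ) y := by
  rw [(trivializationAt (ℝ →L[ℝ] ℝ) L.dualFiber x₀).contMDiffAt_iff, contMDiff_clm]
  · simp [hom_trivializationAt_apply, ContinuousLinearMap.inCoordinates, frame]
  · rw [Trivialization.mem_source]
    simpa using h

theorem ne_zero_iff {x₀ x : L.base} (h : x ∈ (trivializationAt ℝ L.fiber x₀).baseSet)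
    (ε : L.dualFiber x) : ε ≠ 0 ↔ (ε (L.frame x₀ x) : ℝ) ≠ 0 := by
  refine not_congr ⟨fun h => by rw [h]; rfl, fun h' => ?_⟩
  ext v
  rw [L.frame_eq h v, map_smul, h']
  simp

theorem isOpen_slit : IsOpen {p : L.DualTotal | p.2 ≠ 0} := by
  rw [isOpen_iff_mem_nhds]
  intro p hp
  have hb := FiberBundle.mem_baseSet_trivializationAt' (F := ℝ) (E := L.fiber) p.1
  have h := ((dual_contMDiffAt_iff (I := L.dualModel) (f := id) (y := p) p.1 hb).1
    contMDiffAt_id).2.continuousAt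
  have h0 := (L.ne_zero_iff hb p.2).1 hp
  filter_upwards [h.eventually_ne h0] with z hz h'
  exact hz (by simp [h'])

/-- `L^* \ 0`, the complement of the zero section, as an open subset of `L^*`. -/
def slit : TopologicalSpace.Opens L.DualTotal := ⟨{p | p.2 ≠ 0}, L.isOpen_slit⟩

instance : T2Space L.DualTotal := by
  refine ⟨fun p q hpq => ?_⟩
  have hc : Continuous (fun p : L.DualTotal => p.1) := FiberBundle.continuous_proj _ _
  by_cases h : p.1 = q.1
  · let e := trivializationAt (ℝ →L[ℝ] ℝ) L.dualFiber p.1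
    have hp : p ∈ e.source := FiberBundle.mem_trivializationAt_proj_source
    have hq : q ∈ e.source := by
      rw [Trivialization.mem_source, ← h]
      exact FiberBundle.mem_baseSet_trivializationAt' p.1
    have hne : e p ≠ e q := fun h' => hpq (e.injOn hp hq h')
    obtain ⟨U, V, hU, hV, hpU, hqV, hd⟩ := t2_separation hne
    exact ⟨e.source ∩ e ⁻¹' U, e.source ∩ e ⁻¹' V, e.isOpen_inter_preimage hU,
      e.isOpen_inter_preimage hV, ⟨hp, hpU⟩, ⟨hq, hqV⟩,
      (hd.preimage e).mono Set.inter_subset_right Set.inter_subset_right⟩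
  · obtain ⟨U, V, hU, hV, hpU, hqV, hd⟩ := t2_separation h
    exact ⟨_, _, hU.preimage hc, hV.preimage hc, hpU, hqV, hd.preimage _⟩

instance : SecondCountableTopology L.DualTotal := by
  let e := fun x => trivializationAt (ℝ →L[ℝ] ℝ) L.dualFiber x
  obtain ⟨s, hs, hsU⟩ := TopologicalSpace.countable_cover_nhds
    (fun x : L.base => (e x).open_baseSet.mem_nhds (FiberBundle.mem_baseSet_trivializationAt' x))
  have := hs.to_subtype
  have : SecondCountableTopology (ℝ →L[ℝ] ℝ) :=
    (ContinuousLinearMap.toSpanSingletonCLE (𝕜 := ℝ) (E := ℝ)).symm.toHomeomorph.secondCountableTopology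
  have (x : s) : SecondCountableTopology (e x).source :=
    (e x).toOpenPartialHomeomorph.toHomeomorphSourceTarget.secondCountableTopology
  refine TopologicalSpace.secondCountableTopology_of_countable_cover
    (fun x : s => (e x).open_source) ?_
  rw [Set.eq_univ_iff_forall]
  intro p
  have hp : p.1 ∈ ⋃ x ∈ s, (e x).baseSet := by rw [hsU]; trivial
  simp only [Set.mem_iUnion] at hp ⊢
  obtain ⟨x, hx, hp⟩ := hp
  exact ⟨⟨x, hx⟩, (Trivialization.mem_source _).2 hp⟩

/-- The smooth manifold `L^* \ 0`. -/
abbrev slitMfd : SmoothMfd.{u} where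
  carrier := L.slit
  E := L.base.E × (ℝ →L[ℝ] ℝ)
  H := ModelProd L.base.H (ℝ →L[ℝ] ℝ)
  I := L.dualModel

variable {L}

/-- The projection of `L^* \ 0` to the base. -/
def slitProj (p : L.slit) : L.base := p.1.1

/-- The action of `ℝˣ` on `L^* \ 0` by fibrewise multiplication. -/
instance : MulAction ℝˣ L.slit where
  smul t p := ⟨⟨p.1.1, (t : ℝ) • p.1.2⟩, smul_ne_zero t.ne_zero p.2⟩
  one_smul p := Subtype.ext (congrArg (TotalSpace.mk p.1.1) (one_smul ℝ p.1.2))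
  mul_smul s t p := Subtype.ext (congrArg (TotalSpace.mk p.1.1) (mul_smul (s : ℝ) (t : ℝ) p.1.2))

theorem smul_fst (t : ℝˣ) (p : L.slit) : (t • p).1.1 = p.1.1 := rfl
theorem smul_snd (t : ℝˣ) (p : L.slit) : (t • p).1.2 = (t : ℝ) • p.1.2 := rfl

theorem contMDiff_slitProj : ContMDiff L.dualModel L.base.I ∞ (slitProj (L := L)) :=
  (Bundle.contMDiff_proj L.dualFiber).comp contMDiff_subtype_val

theorem slit_contMDiffAt_iff {E H N : Type*} [NormedAddCommGroup E] [NormedSpace ℝ E]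
    [TopologicalSpace H] {I : ModelWithCorners ℝ E H} [TopologicalSpace N] [ChartedSpace H N]
    {f : N → L.slit} {y : N} (x₀ : L.base)
    (h : (f y).1.1 ∈ (trivializationAt ℝ L.fiber x₀).baseSet) :
    ContMDiffAt I L.dualModel ∞ f y ↔ ContMDiffAt I L.base.I ∞ (fun z => (f z).1.1) y ∧
      ContMDiffAt I 𝓘(ℝ, ℝ) ∞ (fun z => (f z).1.2 (L.frame x₀ (f z).1.1) : N → ℝ) y := by
  rw [← ContMDiffAt.subtypeVal_comp_iff]
  exact dual_contMDiffAt_iff x₀ h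

instance : ContMDiffSMul 𝓘(ℝ, ℝ) L.dualModel ∞ ℝˣ L.slit where
  contMDiff_smul := by
    intro ⟨t, p⟩
    have hb := FiberBundle.mem_baseSet_trivializationAt' (F := ℝ) (E := L.fiber) p.1.1
    have h2 : ContMDiffAt (𝓘(ℝ, ℝ).prod L.dualModel) L.dualModel ∞
      (fun z : ℝˣ × L.slit => z.2) (t, p) := contMDiffAt_snd
    rw [slit_contMDiffAt_iff p.1.1 hb] at h2 ⊢
    refine ⟨h2.1, ?_⟩
    exact (Units.contMDiff_val.contMDiffAt.comp (t, p) contMDiffAt_fst).mul h2.2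

/-- The fibre coordinate of `L^* \ 0` over the trivialising neighbourhood of `x₀`. -/
def slitCoord (x₀ : L.base) (p : L.slit) : ℝ := p.1.2 (L.frame x₀ p.1.1)

open Classical in
/-- The fibre coordinate as an element of `ℝˣ`. -/
def slitUnit (x₀ : L.base) (p : L.slit) : ℝˣ :=
  if h : slitCoord x₀ p ≠ 0 then Units.mk0 _ h else 1

theorem slitUnit_val {x₀ : L.base} {p : L.slit}
    (h : p.1.1 ∈ (trivializationAt ℝ L.fiber x₀).baseSet) :
    (slitUnit x₀ p : ℝ) = slitCoord x₀ p := by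
  have h0 : slitCoord x₀ p ≠ 0 := (L.ne_zero_iff h _).1 p.2
  rw [slitUnit, dif_pos h0, Units.val_mk0]

open Classical in
/-- The local section of `L^* \ 0` dual to `frame`. -/
def slitPoint (x₀ x : L.base) : L.slit :=
  if h : x ∈ (trivializationAt ℝ L.fiber x₀).baseSet then
    ⟨⟨x, Trivialization.continuousLinearMapAt ℝ (trivializationAt ℝ L.fiber x₀) x⟩,
      (L.ne_zero_iff h _).2 (by
        rw [frame]
        erw [(trivializationAt ℝ L.fiber x₀).continuousLinearMapAt_symmL (R := ℝ) h 1]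
        exact one_ne_zero)⟩
  else
    ⟨⟨x, Trivialization.continuousLinearMapAt ℝ (trivializationAt ℝ L.fiber x) x⟩,
      (L.ne_zero_iff (FiberBundle.mem_baseSet_trivializationAt' x) _).2 (by
        rw [frame]
        erw [(trivializationAt ℝ L.fiber x).continuousLinearMapAt_symmL (R := ℝ)
          (FiberBundle.mem_baseSet_trivializationAt' x) 1]
        exact one_ne_zero)⟩

theorem slitPoint_proj (x₀ x : L.base) : (slitPoint x₀ x).1.1 = x := by
  rw [slitPoint]; split_ifs <;> rfl

theorem slitCoord_smul (x₀ : L.base) (t : ℝˣ) (p : L.slit) :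
    slitCoord x₀ (t • p) = t * slitCoord x₀ p := rfl

theorem slitCoord_slitPoint {x₀ x : L.base}
    (h : x ∈ (trivializationAt ℝ L.fiber x₀).baseSet) : slitCoord x₀ (slitPoint x₀ x) = 1 := by
  rw [slitPoint, dif_pos h, slitCoord, frame]
  exact (trivializationAt ℝ L.fiber x₀).continuousLinearMapAt_symmL (R := ℝ) h 1

theorem slit_ext {x₀ : L.base} {p q : L.slit}
    (h : p.1.1 ∈ (trivializationAt ℝ L.fiber x₀).baseSet) (hpq : p.1.1 = q.1.1)
    (hc : slitCoord x₀ p = slitCoord x₀ q) : p = q := by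
  obtain ⟨⟨x, ε⟩, hε⟩ := p
  obtain ⟨⟨y, η⟩, hη⟩ := q
  obtain rfl : x = y := hpq
  have : ε = η := by
    ext v
    rw [L.frame_eq h v, map_smul, map_smul]
    exact congrArg _ hc
  subst this
  rfl

theorem slitUnit_smul {x₀ : L.base} (t : ℝˣ) {p : L.slit}
    (h : p.1.1 ∈ (trivializationAt ℝ L.fiber x₀).baseSet) :
    slitUnit x₀ (t • p) = t * slitUnit x₀ p := by
  ext
  rw [slitUnit_val (p := t • p) h, Units.val_mul, slitUnit_val h, slitCoord_smul]

theorem contMDiffOn_slitUnit (x₀ : L.base) : ContMDiffOn L.dualModel 𝓘(ℝ, ℝ) ∞ (slitUnit x₀)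
    (slitProj ⁻¹' (trivializationAt ℝ L.fiber x₀).baseSet) := by
  intro p hp
  refine ContMDiffAt.contMDiffWithinAt ?_
  have h1 : ContMDiffAt L.dualModel 𝓘(ℝ, ℝ) ∞ (slitCoord x₀) p :=
    ((slit_contMDiffAt_iff (I := L.dualModel) (f := id) (y := p) x₀ hp).1 contMDiffAt_id).2
  have h2 := (contMDiffOn_isOpenEmbedding_symm (I := 𝓘(ℝ, ℝ)) (n := ∞)
    (Units.isOpenEmbedding_val (R := ℝ)))
  have hr : ∀ q : L.slit, q ∈ slitProj ⁻¹' (trivializationAt ℝ L.fiber x₀).baseSet →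
      slitCoord x₀ q = ((slitUnit x₀ q : ℝˣ) : ℝ) := fun q hq => (slitUnit_val hq).symm
  have hmem : slitCoord x₀ p ∈ Set.range ((↑) : ℝˣ → ℝ) := ⟨_, (hr p hp).symm⟩
  have h3 := (h2 _ hmem).contMDiffAt ((Units.isOpenEmbedding_val (R := ℝ)).isOpen_range.mem_nhds hmem)
  refine (h3.comp p h1).congr_of_eventuallyEq ?_
  filter_upwards [((trivializationAt ℝ L.fiber x₀).open_baseSet.preimage
    contMDiff_slitProj.continuous).mem_nhds hp] with q hq
  rw [Function.comp, hr q hq]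
  exact ((Units.isOpenEmbedding_val (R := ℝ)).toOpenPartialHomeomorph_left_inv).symm

theorem contMDiffOn_slitSymm (x₀ : L.base) :
    ContMDiffOn (L.base.I.prod 𝓘(ℝ, ℝ)) L.dualModel ∞
      (fun z : L.base × ℝˣ => z.2 • slitPoint x₀ z.1)
      ((trivializationAt ℝ L.fiber x₀).baseSet ×ˢ Set.univ) := by
  intro z hz
  refine ContMDiffAt.contMDiffWithinAt ?_
  have hz1 := hz.1
  rw [slit_contMDiffAt_iff x₀ (by rw [smul_fst, slitPoint_proj]; exact hz1)]
  constructor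
  · simp only [smul_fst, slitPoint_proj]
    exact contMDiffAt_fst
  · refine (Units.contMDiff_val.contMDiffAt.comp z contMDiffAt_snd).congr_of_eventuallyEq ?_
    filter_upwards [((trivializationAt ℝ L.fiber x₀).open_baseSet.preimage
      continuous_fst).mem_nhds hz1] with w hw
    change slitCoord x₀ (w.2 • slitPoint x₀ w.1) = _
    rw [slitCoord_smul, slitCoord_slitPoint hw, mul_one]
    rfl

/-- The local trivialisation of the principal bundle `L^* \ 0` induced by one of `L`. -/
def slitTriv (x₀ : L.base) : Trivialization ℝˣ (slitProj (L := L)) where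
  toFun p := (p.1.1, slitUnit x₀ p)
  invFun z := z.2 • slitPoint x₀ z.1
  source := slitProj ⁻¹' (trivializationAt ℝ L.fiber x₀).baseSet
  target := (trivializationAt ℝ L.fiber x₀).baseSet ×ˢ Set.univ
  map_source' p hp := ⟨hp, trivial⟩
  map_target' z hz := by
    have h1 : slitProj (z.2 • slitPoint x₀ z.1) = z.1 := slitPoint_proj x₀ z.1
    rw [Set.mem_preimage, h1]
    exact hz.1
  left_inv' p hp := by
    refine slit_ext (x₀ := x₀) ?_ ?_ ?_
    · rw [smul_fst, slitPoint_proj]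
      exact hp
    · rw [smul_fst, slitPoint_proj]
    · have h1 : slitCoord x₀ (slitPoint x₀ p.1.1) = 1 := slitCoord_slitPoint hp
      rw [slitCoord_smul, slitUnit_val hp, h1, mul_one]
  right_inv' z hz := by
    have h1 : (z.2 • slitPoint x₀ z.1).1.1 = z.1 := by rw [smul_fst, slitPoint_proj]
    refine Prod.ext h1 ?_
    ext
    change ((slitUnit x₀ (z.2 • slitPoint x₀ z.1) : ℝˣ) : ℝ) = _
    rw [slitUnit_val (by rw [h1]; exact hz.1), slitCoord_smul, slitCoord_slitPoint hz.1, mul_one]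
  open_source := (trivializationAt ℝ L.fiber x₀).open_baseSet.preimage contMDiff_slitProj.continuous
  open_target := (trivializationAt ℝ L.fiber x₀).open_baseSet.prod isOpen_univ
  continuousOn_toFun :=
    (contMDiff_slitProj.continuous.continuousOn).prodMk (contMDiffOn_slitUnit x₀).continuousOn
  continuousOn_invFun := (contMDiffOn_slitSymm x₀).continuousOn
  baseSet := (trivializationAt ℝ L.fiber x₀).baseSet
  open_baseSet := (trivializationAt ℝ L.fiber x₀).open_baseSet
  source_eq := rfl
  target_eq := rfl
  proj_toFun _ _ := rfl

end LineBundle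

/-- A homogeneous manifold: a smooth principal `ℝˣ`-bundle `total → base`, i.e. a smooth `ℝˣ`-action
on `total` and a smooth invariant map `proj` which is locally, over the base, equivariantly
diffeomorphic to the projection of `base × ℝˣ`, with `ℝˣ` acting on itself by multiplication. -/
structure HomogeneousManifold : Type (u + 1) where
  total : SmoothMfd.{u}
  base : SmoothMfd.{u}
  proj : total → base
  [action : MulAction ℝˣ total]
  [smooth_action : ContMDiffSMul 𝓘(ℝ, ℝ) total.I ∞ ℝˣ total]
  smooth_proj : ContMDiff total.I base.I ∞ proj
  proj_smul : ∀ (t : ℝˣ) (p : total), proj (t • p) = proj p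
  locally_trivial : ∀ x₀ : base, ∃ e : Trivialization ℝˣ proj, x₀ ∈ e.baseSet ∧
    ContMDiffOn total.I (base.I.prod 𝓘(ℝ, ℝ)) ∞ e e.source ∧
    ContMDiffOn (base.I.prod 𝓘(ℝ, ℝ)) total.I ∞ e.toOpenPartialHomeomorph.symm e.target ∧
    ∀ p ∈ e.source, ∀ t : ℝˣ, e (t • p) = (proj p, t * (e p).2)

attribute [instance] HomogeneousManifold.action HomogeneousManifold.smooth_action

/-- The homogeneous manifold `L^* \ 0` associated with a line bundle `L`. -/
abbrev LineBundle.slitDual (L : LineBundle.{u}) : HomogeneousManifold.{u} where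
  total := L.slitMfd
  base := L.base
  proj := LineBundle.slitProj
  smooth_proj := LineBundle.contMDiff_slitProj
  proj_smul _ _ := rfl
  locally_trivial x₀ := ⟨LineBundle.slitTriv x₀, FiberBundle.mem_baseSet_trivializationAt' x₀,
    (LineBundle.contMDiff_slitProj.contMDiffOn).prodMk (LineBundle.contMDiffOn_slitUnit x₀),
    LineBundle.contMDiffOn_slitSymm x₀,
    fun _ hp t => Prod.ext rfl (LineBundle.slitUnit_smul t hp)⟩

/-- `[V, W] f = V (W f) - W (V f)`. -/
theorem mvfderiv_mlieBracket {E H M : Type*} [NormedAddCommGroup E] [NormedSpace ℝ E]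
    [CompleteSpace E]
    [TopologicalSpace H] {I : ModelWithCorners ℝ E H} [I.Boundaryless] [TopologicalSpace M]
    [ChartedSpace H M] [IsManifold I ∞ M] {V W : ∀ p : M, TangentSpace I p}
    (hV : ContMDiff I I.tangent ∞ (fun p => (⟨p, V p⟩ : TangentBundle I M)))
    (hW : ContMDiff I I.tangent ∞ (fun p => (⟨p, W p⟩ : TangentBundle I M)))
    {f : M → ℝ} (hf : ContMDiff I 𝓘(ℝ, ℝ) ∞ f) (x : M) :
    mvfderiv I f x (mlieBracket I V W x) =
      mvfderiv I (fun y => mvfderiv I f y (W y)) x (V x) -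
        mvfderiv I (fun y => mvfderiv I f y (V y)) x (W x) := by
  set φ := extChartAt I x with hφ
  let P : (∀ p : M, TangentSpace I p) → E → E :=
    fun U => mpullbackWithin 𝓘(ℝ, E) I φ.symm U (Set.range I)
  set f' : E → ℝ := f ∘ φ.symm with hf'
  have htar : φ.target ∈ nhds (φ x) := extChartAt_target_mem_nhds x
  have hsrc : φ.source ∈ nhds x := extChartAt_source_mem_nhds x
  have key : ∀ (g : M → ℝ) (U : ∀ p : M, TangentSpace I p) (p : M), p ∈ φ.source →
      MDifferentiableAt I 𝓘(ℝ, ℝ) g p →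
      mvfderiv I g p (U p) = fderiv ℝ (g ∘ φ.symm) (φ p) (P U (φ p)) := by
    intro g U p hp hg
    obtain ⟨y, hy, rfl⟩ : ∃ y ∈ φ.target, φ.symm y = p := ⟨φ p, φ.map_source hp, φ.left_inv hp⟩
    rw [φ.right_inv hy]
    have hi := isInvertible_mfderivWithin_extChartAt_symm (I := I) hy
    have hs : MDifferentiableAt 𝓘(ℝ, E) I φ.symm y := by
      have := mdifferentiableWithinAt_extChartAt_symm (I := I) hy
      rwa [I.range_eq_univ, mdifferentiableWithinAt_univ] at this
    have hc := mfderiv_comp y hg hs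
    rw [mfderiv_eq_fderiv] at hc
    rw [hc]
    simp only [P]
    rw [mpullbackWithin_apply, I.range_eq_univ, mfderivWithin_univ]
    rw [I.range_eq_univ, mfderivWithin_univ] at hi
    obtain ⟨e, he⟩ := hi
    rw [← he, ContinuousLinearMap.inverse_equiv]
    change mfderiv I 𝓘(ℝ, ℝ) g (φ.symm y) (U (φ.symm y)) =
      mfderiv I 𝓘(ℝ, ℝ) g (φ.symm y) (e (e.symm (U (φ.symm y))))
    rw [e.apply_symm_apply]
  have hf'C : ContDiffAt ℝ ∞ f' (φ x) := by
    have h1 : ContMDiffAt 𝓘(ℝ, E) I ∞ φ.symm (φ x) :=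
      (contMDiffOn_extChartAt_symm x).contMDiffAt htar
    exact (hf.contMDiffAt.comp (φ x) h1).contDiffAt
  have hd : DifferentiableAt ℝ (fderiv ℝ f') (φ x) :=
    (hf'C.fderiv_right (m := 1) (by rw [one_add_one_eq_two]; exact ENat.LEInfty.out)).differentiableAt (by simp)
  have hP : ∀ U : ∀ p : M, TangentSpace I p,
      ContMDiff I I.tangent ∞ (fun p => (⟨p, U p⟩ : TangentBundle I M)) →
      DifferentiableAt ℝ (P U) (φ x) := by
    intro U hU
    have h1 := ((hU.mdifferentiable (by simp)) x).mdifferentiableWithinAt (s := Set.univ)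
    have h2 := h1.differentiableWithinAt_mpullbackWithin_vectorField
    rw [Set.preimage_univ, Set.univ_inter] at h2
    exact h2.differentiableAt (by rw [I.range_eq_univ]; exact Filter.univ_mem)
  have hsec : ∀ A B : ∀ p : M, TangentSpace I p,
      ContMDiff I I.tangent ∞ (fun p => (⟨p, B p⟩ : TangentBundle I M)) →
      mvfderiv I (fun y => mvfderiv I f y (B y)) x (A x) =
        fderiv ℝ (fderiv ℝ f') (φ x) (P A (φ x)) (P B (φ x)) +
          fderiv ℝ f' (φ x) (fderiv ℝ (P B) (φ x) (P A (φ x))) := by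
    intro A B hB
    set h : E → ℝ := fun z => fderiv ℝ f' z (P B z) with hh
    have hhd : DifferentiableAt ℝ h (φ x) := hd.clm_apply (hP B hB)
    have heq : (fun y => mvfderiv I f y (B y)) =ᶠ[nhds x] h ∘ φ := by
      filter_upwards [hsrc] with p hp
      exact key f B p hp (hf.mdifferentiable (by simp) p)
    have hφd : MDifferentiableAt I 𝓘(ℝ, E) φ x := mdifferentiableAt_extChartAt (mem_chart_source H x)
    have hmd : MDifferentiableAt I 𝓘(ℝ, ℝ) (fun y => mvfderiv I f y (B y)) x :=
      (hhd.mdifferentiableAt.comp x hφd).congr_of_eventuallyEq heq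
    rw [key _ A x (mem_extChartAt_source x) hmd]
    have heq2 : (fun y => mvfderiv I f y (B y)) ∘ φ.symm =ᶠ[nhds (φ x)] h := by
      filter_upwards [htar] with z hz
      have := key f B (φ.symm z) (φ.map_target hz) (hf.mdifferentiable (by simp) _)
      rw [φ.right_inv hz] at this
      exact this
    rw [heq2.fderiv_eq, hh, fderiv_clm_apply hd (hP B hB)]
    simp [add_comm]
  rw [hsec V W hW, hsec W V hV]
  have hsymm : IsSymmSndFDerivAt ℝ f' (φ x) := hf'C.isSymmSndFDerivAt (by simpa using ENat.LEInfty.out)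
  have hbr : mvfderiv I f x (mlieBracket I V W x) =
      fderiv ℝ f' (φ x) (fderiv ℝ (P W) (φ x) (P V (φ x)) - fderiv ℝ (P V) (φ x) (P W (φ x))) := by
    have hfe : f =ᶠ[nhds x] f' ∘ φ := by
      filter_upwards [hsrc] with p hp
      simp only [hf', Function.comp, φ.left_inv hp]
    have hφd : MDifferentiableAt I 𝓘(ℝ, E) φ x := mdifferentiableAt_extChartAt (mem_chart_source H x)
    have hf'd : DifferentiableAt ℝ f' (φ x) := hf'C.differentiableAt (by simp)
    have hm : ∀ u : E, mvfderiv I f x u = fderiv ℝ f' (φ x) u := by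
      intro u
      change mfderiv I 𝓘(ℝ, ℝ) f x u = _
      rw [hfe.mfderiv_eq, mfderiv_comp x hf'd.mdifferentiableAt hφd, mfderiv_extChartAt_self,
        mfderiv_eq_fderiv]
      rfl
    refine (hm _).trans (congrArg (fderiv ℝ f' (φ x)) ?_)
    have hA : ∀ T : E →L[ℝ] E, T = ContinuousLinearMap.id ℝ E → ∀ u, T.inverse u = u := by
      rintro _ rfl u
      rw [ContinuousLinearMap.inverse_id]
      rfl
    refine (hA (mfderiv I 𝓘(ℝ, E) φ x) mfderiv_extChartAt_self _).trans ?_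
    have hB : (extChartAt I x).symm ⁻¹' Set.univ ∩ Set.range I = Set.univ := by
      rw [I.range_eq_univ, Set.preimage_univ, Set.univ_inter]
    have hC : lieBracketWithin ℝ (P V) (P W) Set.univ (φ x) =
        fderiv ℝ (P W) (φ x) (P V (φ x)) - fderiv ℝ (P V) (φ x) (P W (φ x)) := by
      rw [lieBracketWithin_univ, lieBracket]
    rw [← hC, ← hB]
  rw [hbr, map_sub, hsymm.eq]
  ring

/-- The derivative of a smooth function along a smooth vector field is smooth. -/
theorem SmoothMfd.IsSmoothField.contMDiff_mvfderiv {N : SmoothMfd.{u}}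
    {V : ∀ p : N, TangentSpace N.I p} (hV : N.IsSmoothField V) {f : N → ℝ}
    (hf : ContMDiff N.I 𝓘(ℝ, ℝ) ∞ f) :
    ContMDiff N.I 𝓘(ℝ, ℝ) ∞ (fun y => mvfderiv N.I f y (V y)) := by
  have h1 : ContMDiff N.I.tangent 𝓘(ℝ, ℝ).tangent ∞ (tangentMap N.I 𝓘(ℝ, ℝ) f) :=
    hf.contMDiff_tangentMap (by simp)
  exact (contMDiff_snd_tangentBundle_modelSpace ℝ 𝓘(ℝ, ℝ)).comp (h1.comp hV)

namespace LineBundle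

variable (L : LineBundle.{u})

/-- `X` is a symbol of the operator `D` on sections: `D (f λ) = X(f) λ + f D λ`. -/
def IsSymbol (D : Module.End ℝ L.Section) (X : ∀ x : L.base, TangentSpace L.base.I x) : Prop :=
  ∀ (f : L.Fun) (s : L.Section) (x : L.base),
    D (f • s) x = mvfderiv L.base.I f x (X x) • s x + f x • D s x

/-- The real vector space of derivations of `L`, i.e. of smooth sections of the gauge algebroid:
linear operators on sections which have a smooth vector field as symbol. -/
def Der : Submodule ℝ (Module.End ℝ L.Section) where
  carrier := {D | ∃ X, L.base.IsSmoothField X ∧ L.IsSymbol D X}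
  zero_mem' := ⟨fun _ => 0, contMDiff_zeroSection ℝ (TangentSpace L.base.I), fun f s x => by simp⟩
  add_mem' := by
    rintro D₁ D₂ ⟨X₁, hX₁, h₁⟩ ⟨X₂, hX₂, h₂⟩
    refine ⟨X₁ + X₂, ContMDiff.add_section hX₁ hX₂, fun f s x => ?_⟩
    simp only [LinearMap.add_apply, ContMDiffSection.coe_add, Pi.add_apply, h₁ f s x, h₂ f s x,
      map_add]
    module
  smul_mem' := by
    rintro c D ⟨X, hX, h⟩
    refine ⟨c • X, ContMDiff.const_smul_section hX, fun f s x => ?_⟩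
    simp only [LinearMap.smul_apply, ContMDiffSection.coe_smul, Pi.smul_apply, h f s x,
      map_smul, smul_eq_mul]
    module

variable {L}

theorem Der.commutator_mem (D₁ D₂ : L.Der) : D₁.1 * D₂.1 - D₂.1 * D₁.1 ∈ L.Der := by
  obtain ⟨D₁, X₁, hX₁, h₁⟩ := D₁
  obtain ⟨D₂, X₂, hX₂, h₂⟩ := D₂
  refine ⟨mlieBracket L.base.I X₁ X₂, ?_, fun f s x => ?_⟩
  · have : IsManifold L.base.I (((⊤ : ℕ∞) : WithTop ℕ∞) + 1) L.base.carrier :=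
      inferInstanceAs (IsManifold L.base.I ∞ L.base.carrier)
    have : IsManifold L.base.I (minSmoothness ℝ 2) L.base.carrier := by
      rw [minSmoothness_of_isRCLikeNormedField]; infer_instance
    exact ContDiff.mlieBracket_vectorField (m := ⊤) (n := ⊤) hX₁ hX₂
      (by rw [minSmoothness_of_isRCLikeNormedField]; exact le_rfl)
  · let g₁ : L.Fun := ⟨fun y => mvfderiv L.base.I f y (X₁ y), hX₁.contMDiff_mvfderiv f.contMDiff⟩
    let g₂ : L.Fun := ⟨fun y => mvfderiv L.base.I f y (X₂ y), hX₂.contMDiff_mvfderiv f.contMDiff⟩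
    have e₂ : D₂ (f • s) = g₂ • s + f • D₂ s := by
      ext y; exact h₂ f s y
    have e₁ : D₁ (f • s) = g₁ • s + f • D₁ s := by
      ext y; exact h₁ f s y
    have h₁₂ : D₁ (D₂ (f • s)) x = mvfderiv L.base.I g₂ x (X₁ x) • s x + g₂ x • D₁ s x +
        (g₁ x • D₂ s x + f x • D₁ (D₂ s) x) := by
      rw [e₂, map_add, ContMDiffSection.coe_add, Pi.add_apply, h₁, h₁]; rfl
    have h₂₁ : D₂ (D₁ (f • s)) x = mvfderiv L.base.I g₁ x (X₂ x) • s x + g₁ x • D₂ s x +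
        (g₂ x • D₁ s x + f x • D₂ (D₁ s) x) := by
      rw [e₁, map_add, ContMDiffSection.coe_add, Pi.add_apply, h₂, h₂]; rfl
    have hb : mvfderiv L.base.I f x (mlieBracket L.base.I X₁ X₂ x) =
        mvfderiv L.base.I g₂ x (X₁ x) - mvfderiv L.base.I g₁ x (X₂ x) :=
      mvfderiv_mlieBracket hX₁ hX₂ f.contMDiff x
    rw [hb]
    change D₁ (D₂ (f • s)) x - D₂ (D₁ (f • s)) x = _ • s x + f x • (D₁ (D₂ s) x - D₂ (D₁ s) x)
    rw [h₁₂, h₂₁]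
    module

/-- The commutator bracket of derivations, i.e. the Lie bracket of the gauge algebroid. -/
instance : Bracket L.Der L.Der := ⟨fun D₁ D₂ => ⟨_, Der.commutator_mem D₁ D₂⟩⟩

variable (L)

/-- The fibre `D_x L` of the gauge algebroid: the linear maps `δ : Γ(L) → L_x` such that
`δ (f λ) = v(f) λ_x + f(x) δ λ` for some tangent vector `v` at `x`. -/
def gaugeFiber (x : L.base) : Submodule ℝ (L.Section →ₗ[ℝ] L.fiber x) where
  carrier := {δ | ∃ v : TangentSpace L.base.I x, ∀ (f : L.Fun) (s : L.Section),
    δ (f • s) = mvfderiv L.base.I f x v • s x + f x • δ s}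
  zero_mem' := ⟨0, fun f s => by simp⟩
  add_mem' := by
    rintro δ₁ δ₂ ⟨v₁, h₁⟩ ⟨v₂, h₂⟩
    refine ⟨v₁ + v₂, fun f s => ?_⟩
    simp only [LinearMap.add_apply, h₁ f s, h₂ f s, map_add]
    module
  smul_mem' := by
    rintro c δ ⟨v, h⟩
    refine ⟨c • v, fun f s => ?_⟩
    simp only [LinearMap.smul_apply, h f s, map_smul, smul_eq_mul]
    module

/-- Evaluation of sections at a point. -/
def evalAt (x : L.base) : L.Section →ₗ[ℝ] L.fiber x where
  toFun s := s x
  map_add' _ _ := rfl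
  map_smul' _ _ := rfl

variable {L}

/-- The value at `x` of a derivation, as an element of `D_x L`. -/
def evalDer (D : L.Der) (x : L.base) : L.gaugeFiber x :=
  ⟨L.evalAt x ∘ₗ D.1, by
    obtain ⟨X, -, hX⟩ := D.2
    exact ⟨X x, fun f s => hX f s x⟩⟩

end LineBundle

/-- A smooth vector bundle endomorphism of the gauge algebroid `D L`: linear endomorphisms of the
fibres which map smooth sections of `D L` (i.e. derivations) to smooth sections. -/
structure GaugeEndomorphism (L : LineBundle.{u}) where
  toFun : ∀ x : L.base, L.gaugeFiber x →ₗ[ℝ] L.gaugeFiber x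
  smooth : ∀ D : L.Der, ∃ D' : L.Der, ∀ x, LineBundle.evalDer D' x = toFun x (LineBundle.evalDer D x)

/-- The action of a bundle endomorphism of `D L` on sections. -/
def GaugeEndomorphism.onDer {L : LineBundle.{u}} (K : GaugeEndomorphism L) (D : L.Der) : L.Der :=
  (K.smooth D).choose

theorem GaugeEndomorphism.onDer_at {L : LineBundle.{u}} (K : GaugeEndomorphism L) (D : L.Der)
    (x : L.base) : LineBundle.evalDer (K.onDer D) x = K.toFun x (LineBundle.evalDer D x) :=
  (K.smooth D).choose_spec x

/-- A complex Atiyah structure on `L`: a fibrewise complex structure on the gauge algebroid of `L`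
whose Lie algebroid Nijenhuis torsion vanishes. -/
structure ComplexAtiyahStructure (L : LineBundle.{u}) extends GaugeEndomorphism L where
  sq : ∀ (x : L.base) (δ : L.gaugeFiber x), toFun x (toFun x δ) = -δ
  torsion : ∀ D₁ D₂ : L.Der,
    ⁅toGaugeEndomorphism.onDer D₁, toGaugeEndomorphism.onDer D₂⁆ - ⁅D₁, D₂⁆
      - toGaugeEndomorphism.onDer ⁅toGaugeEndomorphism.onDer D₁, D₂⁆
      - toGaugeEndomorphism.onDer ⁅D₁, toGaugeEndomorphism.onDer D₂⁆ = 0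

/-- A complex structure on a smooth manifold: a smooth endomorphism `J` of the tangent bundle with
`J ∘ J = -1` whose Nijenhuis torsion vanishes. -/
structure ComplexStructure (N : SmoothMfd.{u}) where
  J : ∀ p : N, TangentSpace N.I p →L[ℝ] TangentSpace N.I p
  smooth : ∀ V : ∀ p : N, TangentSpace N.I p, N.IsSmoothField V →
    N.IsSmoothField fun p => J p (V p)
  sq : ∀ (p : N) (v : TangentSpace N.I p), J p (J p v) = -v
  torsion : ∀ V W : ∀ p : N, TangentSpace N.I p, N.IsSmoothField V → N.IsSmoothField W → ∀ p : N,
    mlieBracket N.I (fun q => J q (V q)) (fun q => J q (W q)) p - mlieBracket N.I V W p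
      - J p (mlieBracket N.I (fun q => J q (V q)) W p)
      - J p (mlieBracket N.I V (fun q => J q (W q)) p) = 0

/-- A holomorphic map: a smooth map with complex linear differential. -/
def IsHolomorphic {N₁ N₂ : SmoothMfd.{u}} (J₁ : ComplexStructure N₁) (J₂ : ComplexStructure N₂)
    (f : N₁ → N₂) : Prop :=
  ContMDiff N₁.I N₂.I ∞ f ∧ ∀ (p : N₁) (v : TangentSpace N₁.I p),
    mfderiv N₁.I N₂.I f p (J₁.J p v) = J₂.J (f p) (mfderiv N₁.I N₂.I f p v)

theorem IsHolomorphic.id {N : SmoothMfd.{u}} (J : ComplexStructure N) :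
    IsHolomorphic J J (fun p => p) :=
  ⟨contMDiff_id, fun p v => by
    change mfderiv N.I N.I _root_.id p _ = J.J p (mfderiv N.I N.I _root_.id p v)
    rw [mfderiv_id]; rfl⟩

theorem IsHolomorphic.comp {N₁ N₂ N₃ : SmoothMfd.{u}} {J₁ : ComplexStructure N₁}
    {J₂ : ComplexStructure N₂} {J₃ : ComplexStructure N₃} {f : N₁ → N₂} {g : N₂ → N₃}
    (hg : IsHolomorphic J₂ J₃ g) (hf : IsHolomorphic J₁ J₂ f) :
    IsHolomorphic J₁ J₃ (fun p => g (f p)) := by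
  refine ⟨hg.1.comp hf.1, fun p v => ?_⟩
  have h := mfderiv_comp p (hg.1.mdifferentiable (by simp) (f p)) (hf.1.mdifferentiable (by simp) p)
  change mfderiv N₁.I N₃.I (g ∘ f) p _ = J₃.J (g (f p)) (mfderiv N₁.I N₃.I (g ∘ f) p v)
  rw [h]
  exact (congrArg (mfderiv N₂.I N₃.I g (f p)) (hf.2 p v)).trans (hg.2 (f p) _)

/-- A complex structure `J` is homogeneous (of degree `0`) if `h_t^* J = J` for all `t`, where `h_t`
is the action of `t`. -/
def ComplexStructure.IsHomogeneous {P : HomogeneousManifold.{u}} (J : ComplexStructure P.total) :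
    Prop :=
  ∀ (t : ℝˣ) (p : P.total) (v : TangentSpace P.total.I p),
    mfderiv P.total.I P.total.I (fun q : P.total => t • q) p (J.J p v) =
      J.J (t • p) (mfderiv P.total.I P.total.I (fun q : P.total => t • q) p v)

/-- A homogeneous manifold with a homogeneous complex structure. -/
structure HomogeneousComplexManifold extends HomogeneousManifold.{u} where
  complex : ComplexStructure total
  homogeneous : complex.IsHomogeneous (P := toHomogeneousManifold)

namespace HomogeneousComplexManifold

/-- The equivariant holomorphic maps. -/
@[ext] structure Hom (P Q : HomogeneousComplexManifold.{u}) : Type u where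
  toFun : P.total → Q.total
  holomorphic : IsHolomorphic P.complex Q.complex toFun
  equivariant : ∀ (t : ℝˣ) (p : P.total), toFun (t • p) = t • toFun p

instance : Category HomogeneousComplexManifold.{u} where
  Hom := Hom
  id P := ⟨fun p => p, IsHolomorphic.id _, fun _ _ => rfl⟩
  comp f g := ⟨fun p => g.toFun (f.toFun p), g.holomorphic.comp f.holomorphic, fun t p => by
    rw [f.equivariant, g.equivariant]⟩

end HomogeneousComplexManifold

namespace LineBundle

/-- A morphism of line bundles: a smooth bundle map which is an isomorphism on each fibre. -/
@[ext] structure Hom (L₁ L₂ : LineBundle.{u}) : Type u where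
  base : L₁.base → L₂.base
  fib : ∀ x : L₁.base, L₁.fiber x ≃L[ℝ] L₂.fiber (base x)
  smooth_base : ContMDiff L₁.base.I L₂.base.I ∞ base
  smooth : ContMDiff (L₁.base.I.prod 𝓘(ℝ, ℝ)) (L₂.base.I.prod 𝓘(ℝ, ℝ)) ∞
    (fun e : TotalSpace ℝ L₁.fiber => (⟨base e.1, fib e.1 e.2⟩ : TotalSpace ℝ L₂.fiber))

namespace Hom

variable {L₁ L₂ L₃ : LineBundle.{u}}

/-- The identity morphism. -/
def id (L : LineBundle.{u}) : Hom L L where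
  base x := x
  fib x := ContinuousLinearEquiv.refl ℝ (L.fiber x)
  smooth_base := contMDiff_id
  smooth := contMDiff_id

/-- The composition of morphisms. -/
def comp (F : Hom L₁ L₂) (G : Hom L₂ L₃) : Hom L₁ L₃ where
  base x := G.base (F.base x)
  fib x := (F.fib x).trans (G.fib (F.base x))
  smooth_base := G.smooth_base.comp F.smooth_base
  smooth := G.smooth.comp F.smooth

/-- The coefficient of a morphism with respect to local frames. -/
def coeff (F : Hom L₁ L₂) (x₀ x : L₁.base) : ℝ :=
  (trivializationAt ℝ L₂.fiber (F.base x₀) ⟨F.base x, F.fib x (L₁.frame x₀ x)⟩).2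

theorem frame_contMDiffAt {L : LineBundle.{u}} (x₀ : L.base) :
    ContMDiffAt L.base.I (L.base.I.prod 𝓘(ℝ, ℝ)) ∞
      (fun x => (⟨x, L.frame x₀ x⟩ : TotalSpace ℝ L.fiber)) x₀ := by
  rw [contMDiffAt_section]
  refine (contMDiffAt_const (c := (1 : ℝ))).congr_of_eventuallyEq ?_
  filter_upwards [(trivializationAt ℝ L.fiber x₀).open_baseSet.mem_nhds
    (FiberBundle.mem_baseSet_trivializationAt' x₀)] with x hx
  exact L.triv_frame hx

theorem coeff_contMDiffAt (F : Hom L₁ L₂) (x₀ : L₁.base) :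
    ContMDiffAt L₁.base.I 𝓘(ℝ, ℝ) ∞ (F.coeff x₀) x₀ := by
  have h := (F.smooth _).comp x₀ (frame_contMDiffAt x₀)
  exact ((contMDiffAt_totalSpace (F := ℝ) (E := L₂.fiber)).1 h).2

theorem base_mem (F : Hom L₁ L₂) (x₀ : L₁.base) : ∀ᶠ x in nhds x₀,
    F.base x ∈ (trivializationAt ℝ L₂.fiber (F.base x₀)).baseSet :=
  F.smooth_base.continuous.continuousAt.eventually_mem
    ((trivializationAt ℝ L₂.fiber (F.base x₀)).open_baseSet.mem_nhds
      (FiberBundle.mem_baseSet_trivializationAt' _))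

theorem fib_frame (F : Hom L₁ L₂) {x₀ x : L₁.base}
    (h : F.base x ∈ (trivializationAt ℝ L₂.fiber (F.base x₀)).baseSet) :
    F.fib x (L₁.frame x₀ x) = F.coeff x₀ x • L₂.frame (F.base x₀) (F.base x) :=
  L₂.frame_eq h _

theorem frame_ne_zero {L : LineBundle.{u}} {x₀ x : L.base}
    (h : x ∈ (trivializationAt ℝ L.fiber x₀).baseSet) : L.frame x₀ x ≠ 0 := by
  intro h0
  have h1 := L.triv_frame h
  rw [h0, ← Trivialization.continuousLinearMapAt_apply_of_mem (R := ℝ) _ h, map_zero] at h1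
  exact zero_ne_one h1

theorem coeff_ne_zero (F : Hom L₁ L₂) {x₀ x : L₁.base}
    (h₁ : x ∈ (trivializationAt ℝ L₁.fiber x₀).baseSet)
    (h : F.base x ∈ (trivializationAt ℝ L₂.fiber (F.base x₀)).baseSet) : F.coeff x₀ x ≠ 0 := by
  intro h0
  have h2 := F.fib_frame h
  rw [h0, zero_smul, ContinuousLinearEquiv.map_eq_zero_iff] at h2
  exact frame_ne_zero h₁ h2

theorem symm_frame (F : Hom L₁ L₂) {x₀ x : L₁.base}
    (h₁ : x ∈ (trivializationAt ℝ L₁.fiber x₀).baseSet)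
    (h : F.base x ∈ (trivializationAt ℝ L₂.fiber (F.base x₀)).baseSet) :
    (F.fib x).symm (L₂.frame (F.base x₀) (F.base x)) = (F.coeff x₀ x)⁻¹ • L₁.frame x₀ x := by
  rw [ContinuousLinearEquiv.symm_apply_eq, map_smul, F.fib_frame h, smul_smul,
    inv_mul_cancel₀ (F.coeff_ne_zero h₁ h), one_smul]

theorem contMDiff_pullback (F : Hom L₁ L₂) (s : L₂.Section) :
    ContMDiff L₁.base.I (L₁.base.I.prod 𝓘(ℝ, ℝ)) ∞
      (fun x => (⟨x, (F.fib x).symm (s (F.base x))⟩ : TotalSpace ℝ L₁.fiber)) := by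
  intro x₀
  rw [contMDiffAt_section]
  have h := ((contMDiffAt_section _).1 (s.contMDiff (F.base x₀))).comp x₀ (F.smooth_base x₀)
  have hc := (F.coeff_contMDiffAt x₀).inv₀ (F.coeff_ne_zero
    (FiberBundle.mem_baseSet_trivializationAt' x₀) (FiberBundle.mem_baseSet_trivializationAt' _))
  refine (hc.mul h).congr_of_eventuallyEq ?_
  filter_upwards [F.base_mem x₀, (trivializationAt ℝ L₁.fiber x₀).open_baseSet.mem_nhds
    (FiberBundle.mem_baseSet_trivializationAt' x₀)] with x hx hx₁
  have e := L₂.frame_eq hx (s (F.base x))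
  rw [e, map_smul, F.symm_frame hx₁ hx, smul_smul]
  rw [← Trivialization.continuousLinearMapAt_apply_of_mem (R := ℝ) _ hx₁, map_smul,
    Trivialization.continuousLinearMapAt_apply_of_mem (R := ℝ) _ hx₁, L₁.triv_frame hx₁]
  simp [mul_comm]

/-- The pull-back of sections `(F^* λ)_x = F_x⁻¹ λ_{F(x)}`. -/
def pullback (F : Hom L₁ L₂) : L₂.Section →ₗ[ℝ] L₁.Section where
  toFun s := ⟨fun x => (F.fib x).symm (s (F.base x)), F.contMDiff_pullback s⟩
  map_add' s t := by ext x; exact map_add (F.fib x).symm _ _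
  map_smul' c s := by ext x; exact map_smul (F.fib x).symm c _

theorem pullback_apply (F : Hom L₁ L₂) (s : L₂.Section) (x : L₁.base) :
    F.pullback s x = (F.fib x).symm (s (F.base x)) := rfl

/-- The map `D F : D L₁ → D L₂` on gauge algebroids: `(D F δ) λ = F_x (δ (F^* λ))`. -/
def gaugeMap (F : Hom L₁ L₂) (x : L₁.base) : L₁.gaugeFiber x →ₗ[ℝ] L₂.gaugeFiber (F.base x) where
  toFun δ := ⟨(F.fib x).toLinearEquiv.toLinearMap ∘ₗ δ.1 ∘ₗ F.pullback, by
    obtain ⟨δ, v, h⟩ := δ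
    refine ⟨mfderiv L₁.base.I L₂.base.I F.base x v, fun f s => ?_⟩
    let g : L₁.Fun := ⟨fun y => f (F.base y), f.contMDiff.comp F.smooth_base⟩
    have hp : F.pullback (f • s) = g • F.pullback s := by
      ext y; exact map_smul (F.fib y).symm (f (F.base y)) _
    have hd : mvfderiv L₁.base.I g x v =
        mvfderiv L₂.base.I f (F.base x) (mfderiv L₁.base.I L₂.base.I F.base x v) := by
      have h' := mfderiv_comp x (f.contMDiff.mdifferentiable (by simp) (F.base x))
        (F.smooth_base.mdifferentiable (by simp) x)
      exact congrArg (fun T => T v) h'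
    change F.fib x (δ (F.pullback (f • s))) = _ • s (F.base x) +
      f (F.base x) • F.fib x (δ (F.pullback s))
    rw [hp, h, map_add, map_smul, map_smul, pullback_apply, ContinuousLinearEquiv.apply_symm_apply,
      hd]
    rfl⟩
  map_add' δ₁ δ₂ := by ext s; exact map_add (F.fib x) _ _
  map_smul' c δ := by ext s; exact map_smul (F.fib x) c _

theorem gaugeMap_id (L : LineBundle.{u}) (x : L.base) (δ : L.gaugeFiber x) :
    (Hom.id L).gaugeMap x δ = δ := rfl

theorem gaugeMap_comp (F : Hom L₁ L₂) (G : Hom L₂ L₃) (x : L₁.base) (δ : L₁.gaugeFiber x) :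
    (F.comp G).gaugeMap x δ = G.gaugeMap (F.base x) (F.gaugeMap x δ) := rfl

/-- The map `L₁^* \ 0 → L₂^* \ 0`, `(x, ε) ↦ (F(x), ε ∘ F_x⁻¹)`. -/
def slitMap (F : Hom L₁ L₂) (p : L₁.slit) : L₂.slit :=
  ⟨⟨F.base p.1.1, p.1.2.comp ((F.fib p.1.1).symm : L₂.fiber (F.base p.1.1) →L[ℝ] L₁.fiber p.1.1)⟩,
    fun h => p.2 (by
      ext v
      have := congrArg (fun T => T (F.fib p.1.1 v)) h
      simpa using this)⟩

theorem contMDiff_slitMap (F : Hom L₁ L₂) : ContMDiff L₁.dualModel L₂.dualModel ∞ F.slitMap := by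
  intro p
  have h1 := FiberBundle.mem_baseSet_trivializationAt' (F := ℝ) (E := L₁.fiber) p.1.1
  have h2 := FiberBundle.mem_baseSet_trivializationAt' (F := ℝ) (E := L₂.fiber) (F.base p.1.1)
  have hi := (slit_contMDiffAt_iff (I := L₁.dualModel) (f := _root_.id) (y := p) p.1.1 h1).1
    contMDiffAt_id
  rw [slit_contMDiffAt_iff (F.base p.1.1) h2]
  refine ⟨(F.smooth_base _).comp p hi.1, ?_⟩
  have hc := ((F.coeff_contMDiffAt p.1.1).inv₀ (F.coeff_ne_zero h1 h2)).comp p hi.1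
  refine (hc.mul hi.2).congr_of_eventuallyEq ?_
  have hcont : ContinuousAt (fun q : L₁.slit => q.1.1) p := hi.1.continuousAt
  filter_upwards [hcont.eventually (F.base_mem p.1.1), hcont.eventually_mem
    ((trivializationAt ℝ L₁.fiber p.1.1).open_baseSet.mem_nhds h1)] with q hq hq₁
  change (q.1.2 ((F.fib q.1.1).symm (L₂.frame (F.base p.1.1) (F.base q.1.1))) : ℝ) = _
  rw [F.symm_frame hq₁ hq, map_smul]
  rfl

theorem slitMap_smul (F : Hom L₁ L₂) (t : ℝˣ) (p : L₁.slit) :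
    F.slitMap (t • p) = t • F.slitMap p := rfl

end Hom

end LineBundle

/-- An odd complex manifold: a line bundle with a complex Atiyah structure. -/
structure OddComplexManifold : Type (u + 1) where
  line : LineBundle.{u}
  atiyah : ComplexAtiyahStructure line

namespace OddComplexManifold

/-- The odd holomorphic maps: morphisms of line bundles `F` with `D F ∘ K₁ = K₂ ∘ D F`. -/
@[ext] structure Hom (X Y : OddComplexManifold.{u}) : Type u where
  toHom : LineBundle.Hom X.line Y.line
  holomorphic : ∀ (x : X.line.base) (δ : X.line.gaugeFiber x),
    toHom.gaugeMap x (X.atiyah.toFun x δ) = Y.atiyah.toFun (toHom.base x) (toHom.gaugeMap x δ)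

instance : Category OddComplexManifold.{u} where
  Hom := Hom
  id X := ⟨LineBundle.Hom.id X.line, fun _ _ => rfl⟩
  comp F G := ⟨F.toHom.comp G.toHom, fun x δ => by
    rw [LineBundle.Hom.gaugeMap_comp, F.holomorphic]
    exact G.holomorphic _ _⟩

end OddComplexManifold

namespace LineBundle

variable {L : LineBundle.{u}}

/-- The function `λ̃` on `L^* \ 0` corresponding to a section `λ`: `λ̃(ε) = ⟨ε, λ_x⟩`. -/
def liftSection (s : L.Section) (p : L.slit) : ℝ := p.1.2 (s p.1.1)

/-- The vector field `V` on `L^* \ 0` is the lift `D̃` of the derivation `D`: it maps `λ̃` to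
`(D λ)~` for every section `λ`. -/
def IsLift (D : L.Der) (V : ∀ p : L.slit, TangentSpace L.dualModel p) : Prop :=
  ∀ (s : L.Section) (p : L.slit),
    mvfderiv L.dualModel (liftSection s) p (V p) = liftSection (D.1 s) p

/-- The complex structure `J` on `L^* \ 0` is a lift of the complex Atiyah structure `K`:
`(K D)~ = J D̃` for all derivations `D`. -/
def IsLiftStructure (K : ComplexAtiyahStructure L) (J : ComplexStructure L.slitDual.total) : Prop :=
  ∀ (D : L.Der) (V : ∀ p : L.slit, TangentSpace L.dualModel p), L.slitMfd.IsSmoothField V →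
    IsLift D V → IsLift (K.onDer D) (fun p => J.J p (V p))

end LineBundle

/-- The functor sending `(L, K)` to `L^* \ 0` with the structure `κ L K`, and a morphism `F` to the
map `(x, ε) ↦ (F(x), ε ∘ F_x⁻¹)`. -/
def coneFunctor
    (κ : ∀ L : LineBundle.{u}, ComplexAtiyahStructure L → ComplexStructure L.slitDual.total)
    (hκ : ∀ (L : LineBundle.{u}) (K : ComplexAtiyahStructure L),
      (κ L K).IsHomogeneous (P := L.slitDual))
    (hol : ∀ (X Y : OddComplexManifold.{u}) (F : X ⟶ Y),
      IsHolomorphic (κ X.line X.atiyah) (κ Y.line Y.atiyah) F.toHom.slitMap) :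
    OddComplexManifold.{u} ⥤ HomogeneousComplexManifold.{u} where
  obj X := ⟨X.line.slitDual, κ X.line X.atiyah, hκ _ _⟩
  map {X Y} F := ⟨F.toHom.slitMap, hol X Y F, fun _ _ => rfl⟩
  map_id _ := rfl
  map_comp _ _ := rfl

end

/-! A point `p` of `L^* \ 0` over `x` is a linear isomorphism `L_x → ℝ`. A tangent vector `w` at `p`
is therefore turned into an operator on sections, `λ ↦ p⁻¹ (w λ̃)`. Since `(f λ)~ = (f ∘ π) λ̃`,
with `π` the projection, this operator obeys the Leibniz rule with symbol `dπ(w)`, so it lies in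
`D_x L`. The resulting map `slitGauge p` from the tangent space to `D_x L` is an isomorphism,
because over a trivialising open set both sides consist of a tangent vector of the base and a number
(`slitGauge_bijective`). It does not change along the orbits of `ℝˣ`, because the factor `t` in
`λ̃(t p) = t λ̃(p)` cancels against the one in `(t p)⁻¹` (`slitGauge_smul`), and it is natural in
the line bundle (`slitGauge_slitMap`). In short, the gauge algebroid is the quotient of the tangent
bundle of `L^* \ 0` by `ℝˣ`, and every statement is read off from this.

The lift of a derivation is the field which corresponds to it at every point. Lifts are smooth, they
span every tangent space, and they respect brackets, since functions `λ̃` are enough to detect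
tangent vectors (`lift_bracket`). Conversely, a smooth invariant field is a lift
(`exists_lift_eq_of_invariant`).

A structure `K` is carried to each tangent space by `slitGauge`. The result is smooth and has
vanishing Nijenhuis torsion because both properties may be tested on a spanning family of fields:
the first by expansion in a frame, the second because the torsion is a tensor
(`SpanningFamily.nijenhuis_eq_zero`). Invariance of `slitGauge` makes the structure homogeneous, and
lets a homogeneous `J` descend to the gauge algebroid (`corresponds_gaugeOfCone`).

By naturality, a bundle map `F` is compatible with the structures on the line bundles exactly when
`F̃` is holomorphic (`isHolomorphic_slitMap_iff`). An equivariant map `φ` comes from the unique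
bundle map with fibre maps `φ(p)⁻¹ ∘ p`, so the functor is full and faithful. For essential
surjectivity, the fibre at `x` of the line bundle of a principal bundle `P` consists of the
functions on `P_x` which are homogeneous of degree `1`. Evaluation at points of `P` is an
equivariant diffeomorphism from `P` to the slit dual (`toSlit`), and the complex structure is
transported along it. -/

noncomputable section

/-! ### Vector fields, frames and Nijenhuis torsion on manifolds -/

section Manifold

variable {E H M : Type*} [NormedAddCommGroup E] [NormedSpace ℝ E] [TopologicalSpace H]
  {I : ModelWithCorners ℝ E H} [TopologicalSpace M] [ChartedSpace H M]

/-- A smooth function equal to `1` near `x` and supported in a given neighbourhood of `x`. -/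
theorem exists_contMDiff_bump [FiniteDimensional ℝ E] [T2Space M] [IsManifold I ∞ M] {x : M}
    {U : Set M} (hU : U ∈ nhds x) :
    ∃ χ : M → ℝ, ContMDiff I 𝓘(ℝ, ℝ) ∞ χ ∧ tsupport χ ⊆ U ∧ ∀ᶠ y in nhds x, χ y = 1 := by
  obtain ⟨χ, -, hχ⟩ := (SmoothBumpFunction.nhds_basis_tsupport (I := I) x).mem_iff.1 hU
  exact ⟨χ, χ.contMDiff, hχ, χ.eventuallyEq_one⟩

/-- A section of a vector bundle which is smooth near `x` agrees near `x` with a smooth section. -/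
theorem exists_contMDiff_section [FiniteDimensional ℝ E] [T2Space M] [IsManifold I ∞ M]
    {F : Type*} [NormedAddCommGroup F] [NormedSpace ℝ F] {V : M → Type*}
    [TopologicalSpace (TotalSpace F V)] [∀ x, AddCommGroup (V x)] [∀ x, Module ℝ (V x)]
    [∀ x, TopologicalSpace (V x)] [FiberBundle F V] [VectorBundle ℝ F V]
    {x : M} {U : Set M} (hU : IsOpen U) (hx : x ∈ U) {s : ∀ x, V x}
    (hs : ContMDiffOn I (I.prod 𝓘(ℝ, F)) ∞ (fun y => TotalSpace.mk' F y (s y)) U) :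
    ∃ t : ∀ x, V x, ContMDiff I (I.prod 𝓘(ℝ, F)) ∞ (fun y => TotalSpace.mk' F y (t y)) ∧
      ∀ᶠ y in nhds x, t y = s y := by
  obtain ⟨χ, hχ, hχU, hχ1⟩ := exists_contMDiff_bump (I := I) (hU.mem_nhds hx)
  refine ⟨χ • s, ContMDiffOn.smul_section_of_tsupport hχ.contMDiffOn hU hχU hs, ?_⟩
  filter_upwards [hχ1] with y hy
  simp [hy]

/-- Every vector in a fibre of a vector bundle is a value of a smooth section. -/
theorem exists_contMDiff_section_apply_eq [FiniteDimensional ℝ E] [T2Space M] [IsManifold I ∞ M]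
    {F : Type*} [NormedAddCommGroup F] [NormedSpace ℝ F] {V : M → Type*}
    [TopologicalSpace (TotalSpace F V)] [∀ x, AddCommGroup (V x)] [∀ x, Module ℝ (V x)]
    [∀ x, TopologicalSpace (V x)] [FiberBundle F V] [VectorBundle ℝ F V]
    [ContMDiffVectorBundle ∞ F V I] {x : M} (v : V x) :
    ∃ t : ∀ x, V x, ContMDiff I (I.prod 𝓘(ℝ, F)) ∞ (fun y => TotalSpace.mk' F y (t y)) ∧
      t x = v := by
  let e := trivializationAt F V x
  have hx : x ∈ e.baseSet := FiberBundle.mem_baseSet_trivializationAt' x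
  obtain ⟨t, ht, hts⟩ := exists_contMDiff_section (I := I) e.open_baseSet hx
    (s := fun y => e.symm y (e ⟨x, v⟩).2) (by
      rw [e.contMDiffOn_section_baseSet_iff]
      refine contMDiffOn_const (c := (e ⟨x, v⟩).2) |>.congr fun y hy => ?_
      rw [e.apply_mk_symm hy])
  exact ⟨t, ht, by rw [hts.self_of_nhds, e.symm_apply_apply_mk hx]⟩

/-- Smooth functions separate tangent vectors. -/
theorem eq_zero_of_mvfderiv_eq_zero [FiniteDimensional ℝ E] [T2Space M] [IsManifold I ∞ M]
    {x : M} {v : TangentSpace I x}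
    (h : ∀ f : M → ℝ, ContMDiff I 𝓘(ℝ, ℝ) ∞ f → mvfderiv I f x v = 0) : v = 0 := by
  by_contra hv
  obtain ⟨ℓ, hℓ⟩ : ∃ ℓ : E →L[ℝ] ℝ, ℓ v ≠ 0 :=
    SeparatingDual.exists_ne_zero (R := ℝ) (V := E) (x := (show E from v)) hv
  refine hℓ ?_
  obtain ⟨χ, hχ, hχU, hχ1⟩ := exists_contMDiff_bump (I := I) (chart_source_mem_nhds H x)
  have hc : ContMDiffOn I 𝓘(ℝ, ℝ) ∞ (fun y => ℓ (extChartAt I x y)) (chartAt H x).source :=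
    ℓ.contMDiff.comp_contMDiffOn contMDiffOn_extChartAt
  -- The test function is a linear form in the chart at `x`, cut off. The derivative of that chart
  -- at `x` is the identity of the model space, so the derivative of the test function along `v` is
  -- `ℓ v`.
  have hf : ContMDiff I 𝓘(ℝ, ℝ) ∞ (fun y => χ y * ℓ (extChartAt I x y)) := by
    refine contMDiff_of_tsupport fun y hy => ?_
    have hy' : y ∈ (chartAt H x).source := hχU (tsupport_mul_subset_left hy)
    exact hχ.contMDiffAt.mul (hc.contMDiffAt ((chartAt H x).open_source.mem_nhds hy'))
  have h0 := h _ hf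
  have he : (fun y => χ y * ℓ (extChartAt I x y)) =ᶠ[nhds x] ℓ ∘ extChartAt I x := by
    filter_upwards [hχ1] with y hy
    simp [hy]
  change mfderiv I 𝓘(ℝ, ℝ) _ x v = 0 at h0
  rw [he.mfderiv_eq, mfderiv_comp x ℓ.differentiableAt.mdifferentiableAt
    (mdifferentiableAt_extChartAt (mem_chart_source H x)), mfderiv_extChartAt_self,
    mfderiv_eq_fderiv, ℓ.fderiv] at h0
  exact h0

theorem eq_of_mvfderiv_eq [FiniteDimensional ℝ E] [T2Space M] [IsManifold I ∞ M]
    {x : M} {v w : TangentSpace I x}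
    (h : ∀ f : M → ℝ, ContMDiff I 𝓘(ℝ, ℝ) ∞ f → mvfderiv I f x v = mvfderiv I f x w) : v = w :=
  sub_eq_zero.1 (eq_zero_of_mvfderiv_eq_zero fun f hf => by rw [map_sub, h f hf, sub_self])

variable {E' H' M' : Type*} [NormedAddCommGroup E'] [NormedSpace ℝ E'] [TopologicalSpace H']
  {I' : ModelWithCorners ℝ E' H'} [TopologicalSpace M'] [ChartedSpace H' M']
  {E'' H'' N : Type*} [NormedAddCommGroup E''] [NormedSpace ℝ E''] [TopologicalSpace H'']
  {I'' : ModelWithCorners ℝ E'' H''} [TopologicalSpace N] [ChartedSpace H'' N]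

/-- The chain rule for the derivative of a function along a map. -/
theorem mvfderiv_comp_mfderiv {f : M' → ℝ} {φ : M → M'} {x : M}
    (hf : MDifferentiableAt I' 𝓘(ℝ, ℝ) f (φ x)) (hφ : MDifferentiableAt I I' φ x)
    (v : TangentSpace I x) :
    mvfderiv I (fun y => f (φ y)) x v = mvfderiv I' f (φ x) (mfderiv I I' φ x v) :=
  congrArg (fun T => T v) (mfderiv_comp x hf hφ)

theorem Filter.EventuallyEq.mvfderiv_eq_apply {f g : M → ℝ} {x : M} (h : f =ᶠ[nhds x] g)
    (v : TangentSpace I x) : mvfderiv I f x v = mvfderiv I g x v :=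
  congrArg (fun T : E →L[ℝ] ℝ => T v) h.mfderiv_eq

/-- A version of smoothness of the tangent map for maps which are smooth only on an open set. It
serves to push fields forward along `slitOfCoord`, the inverse of the local coordinates on `L^* \
0`. -/
theorem ContMDiffAt.tangentMap_comp [IsManifold I ∞ M] [IsManifold I' ∞ M'] {φ : M → M'}
    {g : N → TangentBundle I M} {y : N} {U : Set M} (hU : IsOpen U) (hy : (g y).1 ∈ U)
    (hφ : ContMDiffOn I I' ∞ φ U) (hg : ContMDiffAt I'' I.tangent ∞ g y) :
    ContMDiffAt I'' I'.tangent ∞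
      (fun z => (⟨φ (g z).1, mfderiv I I' φ (g z).1 (g z).2⟩ : TangentBundle I' M')) y := by
  have h1 : ContMDiffOn I.tangent I'.tangent ∞ (tangentMapWithin I I' φ U)
      (TotalSpace.proj ⁻¹' U) := hφ.contMDiffOn_tangentMapWithin (by simp) hU.uniqueMDiffOn
  have hc : Continuous (TotalSpace.proj : TangentBundle I M → M) := FiberBundle.continuous_proj _ _
  refine ((h1.contMDiffAt ((hU.preimage hc).mem_nhds hy)).comp y hg).congr_of_eventuallyEq ?_
  filter_upwards [(hc.continuousAt.comp hg.continuousAt).eventually_mem (hU.mem_nhds hy)] with z hz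
  exact (tangentMapWithin_eq_tangentMap (hU.uniqueMDiffWithinAt hz)
    ((hφ.contMDiffAt (hU.mem_nhds hz)).mdifferentiableAt (by simp))).symm

/-- In a frame of smooth vector fields the coefficients of a vector field are as regular as the
field. -/
theorem exists_frame_coeff [FiniteDimensional ℝ E] [IsManifold I ∞ M] {p : M} {ι : Type*}
    [Fintype ι] {D : ι → ∀ q : M, TangentSpace I q}
    (hD : ∀ i, ContMDiffAt I I.tangent ∞ (fun q => (⟨q, D i q⟩ : TangentBundle I M)) p)
    (b : Module.Basis ι ℝ (TangentSpace I p)) (hb : ∀ i, D i p = b i)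
    (V : ∀ q : M, TangentSpace I q) :
    ∃ c : ι → M → ℝ, (∀ᶠ q in nhds p, V q = ∑ i, c i q • D i q) ∧
      (∀ n : WithTop ℕ∞, n ≤ ∞ →
        ContMDiffAt I I.tangent n (fun q => (⟨q, V q⟩ : TangentBundle I M)) p →
          ∀ i, ContMDiffAt I 𝓘(ℝ, ℝ) n (c i) p) ∧
      (MDifferentiableAt I I.tangent (fun q => (⟨q, V q⟩ : TangentBundle I M)) p →
          ∀ i, MDifferentiableAt I 𝓘(ℝ, ℝ) (c i) p) := by
  classical
  let e := trivializationAt E (TangentSpace I : M → Type _) p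
  have hp : p ∈ e.baseSet := FiberBundle.mem_baseSet_trivializationAt' p
  -- `T q` sends coefficients to the combination of the frame fields, read in the trivialisation at
  -- `p`. It is smooth in `q` and invertible at `p`, so the coefficients of `V` are `T⁻¹` applied to
  -- `V`.
  let T : M → (ι → ℝ) →L[ℝ] E := fun q =>
    ∑ i, (ContinuousLinearMap.proj (R := ℝ) (φ := fun _ : ι => ℝ) i).smulRight (e ⟨q, D i q⟩).2
  have hTapp : ∀ q a, T q a = ∑ i, a i • (e ⟨q, D i q⟩).2 := fun q a => by
    simp [T]
  have hT : ContMDiffAt I 𝓘(ℝ, (ι → ℝ) →L[ℝ] E) ∞ T p := by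
    refine ContMDiffAt.sum fun i _ => ?_
    have h1 := (contMDiffAt_section _).1 (hD i)
    exact ((ContinuousLinearMap.smulRightL ℝ (ι → ℝ) E
      (ContinuousLinearMap.proj i)).contMDiff.contMDiffAt).comp p h1
  have hlin : ∀ q ∈ e.baseSet, ∀ a : ι → ℝ, T q a = (e ⟨q, ∑ i, a i • D i q⟩).2 := by
    intro q hq a
    rw [hTapp, ← e.continuousLinearMapAt_apply_of_mem (R := ℝ) hq, map_sum]
    refine Finset.sum_congr rfl fun i _ => ?_
    rw [map_smul, e.continuousLinearMapAt_apply_of_mem (R := ℝ) hq]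
  let L : (ι → ℝ) ≃L[ℝ] E :=
    (b.equivFun.symm.trans (e.continuousLinearEquivAt ℝ p hp).toLinearEquiv).toContinuousLinearEquiv
  have hTp : T p = L := by
    ext1 a
    rw [hlin p hp]
    simp only [hb]
    change _ = (e ⟨p, b.equivFun.symm a⟩).2
    rw [b.equivFun_symm_apply]
  -- Invertible operators form an open set, so the fields remain a frame near `p`.
  have hev : ∀ᶠ q in nhds p, T q ∈ Set.range ((↑) : ((ι → ℝ) ≃L[ℝ] E) → (ι → ℝ) →L[ℝ] E) := by
    refine hT.continuousAt.eventually_mem ?_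
    rw [hTp]
    exact ContinuousLinearEquiv.nhds L
  have hinv : ContMDiffAt I 𝓘(ℝ, E →L[ℝ] (ι → ℝ)) ∞ (fun q => (T q).inverse) p := by
    have h1 : ContDiffAt ℝ ∞ (ContinuousLinearMap.inverse : ((ι → ℝ) →L[ℝ] E) → _) (T p) := by
      rw [hTp]
      exact contDiffAt_map_inverse L
    exact h1.contMDiffAt.comp p hT
  refine ⟨fun i q => (T q).inverse (e ⟨q, V q⟩).2 i, ?_, fun n hn hV i => ?_, fun hV i => ?_⟩
  · filter_upwards [hev, e.open_baseSet.mem_nhds hp] with q hq hqb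
    obtain ⟨S, hS⟩ := hq
    have h1 : T q ((T q).inverse (e ⟨q, V q⟩).2) = (e ⟨q, V q⟩).2 := by
      rw [← hS, ContinuousLinearMap.inverse_equiv]
      simp
    rw [hlin q hqb] at h1
    refine (TotalSpace.mk_inj.1 (e.injOn (e.mem_source.2 hqb) (e.mem_source.2 hqb) 
      (?_ : e ⟨q, ∑ i, (T q).inverse (e ⟨q, V q⟩).2 i • D i q⟩ = e ⟨q, V q⟩))).symm
    refine Prod.ext ?_ h1
    rw [e.coe_fst' hqb, e.coe_fst' hqb]
  · have h1 := (contMDiffAt_section _).1 hV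
    exact (contMDiffAt_pi_space.1 ((hinv.of_le hn).clm_apply h1)) i
  · have h1 := ((e.mdifferentiableAt_section_iff I _ hp).1 hV)
    have h2 := (hinv.mdifferentiableAt (by simp)).clm_apply h1
    exact ((ContinuousLinearMap.proj (R := ℝ) (φ := fun _ : ι => ℝ) i).mdifferentiableAt).comp p h2

/-- The Nijenhuis torsion of an endomorphism of the tangent bundle. -/
def nijenhuis (J : ∀ q : M, TangentSpace I q →L[ℝ] TangentSpace I q)
    (V W : ∀ q : M, TangentSpace I q) (p : M) : TangentSpace I p :=
  mlieBracket I (fun q => J q (V q)) (fun q => J q (W q)) p - mlieBracket I V W p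
    - J p (mlieBracket I (fun q => J q (V q)) W p) - J p (mlieBracket I V (fun q => J q (W q)) p)

theorem nijenhuis_swap (J : ∀ q : M, TangentSpace I q →L[ℝ] TangentSpace I q)
    (V W : ∀ q : M, TangentSpace I q) (p : M) : nijenhuis J V W p = -nijenhuis J W V p := by
  unfold nijenhuis
  rw [mlieBracket_swap_apply, mlieBracket_swap_apply (V := V) (W := W),
    mlieBracket_swap_apply (V := fun q => J q (V q)) (W := W),
    mlieBracket_swap_apply (V := V) (W := fun q => J q (W q)), map_neg, map_neg]
  abel

/-- An endomorphism of the tangent bundle which maps the fields of a pointwise spanning family to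
smooth fields is as regular as it can be. -/
structure SpanningFamily [IsManifold I ∞ M] (𝒟 : Set (∀ q : M, TangentSpace I q))
    (J : ∀ q : M, TangentSpace I q →L[ℝ] TangentSpace I q) : Prop where
  smooth : ∀ V ∈ 𝒟, ContMDiff I I.tangent ∞ (fun q => (⟨q, V q⟩ : TangentBundle I M))
  smooth_map : ∀ V ∈ 𝒟, ContMDiff I I.tangent ∞ (fun q => (⟨q, J q (V q)⟩ : TangentBundle I M))
  spans : ∀ (p : M) (v : TangentSpace I p), ∃ V ∈ 𝒟, V p = v

namespace SpanningFamily

variable [FiniteDimensional ℝ E] [IsManifold I ∞ M] {𝒟 : Set (∀ q : M, TangentSpace I q)}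
  {J : ∀ q : M, TangentSpace I q →L[ℝ] TangentSpace I q}

/-- Members of the family which take the values of a basis at `p` form a frame near `p`. With `V = ∑
cᵢ Dᵢ`, linearity gives `J V = ∑ cᵢ J Dᵢ`, where the `cᵢ` inherit the regularity of `V` and the `J
Dᵢ` are smooth by assumption. -/
theorem contMDiffAt (h : SpanningFamily 𝒟 J) {p : M} {V : ∀ q : M, TangentSpace I q}
    (hV : ContMDiffAt I I.tangent ∞ (fun q => (⟨q, V q⟩ : TangentBundle I M)) p) :
    ContMDiffAt I I.tangent ∞ (fun q => (⟨q, J q (V q)⟩ : TangentBundle I M)) p := by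
  let b : Module.Basis _ ℝ (TangentSpace I p) := Module.finBasis ℝ E
  choose D hD hDp using fun i => h.spans p (b i)
  obtain ⟨c, hc, hc1, -⟩ := exists_frame_coeff (fun i => (h.smooth _ (hD i)).contMDiffAt) b hDp V
  have h1 : ContMDiffAt I I.tangent ∞
      (fun q => (⟨q, ∑ i, c i q • J q (D i q)⟩ : TangentBundle I M)) p :=
    ContMDiffAt.sum_section fun i _ => ContMDiffAt.smul_section (hc1 _ le_rfl hV i)
      (h.smooth_map _ (hD i)).contMDiffAt
  refine h1.congr_of_eventuallyEq ?_
  filter_upwards [hc] with q hq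
  rw [hq, map_sum]
  simp only [map_smul]

/-- Tensoriality in the sense of `TensorialAt` is tested on functions and fields which are only
differentiable at one point, so smoothness alone would not be enough. -/
theorem mdifferentiableAt (h : SpanningFamily 𝒟 J) {p : M} {V : ∀ q : M, TangentSpace I q}
    (hV : MDifferentiableAt I I.tangent (fun q => (⟨q, V q⟩ : TangentBundle I M)) p) :
    MDifferentiableAt I I.tangent (fun q => (⟨q, J q (V q)⟩ : TangentBundle I M)) p := by
  let b : Module.Basis _ ℝ (TangentSpace I p) := Module.finBasis ℝ E
  choose D hD hDp using fun i => h.spans p (b i)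
  obtain ⟨c, hc, -, hc1⟩ := exists_frame_coeff (fun i => (h.smooth _ (hD i)).contMDiffAt) b hDp V
  have h1 : MDifferentiableAt I I.tangent
      (fun q => (⟨q, ∑ i, c i q • J q (D i q)⟩ : TangentBundle I M)) p :=
    MDifferentiableAt.sum_section fun i _ => MDifferentiableAt.smul_section (hc1 hV i)
      ((h.smooth_map _ (hD i)).mdifferentiable (by simp) p)
  refine h1.congr_of_eventuallyEq ?_
  filter_upwards [hc] with q hq
  rw [hq, map_sum]
  simp only [map_smul]

/-- Replacing `V` by `f V` produces, besides the multiple by `f`, the terms `-(JW f) JV` and `(W f)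
V` from the first two brackets and `(W f) J(JV) = -(W f) V` and `(JW f) JV` from the last two. They
cancel. -/
theorem tensorialAt_nijenhuis [CompleteSpace E] (h : SpanningFamily 𝒟 J)
    (hJ : ∀ (q : M) (v : TangentSpace I q), J q (J q v) = -v) {p : M}
    (W : ∀ q : M, TangentSpace I q) :
    TensorialAt I E (fun V => nijenhuis J V W p) p where
  smul {f V} hf hV := by
    have e : (fun q => J q ((f • V) q)) = f • fun q => J q (V q) := by
      ext1 q; exact map_smul (J q) (f q) (V q)
    unfold nijenhuis
    rw [e, mlieBracket_smul_left hf (h.mdifferentiableAt hV), mlieBracket_smul_left hf hV,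
      mlieBracket_smul_left hf (h.mdifferentiableAt hV), mlieBracket_smul_left hf hV]
    simp only [map_add, map_smul, hJ]
    module
  add {V V'} hV hV' := by
    have e : (fun q => J q ((V + V') q)) = (fun q => J q (V q)) + fun q => J q (V' q) := by
      ext1 q; exact map_add (J q) (V q) (V' q)
    unfold nijenhuis
    rw [e, mlieBracket_add_left (h.mdifferentiableAt hV) (h.mdifferentiableAt hV'),
      mlieBracket_add_left hV hV',
      mlieBracket_add_left (h.mdifferentiableAt hV) (h.mdifferentiableAt hV'),
      mlieBracket_add_left hV hV']
    simp only [map_add]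
    abel

/-- The Nijenhuis torsion vanishes as soon as it vanishes on a spanning family. -/
theorem nijenhuis_eq_zero [CompleteSpace E] (h : SpanningFamily 𝒟 J)
    (hJ : ∀ (q : M) (v : TangentSpace I q), J q (J q v) = -v)
    (h0 : ∀ V ∈ 𝒟, ∀ W ∈ 𝒟, ∀ p, nijenhuis J V W p = 0) {V W : ∀ q : M, TangentSpace I q}
    (hV : ContMDiff I I.tangent ∞ (fun q => (⟨q, V q⟩ : TangentBundle I M)))
    (hW : ContMDiff I I.tangent ∞ (fun q => (⟨q, W q⟩ : TangentBundle I M))) (p : M) :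
    nijenhuis J V W p = 0 := by
  have hd : ∀ {V : ∀ q : M, TangentSpace I q},
      ContMDiff I I.tangent ∞ (fun q => (⟨q, V q⟩ : TangentBundle I M)) →
        MDifferentiableAt I I.tangent (fun q => (⟨q, V q⟩ : TangentBundle I M)) p :=
    fun hV => hV.mdifferentiable (by simp) p
  have : IsManifold I (1 + 1) M := IsManifold.of_le (n := ∞) (by norm_cast)
  obtain ⟨V', hV', hVp⟩ := h.spans p (V p)
  obtain ⟨W', hW', hWp⟩ := h.spans p (W p)
  -- Each argument is replaced by a member of the family with the same value at `p`; antisymmetry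
  -- brings the second argument into the first slot.
  rw [(h.tensorialAt_nijenhuis hJ W).pointwise (hd hV) (hd (h.smooth _ hV')) hVp.symm,
    nijenhuis_swap, (h.tensorialAt_nijenhuis hJ V').pointwise (hd hW)
      (hd (h.smooth _ hW')) hWp.symm, h0 _ hW' _ hV', neg_zero]

end SpanningFamily

/-- Lie brackets of related vector fields are related. -/
theorem mfderiv_mlieBracket [CompleteSpace E] [I.Boundaryless] [IsManifold I ∞ M]
    [FiniteDimensional ℝ E'] [I'.Boundaryless] [IsManifold I' ∞ M'] [T2Space M']
    {φ : M → M'} (hφ : ContMDiff I I' ∞ φ)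
    {V W : ∀ p : M, TangentSpace I p} {V' W' : ∀ p : M', TangentSpace I' p}
    (hV : ContMDiff I I.tangent ∞ (fun p => (⟨p, V p⟩ : TangentBundle I M)))
    (hW : ContMDiff I I.tangent ∞ (fun p => (⟨p, W p⟩ : TangentBundle I M)))
    (hV' : ContMDiff I' I'.tangent ∞ (fun p => (⟨p, V' p⟩ : TangentBundle I' M')))
    (hW' : ContMDiff I' I'.tangent ∞ (fun p => (⟨p, W' p⟩ : TangentBundle I' M')))
    (hVV' : ∀ p, mfderiv I I' φ p (V p) = V' (φ p))
    (hWW' : ∀ p, mfderiv I I' φ p (W p) = W' (φ p)) (p : M) :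
    mfderiv I I' φ p (mlieBracket I V W p) = mlieBracket I' V' W' (φ p) := by
  have : CompleteSpace E' := FiniteDimensional.complete ℝ E'
  have hφd := hφ.mdifferentiable (by simp)
  have hsm : ∀ {U : ∀ p : M', TangentSpace I' p} {f : M' → ℝ},
      ContMDiff I' I'.tangent ∞ (fun p => (⟨p, U p⟩ : TangentBundle I' M')) →
      ContMDiff I' 𝓘(ℝ, ℝ) ∞ f → ContMDiff I' 𝓘(ℝ, ℝ) ∞ (fun y => mvfderiv I' f y (U y)) :=
    fun hU hf => (contMDiff_snd_tangentBundle_modelSpace ℝ 𝓘(ℝ, ℝ)).comp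
      ((hf.contMDiff_tangentMap (by simp)).comp hU)
  have key : ∀ {U : ∀ p : M, TangentSpace I p} {U' : ∀ p : M', TangentSpace I' p} {f : M' → ℝ},
      (∀ p, mfderiv I I' φ p (U p) = U' (φ p)) → ContMDiff I' 𝓘(ℝ, ℝ) ∞ f →
      (fun q => mvfderiv I (fun y => f (φ y)) q (U q)) = fun q => mvfderiv I' f (φ q) (U' (φ q)) := by
    intro U U' f hU hf
    ext q
    rw [mvfderiv_comp_mfderiv (hf.mdifferentiable (by simp) _) (hφd q), hU]
  -- Fields are `φ`-related exactly when `V (f ∘ φ) = (V' f) ∘ φ` for all test functions, and this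
  -- relation passes to commutators of derivations.
  refine eq_of_mvfderiv_eq fun f hf => ?_
  rw [← mvfderiv_comp_mfderiv (hf.mdifferentiable (by simp) _) (hφd p),
    mvfderiv_mlieBracket hV hW (f := fun y => f (φ y)) (hf.comp hφ), mvfderiv_mlieBracket hV' hW' hf, key hWW' hf,
    key hVV' hf]
  exact congrArg₂ (· - ·) (congrFun (key hVV' (hsm hW' hf)) p) (congrFun (key hWW' (hsm hV' hf)) p)

end Manifold

namespace LineBundle

variable {L : LineBundle.{u}}

/-! ### Local coordinates on `L^* \ 0` -/

theorem slitProj_mem_nhds (p : L.slit) :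
    slitProj ⁻¹' (trivializationAt ℝ L.fiber p.1.1).baseSet ∈ nhds p :=
  ((trivializationAt ℝ L.fiber p.1.1).open_baseSet.preimage
    contMDiff_slitProj.continuous).mem_nhds (FiberBundle.mem_baseSet_trivializationAt' p.1.1)

theorem slitCoord_ne_zero {x₀ : L.base} {p : L.slit}
    (h : p.1.1 ∈ (trivializationAt ℝ L.fiber x₀).baseSet) : slitCoord x₀ p ≠ 0 :=
  (L.ne_zero_iff h _).1 p.2

theorem contMDiffAt_slitCoord {x₀ : L.base} {p : L.slit}
    (h : p.1.1 ∈ (trivializationAt ℝ L.fiber x₀).baseSet) :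
    ContMDiffAt L.dualModel 𝓘(ℝ, ℝ) ∞ (slitCoord x₀) p :=
  ((slit_contMDiffAt_iff (I := L.dualModel) (f := id) (y := p) x₀ h).1 contMDiffAt_id).2

open Classical in
/-- The inverse of the coordinates `p ↦ (slitProj p, slitCoord x₀ p)`. -/
def slitOfCoord (x₀ : L.base) (z : L.base × ℝ) : L.slit :=
  (if h : z.2 ≠ 0 then Units.mk0 z.2 h else 1 : ℝˣ) • slitPoint x₀ z.1

theorem slitOfCoord_proj (x₀ : L.base) (z : L.base × ℝ) : (slitOfCoord x₀ z).1.1 = z.1 := by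
  rw [slitOfCoord, smul_fst, slitPoint_proj]

theorem slitCoord_slitOfCoord {x₀ : L.base} {z : L.base × ℝ}
    (h : z.1 ∈ (trivializationAt ℝ L.fiber x₀).baseSet) (hz : z.2 ≠ 0) :
    slitCoord x₀ (slitOfCoord x₀ z) = z.2 := by
  rw [slitOfCoord, slitCoord_smul, slitCoord_slitPoint h, dif_pos hz, Units.val_mk0, mul_one]

theorem slitOfCoord_coord {x₀ : L.base} {p : L.slit}
    (h : p.1.1 ∈ (trivializationAt ℝ L.fiber x₀).baseSet) :
    slitOfCoord x₀ (p.1.1, slitCoord x₀ p) = p := by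
  refine slit_ext (x₀ := x₀) ?_ (slitOfCoord_proj _ _) ?_
  · rw [slitOfCoord_proj]; exact h
  · rw [slitCoord_slitOfCoord h (slitCoord_ne_zero h)]

/-- The domain of `slitOfCoord`. -/
def coordDomain (x₀ : L.base) : Set (L.base × ℝ) :=
  (trivializationAt ℝ L.fiber x₀).baseSet ×ˢ {0}ᶜ

theorem isOpen_coordDomain (x₀ : L.base) : IsOpen (coordDomain x₀) :=
  (trivializationAt ℝ L.fiber x₀).open_baseSet.prod isOpen_compl_singleton

theorem contMDiffOn_slitOfCoord (x₀ : L.base) :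
    ContMDiffOn (L.base.I.prod 𝓘(ℝ, ℝ)) L.dualModel ∞ (slitOfCoord x₀) (coordDomain x₀) := by
  intro z hz
  refine ContMDiffAt.contMDiffWithinAt ?_
  rw [slit_contMDiffAt_iff x₀ (by rw [slitOfCoord_proj]; exact hz.1)]
  constructor
  · simp only [slitOfCoord_proj]
    exact contMDiffAt_fst
  · refine contMDiffAt_snd.congr_of_eventuallyEq ?_
    filter_upwards [(isOpen_coordDomain x₀).mem_nhds hz] with w hw
    exact slitCoord_slitOfCoord hw.1 hw.2

theorem coord_mem {x₀ : L.base} {p : L.slit}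
    (h : p.1.1 ∈ (trivializationAt ℝ L.fiber x₀).baseSet) :
    (p.1.1, slitCoord x₀ p) ∈ coordDomain x₀ := ⟨h, slitCoord_ne_zero h⟩

theorem mdifferentiableAt_slitProj (p : L.slit) :
    MDifferentiableAt L.dualModel L.base.I (slitProj (L := L)) p :=
  contMDiff_slitProj.mdifferentiable (by simp) p

/-- A tangent vector is recovered from its coordinates. -/
theorem mfderiv_slitOfCoord {x₀ : L.base} {p : L.slit}
    (h : p.1.1 ∈ (trivializationAt ℝ L.fiber x₀).baseSet) (w : TangentSpace L.dualModel p) :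
    (show L.base.E × (ℝ →L[ℝ] ℝ) from w) =
      mfderiv (L.base.I.prod 𝓘(ℝ, ℝ)) L.dualModel (slitOfCoord x₀) (p.1.1, slitCoord x₀ p)
      (mfderiv L.dualModel L.base.I slitProj p w, mvfderiv L.dualModel (slitCoord x₀) p w) := by
  have hψ : MDifferentiableAt L.dualModel 𝓘(ℝ, ℝ) (slitCoord x₀) p :=
    (contMDiffAt_slitCoord h).mdifferentiableAt (by simp)
  have hχ : MDifferentiableAt (L.base.I.prod 𝓘(ℝ, ℝ)) L.dualModel (slitOfCoord x₀)
      (p.1.1, slitCoord x₀ p) := ((contMDiffOn_slitOfCoord x₀).contMDiffAt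
    ((isOpen_coordDomain x₀).mem_nhds (coord_mem h))).mdifferentiableAt (by simp)
  have h1 := mfderiv_comp p (f := fun q : L.slit => (slitProj q, slitCoord x₀ q)) hχ
    ((mdifferentiableAt_slitProj p).prodMk hψ)
  have h2 : (slitOfCoord x₀ ∘ fun q : L.slit => (slitProj q, slitCoord x₀ q)) =ᶠ[nhds p] id := by
    filter_upwards [((trivializationAt ℝ L.fiber x₀).open_baseSet.preimage
      contMDiff_slitProj.continuous).mem_nhds h] with q hq
    exact slitOfCoord_coord hq
  rw [h2.mfderiv_eq, mfderiv_id, mfderiv_prodMk (mdifferentiableAt_slitProj p) hψ] at h1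
  exact congrArg (fun T : L.base.E × (ℝ →L[ℝ] ℝ) →L[ℝ] L.base.E × (ℝ →L[ℝ] ℝ) => T w) h1

theorem slit_tangent_ext {x₀ : L.base} {p : L.slit}
    (h : p.1.1 ∈ (trivializationAt ℝ L.fiber x₀).baseSet) {w w' : TangentSpace L.dualModel p}
    (h1 : mfderiv L.dualModel L.base.I slitProj p w = mfderiv L.dualModel L.base.I slitProj p w')
    (h2 : mvfderiv L.dualModel (slitCoord x₀) p w = mvfderiv L.dualModel (slitCoord x₀) p w') :
    w = w' := by
  refine (mfderiv_slitOfCoord h w).trans (Eq.trans ?_ (mfderiv_slitOfCoord h w').symm)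
  rw [h1, h2]

/-- The required vector is the image of `(v, c)` under the derivative of the inverse coordinates. -/
theorem exists_slit_tangent {x₀ : L.base} {p : L.slit}
    (h : p.1.1 ∈ (trivializationAt ℝ L.fiber x₀).baseSet) (v : TangentSpace L.base.I p.1.1)
    (c : ℝ) : ∃ w : TangentSpace L.dualModel p, mfderiv L.dualModel L.base.I slitProj p w = v ∧
      mvfderiv L.dualModel (slitCoord x₀) p w = c := by
  have hev := (isOpen_coordDomain x₀).mem_nhds (coord_mem h)
  have hψ : MDifferentiableAt L.dualModel 𝓘(ℝ, ℝ) (slitCoord x₀) p :=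
    (contMDiffAt_slitCoord h).mdifferentiableAt (by simp)
  have hχ : MDifferentiableAt (L.base.I.prod 𝓘(ℝ, ℝ)) L.dualModel (slitOfCoord x₀)
      (p.1.1, slitCoord x₀ p) :=
    ((contMDiffOn_slitOfCoord x₀).contMDiffAt hev).mdifferentiableAt (by simp)
  have hp := slitOfCoord_coord h
  refine ⟨mfderiv (L.base.I.prod 𝓘(ℝ, ℝ)) L.dualModel (slitOfCoord x₀)
    (p.1.1, slitCoord x₀ p) (v, c), ?_, ?_⟩
  · have h1 := mfderiv_comp_of_eq (y := p) (mdifferentiableAt_slitProj p) hχ hp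
    have h2 : slitProj ∘ slitOfCoord (L := L) x₀ = Prod.fst := by
      ext1 z; exact slitOfCoord_proj _ _
    rw [h2, mfderiv_fst] at h1
    have h3 := congrArg (fun T : L.base.E × ℝ →L[ℝ] L.base.E => T (v, c)) h1
    -- The point `slitOfCoord x₀ (p.1.1, slitCoord x₀ p)` equals `p` only propositionally, so
    -- derivatives at the two points are compared as operators between the model spaces.
    have h4 : @Eq (L.base.E × (ℝ →L[ℝ] ℝ) →L[ℝ] L.base.E) _ _ := mfderiv_congr_point
      (I := L.dualModel) (I' := L.base.I) (f := slitProj (L := L)) hp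
    exact (congrArg (fun T : L.base.E × (ℝ →L[ℝ] ℝ) →L[ℝ] L.base.E => T _) h4.symm).trans h3.symm
  · have h1 := mfderiv_comp_of_eq (y := p) hψ hχ hp
    have h2 : slitCoord x₀ ∘ slitOfCoord (L := L) x₀ =ᶠ[nhds (p.1.1, slitCoord x₀ p)] Prod.snd := by
      filter_upwards [hev] with z hz
      exact slitCoord_slitOfCoord hz.1 hz.2
    rw [h2.mfderiv_eq, mfderiv_snd] at h1
    have h3 := congrArg (fun T : L.base.E × ℝ →L[ℝ] ℝ => T (v, c)) h1
    have h4 : @Eq (L.base.E × (ℝ →L[ℝ] ℝ) →L[ℝ] ℝ) _ _ := mfderiv_congr_point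
      (I := L.dualModel) (I' := 𝓘(ℝ, ℝ)) (f := slitCoord x₀) hp
    exact (congrArg (fun T : L.base.E × (ℝ →L[ℝ] ℝ) →L[ℝ] ℝ => T _) h4.symm).trans h3.symm

/-- A vector field on `L^* \ 0` is smooth if its coordinates are. -/
theorem contMDiffAt_slit_field {p : L.slit} {V : ∀ q : L.slit, TangentSpace L.dualModel q}
    (h1 : ContMDiffAt L.dualModel L.base.I.tangent ∞ (fun q : L.slit =>
      (⟨q.1.1, mfderiv L.dualModel L.base.I slitProj q (V q)⟩ : TangentBundle L.base.I L.base)) p)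
    (h2 : ContMDiffAt L.dualModel 𝓘(ℝ, ℝ) ∞
      (fun q => mvfderiv L.dualModel (slitCoord p.1.1) q (V q)) p) :
    ContMDiffAt L.dualModel L.dualModel.tangent ∞
      (fun q => (⟨q, V q⟩ : TangentBundle L.dualModel L.slit)) p := by
  have hb := FiberBundle.mem_baseSet_trivializationAt' (F := ℝ) (E := L.fiber) p.1.1
  have h3 : ContMDiffAt L.dualModel 𝓘(ℝ, ℝ).tangent ∞ (fun q : L.slit =>
      (⟨slitCoord p.1.1 q, mvfderiv L.dualModel (slitCoord p.1.1) q (V q)⟩ :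
        TangentBundle 𝓘(ℝ, ℝ) ℝ)) p := by
    rw [contMDiffAt_totalSpace]
    refine ⟨contMDiffAt_slitCoord hb, h2.congr_of_eventuallyEq ?_⟩
    filter_upwards with q
    simp
  -- The two coordinates of the field form a tangent vector of the product of the base with `ℝ`,
  -- smooth in `q`; pushing it forward along `slitOfCoord` recovers `V`.
  have h4 : ContMDiffAt L.dualModel (L.base.I.prod 𝓘(ℝ, ℝ)).tangent ∞ (fun q : L.slit =>
      (equivTangentBundleProd L.base.I L.base 𝓘(ℝ, ℝ) ℝ).symm
        (⟨q.1.1, mfderiv L.dualModel L.base.I slitProj q (V q)⟩,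
          ⟨slitCoord p.1.1 q, mvfderiv L.dualModel (slitCoord p.1.1) q (V q)⟩)) p :=
    contMDiff_equivTangentBundleProd_symm.contMDiffAt.comp p (h1.prodMk h3)
  refine (h4.tangentMap_comp (isOpen_coordDomain p.1.1) (coord_mem hb)
    (contMDiffOn_slitOfCoord _)).congr_of_eventuallyEq ?_
  filter_upwards [slitProj_mem_nhds p] with q hq
  exact TotalSpace.ext (slitOfCoord_coord hq).symm (heq_of_eq (mfderiv_slitOfCoord hq (V q)))

/-! ### Local frames and the fibres of the gauge algebroid -/

/-- Near `x₀` the line bundle has a frame which extends to a smooth section, and the coefficients of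
sections with respect to this frame, cut off, are smooth functions. -/
theorem exists_frame (x₀ : L.base) : ∃ (ρ : L.Fun) (e : L.Section) (ℓ : L.Section →ₗ[ℝ] L.Fun),
    (∀ᶠ y in nhds x₀, ρ y = 1) ∧ (∀ᶠ y in nhds x₀, e y = L.frame x₀ y) ∧
    (∀ (f : L.Fun) (s : L.Section) (y : L.base), ℓ (f • s) y = f y * ℓ s y) ∧
    ∀ s : L.Section, ℓ s • e = ρ • s := by
  let t := trivializationAt ℝ L.fiber x₀
  have hx₀ : x₀ ∈ t.baseSet := FiberBundle.mem_baseSet_trivializationAt' x₀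
  obtain ⟨χ, hχ, hχU, hχ1⟩ := exists_contMDiff_bump (I := L.base.I) (t.open_baseSet.mem_nhds hx₀)
  have hfr : ContMDiffOn L.base.I (L.base.I.prod 𝓘(ℝ, ℝ)) ∞
      (fun y => TotalSpace.mk' ℝ y (L.frame x₀ y)) t.baseSet := by
    rw [t.contMDiffOn_section_baseSet_iff]
    exact contMDiffOn_const.congr fun y hy => L.triv_frame hy
  have hs : ∀ s : L.Section, ContMDiff L.base.I 𝓘(ℝ, ℝ) ∞ (fun y => χ y * (t ⟨y, s y⟩).2) := by
    intro s
    refine contMDiff_of_tsupport fun y hy => ?_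
    have hy' : y ∈ t.baseSet := hχU (tsupport_mul_subset_left hy)
    exact hχ.contMDiffAt.mul ((t.contMDiffAt_section_iff hy').1 (s.contMDiff y))
  have hz : ∀ y ∉ t.baseSet, χ y = 0 := fun y hy =>
    image_eq_zero_of_notMem_tsupport fun h => hy (hχU h)
  have hlin : ∀ y ∈ t.baseSet, ∀ v : L.fiber y, (t ⟨y, v⟩).2 = t.continuousLinearMapAt ℝ y v :=
    fun y hy v => (t.continuousLinearMapAt_apply_of_mem (R := ℝ) hy v).symm
  -- Both the frame and the coefficient map must be cut off by `χ` to be defined globally, so their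
  -- product reproduces a section up to the factor `ρ = χ²`.
  refine ⟨⟨fun y => χ y * χ y, hχ.mul hχ⟩, ⟨fun y => χ y • L.frame x₀ y,
    ContMDiffOn.smul_section_of_tsupport hχ.contMDiffOn t.open_baseSet hχU hfr⟩,
    { toFun := fun s => ⟨fun y => χ y * (t ⟨y, s y⟩).2, hs s⟩
      map_add' := fun s s' => ?_
      map_smul' := fun c s => ?_ }, ?_, ?_, fun f s y => ?_, fun s => ?_⟩
  · ext y
    change χ y * (t ⟨y, s y + s' y⟩).2 = χ y * (t ⟨y, s y⟩).2 + χ y * (t ⟨y, s' y⟩).2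
    by_cases hy : y ∈ t.baseSet
    · rw [hlin y hy, hlin y hy, hlin y hy, map_add, mul_add]
    · simp [hz y hy]
  · ext y
    change χ y * (t ⟨y, c • s y⟩).2 = c * (χ y * (t ⟨y, s y⟩).2)
    by_cases hy : y ∈ t.baseSet
    · rw [hlin y hy, hlin y hy, map_smul, smul_eq_mul]
      ring
    · simp [hz y hy]
  · filter_upwards [hχ1] with y hy
    change χ y * χ y = 1
    rw [hy, one_mul]
  · filter_upwards [hχ1] with y hy
    change χ y • L.frame x₀ y = _
    rw [hy, one_smul]
  · change χ y * (t ⟨y, f y • s y⟩).2 = f y * (χ y * (t ⟨y, s y⟩).2)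
    by_cases hy : y ∈ t.baseSet
    · rw [hlin y hy, hlin y hy, map_smul, smul_eq_mul]
      ring
    · simp [hz y hy]
  · ext y
    change (χ y * (t ⟨y, s y⟩).2) • χ y • L.frame x₀ y = (χ y * χ y) • s y
    by_cases hy : y ∈ t.baseSet
    · conv_rhs => rw [L.frame_eq hy (s y)]
      module
    · simp [hz y hy]

/-- The tangent vector `v` is the symbol of the element `δ` of the fibre of the gauge algebroid. -/
def IsSymbolAt {x : L.base} (δ : L.gaugeFiber x) (v : TangentSpace L.base.I x) : Prop :=
  ∀ (f : L.Fun) (s : L.Section), δ.1 (f • s) = mvfderiv L.base.I f x v • s x + f x • δ.1 s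

theorem exists_isSymbolAt {x : L.base} (δ : L.gaugeFiber x) : ∃ v, IsSymbolAt δ v := δ.2

/-- Applying `δ` to `f e`, with a section `e` which does not vanish at `x`, recovers the derivative
of `f` along the symbol. -/
theorem IsSymbolAt.unique {x : L.base} {δ : L.gaugeFiber x} {v w : TangentSpace L.base.I x}
    (hv : IsSymbolAt δ v) (hw : IsSymbolAt δ w) : v = w := by
  obtain ⟨ρ, e, ℓ, -, he, -, -⟩ := exists_frame x
  have he0 : e x ≠ 0 := by
    rw [he.self_of_nhds]
    exact Hom.frame_ne_zero (FiberBundle.mem_baseSet_trivializationAt' x)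
  refine eq_of_mvfderiv_eq fun f hf => ?_
  have h1 := (hv ⟨f, hf⟩ e).symm.trans (hw ⟨f, hf⟩ e)
  exact smul_left_injective ℝ he0 (add_right_cancel h1)

/-- Elements of `D_x L` are local: since `ρ = 1` near `x`, the Leibniz rule gives `δ s = δ (ρ s) = δ
(ℓ(s) e)`, and a second use of the rule gives the formula. -/
theorem IsSymbolAt.apply_eq {x : L.base} {δ : L.gaugeFiber x} {v : TangentSpace L.base.I x}
    (hv : IsSymbolAt δ v) {ρ : L.Fun} {e : L.Section} {ℓ : L.Section →ₗ[ℝ] L.Fun}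
    (hρ : ∀ᶠ y in nhds x, ρ y = 1) (hℓ : ∀ s : L.Section, ℓ s • e = ρ • s) (s : L.Section) :
    δ.1 s = mvfderiv L.base.I (ℓ s) x v • e x + ℓ s x • δ.1 e := by
  have h1 : mvfderiv L.base.I ρ x v = 0 := by
    rw [Filter.EventuallyEq.mvfderiv_eq_apply (g := fun _ => (1 : ℝ)) hρ, mvfderiv_const]
    rfl
  rw [← hv, hℓ, hv, h1, hρ.self_of_nhds, zero_smul, one_smul, zero_add]

/-- An element of the gauge algebroid is determined by its symbol and its value on a local frame. -/
theorem IsSymbolAt.ext {x : L.base} {δ δ' : L.gaugeFiber x} {v : TangentSpace L.base.I x}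
    (hv : IsSymbolAt δ v) (hv' : IsSymbolAt δ' v) {ρ : L.Fun} {e : L.Section}
    {ℓ : L.Section →ₗ[ℝ] L.Fun} (hρ : ∀ᶠ y in nhds x, ρ y = 1)
    (hℓ : ∀ s : L.Section, ℓ s • e = ρ • s) (he : δ.1 e = δ'.1 e) : δ = δ' := by
  ext s
  rw [hv.apply_eq hρ hℓ, hv'.apply_eq hρ hℓ, he]

/-- Every element of the gauge algebroid is the value of a derivation. -/
theorem evalDer_surjective (x : L.base) : Function.Surjective fun D : L.Der => evalDer D x := by
  intro δ
  obtain ⟨ρ, e, ℓ, hρ, he, hℓf, hℓ⟩ := exists_frame x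
  obtain ⟨v, hv⟩ := exists_isSymbolAt δ
  obtain ⟨X, hX, rfl⟩ := exists_contMDiff_section_apply_eq (I := L.base.I) (F := L.base.E)
    (V := (TangentSpace L.base.I : L.base → Type _)) v
  replace hX : L.base.IsSmoothField X := hX
  have hb := FiberBundle.mem_baseSet_trivializationAt' (F := ℝ) (E := L.fiber) x
  obtain ⟨c, hc⟩ : ∃ c : ℝ, δ.1 e = c • e x :=
    ⟨_, by rw [he.self_of_nhds]; exact L.frame_eq hb (δ.1 e)⟩
  have hd : ∀ (f : L.Fun) (y : L.base), MDifferentiableAt L.base.I 𝓘(ℝ, ℝ) f y :=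
    fun f y => f.contMDiff.mdifferentiable (by simp) y
  -- In the frame `e` the derivation is to act on coefficients as `X + c`, with `X` extending the
  -- symbol of `δ` and `c` chosen so that `δ e = c e` at `x`. The cut-off makes this global.
  let g : L.Section → L.Fun := fun s => ⟨fun y => mvfderiv L.base.I (ℓ s) y (X y) + c * ℓ s y,
    (hX.contMDiff_mvfderiv (ℓ s).contMDiff).add (contMDiff_const.mul (ℓ s).contMDiff)⟩
  have hg : ∀ s y, g s y = mvfderiv L.base.I (ℓ s) y (X y) + c * ℓ s y := fun _ _ => rfl
  let D : Module.End ℝ L.Section :=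
    { toFun := fun s => g s • e
      map_add' := fun s s' => by
        ext y
        have h1 : mvfderiv L.base.I (ℓ s + ℓ s') y =
          mvfderiv L.base.I (ℓ s) y + mvfderiv L.base.I (ℓ s') y := mvfderiv_add (hd _ y) (hd _ y)
        change g (s + s') y • e y = g s y • e y + g s' y • e y
        rw [hg, hg, hg, map_add, h1]
        change (_ + _ + c * (ℓ s y + ℓ s' y)) • e y = _
        module
      map_smul' := fun a s => by
        ext y
        have h1 : mvfderiv L.base.I (ℓ (a • s)) y (X y) = a * mvfderiv L.base.I (ℓ s) y (X y) := by
          have h2 := mvfderiv_mul (I := L.base.I) (mdifferentiableAt_const (c := a)) (hd (ℓ s) y)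
          rw [mvfderiv_const] at h2
          rw [map_smul]
          refine (congrArg (fun T => T (X y)) h2).trans ?_
          change a * mvfderiv L.base.I (ℓ s) y (X y) + ℓ s y * 0 = _
          rw [mul_zero, add_zero]
        change g (a • s) y • e y = a • g s y • e y
        rw [hg, hg, h1, map_smul]
        change (_ + c * (a * ℓ s y)) • e y = _
        module }
  have hDs : ∀ s y, D s y = g s y • e y := fun _ _ => rfl
  -- The symbol is `ρ X` and not `X`, because `ℓ(s) e = ρ s`; at `x` the two agree.
  have hD : L.IsSymbol D (fun y => ρ y • X y) := by
    intro f s y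
    have h1 : mvfderiv L.base.I (ℓ (f • s)) y (X y) =
        f y * mvfderiv L.base.I (ℓ s) y (X y) + ℓ s y * mvfderiv L.base.I f y (X y) := by
      have h2 := mvfderiv_mul (I := L.base.I) (hd f y) (hd (ℓ s) y)
      have h3 : ⇑(ℓ (f • s)) = ⇑f * ⇑(ℓ s) := by
        ext1 z; exact hℓf f s z
      rw [h3, h2]
      simp
    have h4 : ℓ s y • e y = ρ y • s y := congrArg (fun t : L.Section => t y) (hℓ s)
    rw [hDs, hDs, hg, hg, h1, hℓf, map_smul, smul_eq_mul, mul_comm (ρ y), mul_smul, ← h4]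
    module
  let D' : L.Der := ⟨D, _, ContMDiff.smul_section ρ.contMDiff hX, hD⟩
  have hD' : IsSymbolAt (evalDer D' x) (X x) := by
    intro f s
    have h1 : ρ x • X x = X x := by rw [hρ.self_of_nhds, one_smul]
    rw [← h1]
    exact hD f s x
  refine ⟨D', hD'.ext hv hρ hℓ ?_⟩
  have h5 := hv.apply_eq hρ hℓ e
  change g e x • e x = _
  rw [h5, hg, hc]
  module

end LineBundle

namespace LineBundle

variable {L : LineBundle.{u}}

/-! ### Tangent vectors of `L^* \ 0` as elements of the gauge algebroid -/

/-- A point of `L^* \ 0` is an isomorphism from the fibre of `L` to `ℝ`. -/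
def slitFib (p : L.slit) : L.fiber p.1.1 ≃ₗ[ℝ] ℝ :=
  LinearEquiv.ofBijective (p.1.2 : L.fiber p.1.1 →ₗ[ℝ] ℝ) (by
    have hb := FiberBundle.mem_baseSet_trivializationAt' (F := ℝ) (E := L.fiber) p.1.1
    have h0 : (p.1.2 (L.frame p.1.1 p.1.1) : ℝ) ≠ 0 := (L.ne_zero_iff hb p.1.2).1 p.2
    constructor
    · rw [← LinearMap.ker_eq_bot, LinearMap.ker_eq_bot']
      intro v hv
      rw [L.frame_eq hb v] at hv ⊢
      have h1 : (trivializationAt ℝ L.fiber p.1.1 ⟨p.1.1, v⟩).2 * p.1.2 (L.frame p.1.1 p.1.1) =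
          (0 : ℝ) := (map_smul p.1.2 _ _).symm.trans hv
      rw [(mul_eq_zero.1 h1).resolve_right h0, zero_smul]
    · intro c
      refine ⟨(c / p.1.2 (L.frame p.1.1 p.1.1) : ℝ) • L.frame p.1.1 p.1.1, ?_⟩
      exact (map_smul p.1.2 _ _).trans (div_mul_cancel₀ c h0))

theorem slitFib_smul (t : ℝˣ) (p : L.slit) (v : L.fiber p.1.1) :
    slitFib (t • p) v = t * slitFib p v := rfl

theorem liftSection_eq (s : L.Section) (p : L.slit) : liftSection s p = slitFib p (s p.1.1) := rfl

theorem contMDiff_liftSection (s : L.Section) :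
    ContMDiff L.dualModel 𝓘(ℝ, ℝ) ∞ (liftSection s) := by
  intro p
  have hb := FiberBundle.mem_baseSet_trivializationAt' (F := ℝ) (E := L.fiber) p.1.1
  have h1 := ((contMDiffAt_section _).1 (s.contMDiff p.1.1)).comp p
    (contMDiff_slitProj (L := L) p)
  refine (h1.mul (contMDiffAt_slitCoord hb)).congr_of_eventuallyEq ?_
  filter_upwards [slitProj_mem_nhds p] with q hq
  have hq' : q.1.1 ∈ (trivializationAt ℝ L.fiber p.1.1).baseSet := hq
  have h2 := L.frame_eq hq' (s q.1.1)
  rw [liftSection_eq, h2, map_smul]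
  rfl

/-- The product rule for `(f λ)~ = (f ∘ π) λ̃`. This is the Leibniz rule which places `λ ↦ p⁻¹ (w
λ̃)` in the gauge algebroid. -/
theorem mvfderiv_liftSection_smul (f : L.Fun) (s : L.Section) (p : L.slit)
    (w : TangentSpace L.dualModel p) : mvfderiv L.dualModel (liftSection (f • s)) p w =
      mvfderiv L.base.I f p.1.1 (mfderiv L.dualModel L.base.I slitProj p w) * liftSection s p +
        f p.1.1 * mvfderiv L.dualModel (liftSection s) p w := by
  have h1 : liftSection (f • s) = (fun q => f (slitProj q)) * liftSection s := by
    ext q; exact map_smul (slitFib q) (f q.1.1) (s q.1.1)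
  have hf := f.contMDiff.mdifferentiable (by simp) (slitProj p)
  have h2 := mvfderiv_comp_mfderiv hf (mdifferentiableAt_slitProj p) w
  have h3 : MDifferentiableAt L.dualModel 𝓘(ℝ, ℝ) (fun q : L.slit => f (slitProj q)) p :=
    (f.contMDiff.comp contMDiff_slitProj).mdifferentiable (by simp) p
  rw [h1, mvfderiv_mul h3 ((contMDiff_liftSection s).mdifferentiable (by simp) p)]
  change f p.1.1 * mvfderiv L.dualModel (liftSection s) p w + liftSection s p *
    mvfderiv L.dualModel (fun q : L.slit => f (slitProj q)) p w = _
  rw [h2]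
  change _ + liftSection s p * mvfderiv L.base.I f p.1.1 _ = _
  ring

theorem mvfderiv_liftSection_add (s s' : L.Section) (p : L.slit) :
    mvfderiv L.dualModel (liftSection (s + s')) p =
      mvfderiv L.dualModel (liftSection s) p + mvfderiv L.dualModel (liftSection s') p := by
  have h1 : liftSection (s + s') = liftSection s + liftSection s' := by
    ext q; exact map_add (slitFib q) (s q.1.1) (s' q.1.1)
  rw [h1, mvfderiv_add ((contMDiff_liftSection s).mdifferentiable (by simp) p)
    ((contMDiff_liftSection s').mdifferentiable (by simp) p)]

theorem mvfderiv_liftSection_const_smul (c : ℝ) (s : L.Section) (p : L.slit)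
    (w : TangentSpace L.dualModel p) : mvfderiv L.dualModel (liftSection (c • s)) p w =
      c * mvfderiv L.dualModel (liftSection s) p w := by
  let f : L.Fun := ⟨fun _ => c, contMDiff_const⟩
  have h1 : c • s = f • s := rfl
  have h2 : mvfderiv L.base.I f p.1.1 = 0 := mvfderiv_const c
  rw [h1, mvfderiv_liftSection_smul, h2]
  change 0 * liftSection s p + c * _ = _
  rw [zero_mul, zero_add]

/-- The element `λ ↦ p⁻¹ (w λ̃)` of the gauge algebroid defined by a tangent vector `w` of
`L^* \ 0` at `p`. -/
def slitGaugeVal (p : L.slit) (w : TangentSpace L.dualModel p) : L.gaugeFiber p.1.1 :=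
  ⟨{  toFun := fun s => (slitFib p).symm (mvfderiv L.dualModel (liftSection s) p w)
      map_add' := fun s s' => by
        rw [mvfderiv_liftSection_add]
        exact map_add (slitFib p).symm _ _
      map_smul' := fun c s => by
        rw [mvfderiv_liftSection_const_smul]
        exact map_smul (slitFib p).symm c _ },
    mfderiv L.dualModel L.base.I slitProj p w, fun f s => by
      change (slitFib p).symm (mvfderiv L.dualModel (liftSection (f • s)) p w) =
        _ + f p.1.1 • (slitFib p).symm (mvfderiv L.dualModel (liftSection s) p w)
      rw [LinearEquiv.symm_apply_eq, mvfderiv_liftSection_smul, map_add, map_smul, map_smul,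
        LinearEquiv.apply_symm_apply]
      rfl⟩

theorem slitFib_slitGaugeVal (p : L.slit) (w : TangentSpace L.dualModel p) (s : L.Section) :
    slitFib p ((slitGaugeVal p w).1 s) = mvfderiv L.dualModel (liftSection s) p w :=
  (slitFib p).apply_symm_apply _

/-- Elements of the gauge algebroid are determined by their values. -/
theorem gauge_ext {p : L.slit} {δ δ' : L.gaugeFiber p.1.1}
    (h : ∀ s : L.Section, slitFib p (δ.1 s) = slitFib p (δ'.1 s)) : δ = δ' :=
  Subtype.ext (LinearMap.ext fun s => (slitFib p).injective (h s))

/-- The isomorphism from the tangent space of `L^* \ 0` at `p` to the fibre of the gauge algebroid,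
as a linear map: `w` corresponds to `λ ↦ p⁻¹ (w λ̃)`. -/
def slitGauge (p : L.slit) : TangentSpace L.dualModel p →ₗ[ℝ] L.gaugeFiber p.1.1 where
  toFun := slitGaugeVal p
  map_add' w w' := gauge_ext fun s => by
    have h1 : slitFib p ((slitGaugeVal p w + slitGaugeVal p w').1 s) =
        slitFib p ((slitGaugeVal p w).1 s) + slitFib p ((slitGaugeVal p w').1 s) :=
      map_add (slitFib p) _ _
    rw [h1, slitFib_slitGaugeVal, slitFib_slitGaugeVal, slitFib_slitGaugeVal]
    exact ContinuousLinearMap.map_add _ w w'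
  map_smul' c w := gauge_ext fun s => by
    have h1 : slitFib p ((c • slitGaugeVal p w).1 s) = c * slitFib p ((slitGaugeVal p w).1 s) :=
      map_smul (slitFib p) c _
    rw [RingHom.id_apply, h1, slitFib_slitGaugeVal, slitFib_slitGaugeVal]
    exact ContinuousLinearMap.map_smul _ c w

theorem slitFib_slitGauge (p : L.slit) (w : TangentSpace L.dualModel p) (s : L.Section) :
    slitFib p ((slitGauge p w).1 s) = mvfderiv L.dualModel (liftSection s) p w :=
  slitFib_slitGaugeVal p w s

theorem isSymbolAt_slitGauge (p : L.slit) (w : TangentSpace L.dualModel p) :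
    IsSymbolAt (slitGauge p w) (mfderiv L.dualModel L.base.I slitProj p w) := by
  intro f s
  apply (slitFib p).injective
  rw [slitFib_slitGauge, mvfderiv_liftSection_smul, map_add, map_smul, map_smul, slitFib_slitGauge]
  rfl

/-- It exhibits the fibre coordinate near `p` as the function `ẽ` of a global section, so that its
derivative along `w` can be computed from `slitGauge p w`. -/
theorem liftSection_eventuallyEq_slitCoord {x₀ : L.base} {e : L.Section}
    (he : ∀ᶠ y in nhds x₀, e y = L.frame x₀ y) {p : L.slit} (hp : p.1.1 = x₀) :
    liftSection e =ᶠ[nhds p] slitCoord x₀ := by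
  have hc : ContinuousAt (slitProj (L := L)) p := contMDiff_slitProj.continuous.continuousAt
  have h1 : ∀ᶠ y in nhds (slitProj p), e y = L.frame x₀ y := by
    rwa [show slitProj p = x₀ from hp]
  filter_upwards [hc.eventually h1] with q hq
  exact congrArg q.1.2 hq

/-- A tangent vector is given by its projection `v` and the derivative `c` of the fibre coordinate;
an element of `D_x L` is given by its symbol and its value on a frame `e`. Under `slitGauge` the
symbol is `v` and the value on `e` is `p⁻¹ c`, so the two descriptions match. -/
theorem slitGauge_bijective (p : L.slit) : Function.Bijective (slitGauge p) := by
  obtain ⟨ρ, e, ℓ, hρ, he, hℓf, hℓ⟩ := exists_frame p.1.1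
  have hb := FiberBundle.mem_baseSet_trivializationAt' (F := ℝ) (E := L.fiber) p.1.1
  have hc := liftSection_eventuallyEq_slitCoord he (p := p) rfl
  constructor
  · intro w w' hw
    refine slit_tangent_ext hb ((isSymbolAt_slitGauge p w).unique ?_) ?_
    · rw [hw]
      exact isSymbolAt_slitGauge p w'
    · rw [← hc.mvfderiv_eq_apply, ← hc.mvfderiv_eq_apply, ← slitFib_slitGauge, hw,
        slitFib_slitGauge]
  · intro δ
    obtain ⟨v, hv⟩ := exists_isSymbolAt δ
    obtain ⟨w, hw1, hw2⟩ := exists_slit_tangent hb v (slitFib p (δ.1 e))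
    have h1 := isSymbolAt_slitGauge p w
    rw [hw1] at h1
    refine ⟨w, h1.ext hv hρ hℓ ((slitFib p).injective ?_)⟩
    rw [slitFib_slitGauge, hc.mvfderiv_eq_apply, hw2]

/-- The isomorphism from the tangent space of `L^* \ 0` to the fibre of the gauge algebroid. -/
def slitGaugeEquiv (p : L.slit) : TangentSpace L.dualModel p ≃ₗ[ℝ] L.gaugeFiber p.1.1 :=
  LinearEquiv.ofBijective (slitGauge p) (slitGauge_bijective p)

theorem slitGauge_slitGaugeEquiv_symm (p : L.slit) (δ : L.gaugeFiber p.1.1) :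
    slitGauge p ((slitGaugeEquiv p).symm δ) = δ := (slitGaugeEquiv p).apply_symm_apply δ

/-- A field is a lift of a derivation if and only if it corresponds to it pointwise. -/
theorem isLift_iff {D : L.Der} {V : ∀ p : L.slit, TangentSpace L.dualModel p} :
    IsLift D V ↔ ∀ p, slitGauge p (V p) = evalDer D p.1.1 := by
  constructor
  · intro h p
    refine gauge_ext fun s => ?_
    rw [slitFib_slitGauge, h s p]
    rfl
  · intro h s p
    rw [← slitFib_slitGauge, h]
    rfl

/-- The isomorphisms `slitGauge` are natural. -/
theorem slitGauge_slitMap {L₁ L₂ : LineBundle.{u}} (F : Hom L₁ L₂) (p : L₁.slit)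
    (w : TangentSpace L₁.dualModel p) :
    slitGauge (F.slitMap p) (mfderiv L₁.dualModel L₂.dualModel F.slitMap p w) =
      F.gaugeMap p.1.1 (slitGauge p w) := by
  refine gauge_ext (p := F.slitMap p) fun s => ?_
  rw [slitFib_slitGauge, ← mvfderiv_comp_mfderiv
    ((contMDiff_liftSection s).mdifferentiable (by simp) _)
    (F.contMDiff_slitMap.mdifferentiable (by simp) p)]
  -- The definitions of `F̃` and `F^*` are dual to each other: `λ̃ ∘ F̃ = (F^* λ)~`.
  have h1 : (fun q => liftSection s (F.slitMap q)) = liftSection (F.pullback s) := rfl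
  rw [h1, ← slitFib_slitGauge]
  change _ = slitFib p ((F.fib p.1.1).symm (F.fib p.1.1 ((slitGauge p w).1 (F.pullback s))))
  rw [ContinuousLinearEquiv.symm_apply_apply]

theorem contMDiff_smul_slit (t : ℝˣ) :
    ContMDiff L.dualModel L.dualModel ∞ (fun q : L.slit => t • q) :=
  ContMDiffSMul.contMDiff_const_smul (I := 𝓘(ℝ, ℝ)) t

/-- The isomorphisms `slitGauge` are invariant under the action of `ℝˣ`. -/
theorem slitGauge_smul (t : ℝˣ) (p : L.slit) (w : TangentSpace L.dualModel p) :
    slitGauge (t • p) (mfderiv L.dualModel L.dualModel (fun q : L.slit => t • q) p w) =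
      slitGauge p w := by
  refine gauge_ext (p := t • p) fun s => ?_
  have hs : MDifferentiableAt L.dualModel L.dualModel (fun q : L.slit => t • q) p :=
    (contMDiff_smul_slit t).mdifferentiable (by simp) p
  rw [slitFib_slitGauge, ← mvfderiv_comp_mfderiv
    ((contMDiff_liftSection s).mdifferentiable (by simp) _) hs]
  -- The functions `λ̃` are homogeneous of degree `1`, and so is `slitFib`; the two factors `t`
  -- cancel.
  have h1 : (fun q : L.slit => liftSection s (t • q)) = (fun _ => (t : ℝ)) * liftSection s := rfl
  rw [h1, mvfderiv_mul mdifferentiableAt_const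
    ((contMDiff_liftSection s).mdifferentiable (by simp) p), mvfderiv_const, slitFib_smul,
    slitFib_slitGauge]
  simp

/-! ### Lifts of derivations -/

/-- The lift of a derivation to a vector field on `L^* \ 0`. -/
def lift (D : L.Der) (p : L.slit) : TangentSpace L.dualModel p :=
  (slitGaugeEquiv p).symm (evalDer D p.1.1)

theorem slitGauge_lift (D : L.Der) (p : L.slit) : slitGauge p (lift D p) = evalDer D p.1.1 :=
  slitGauge_slitGaugeEquiv_symm p _

theorem isLift_lift (D : L.Der) : IsLift D (lift D) := isLift_iff.2 (slitGauge_lift D)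

theorem IsLift.eq_lift {D : L.Der} {V : ∀ p : L.slit, TangentSpace L.dualModel p}
    (h : IsLift D V) : V = lift D := by
  ext1 p
  exact (slitGauge_bijective p).1 ((isLift_iff.1 h p).trans (slitGauge_lift D p).symm)

theorem mvfderiv_lift (D : L.Der) (s : L.Section) (p : L.slit) :
    mvfderiv L.dualModel (liftSection s) p (lift D p) = liftSection (D.1 s) p := isLift_lift D s p

/-- In local coordinates the components of the lift are `X ∘ π`, with `X` the symbol of `D`, and the
function `(D e)~`, with `e` extending the local frame. Both are smooth. -/
theorem isSmoothField_lift (D : L.Der) : L.slitMfd.IsSmoothField (lift D) := by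
  intro p
  obtain ⟨X, hX, hDX⟩ := D.2
  obtain ⟨ρ, e, ℓ, hρ, he, hℓf, hℓ⟩ := exists_frame p.1.1
  have hc := liftSection_eventuallyEq_slitCoord he (p := p) rfl
  have h1 : ∀ q : L.slit, mfderiv L.dualModel L.base.I slitProj q (lift D q) = X q.1.1 := by
    intro q
    have h2 := isSymbolAt_slitGauge q (lift D q)
    rw [slitGauge_lift] at h2
    exact h2.unique fun f s => hDX f s q.1.1
  refine contMDiffAt_slit_field ?_ ?_
  · simp only [h1]
    exact (hX p.1.1).comp p (contMDiff_slitProj p)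
  · refine (contMDiff_liftSection (D.1 e) p).congr_of_eventuallyEq ?_
    filter_upwards [hc.eventuallyEq_nhds] with q hq
    rw [← hq.mvfderiv_eq_apply, mvfderiv_lift]

theorem exists_lift_eq (p : L.slit) (w : TangentSpace L.dualModel p) :
    ∃ D : L.Der, lift D p = w := by
  obtain ⟨D, hD⟩ := evalDer_surjective p.1.1 (slitGauge p w)
  exact ⟨D, (slitGauge_bijective p).1 ((slitGauge_lift D p).trans hD)⟩

theorem lift_sub (D D' : L.Der) (p : L.slit) : lift (D - D') p = lift D p - lift D' p := by
  apply (slitGauge_bijective p).1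
  rw [map_sub, slitGauge_lift, slitGauge_lift, slitGauge_lift]
  rfl

/-- Both sides act on every `λ̃` as the commutator of `D` and `D'`, and tangent vectors of `L^* \ 0`
are determined by their action on these functions. -/
theorem lift_bracket (D D' : L.Der) (p : L.slit) :
    lift ⁅D, D'⁆ p = mlieBracket L.dualModel (lift D) (lift D') p := by
  apply (slitGauge_bijective p).1
  refine gauge_ext fun s => ?_
  rw [slitFib_slitGauge, slitFib_slitGauge, mvfderiv_lift, mvfderiv_mlieBracket
    (isSmoothField_lift D) (isSmoothField_lift D') (contMDiff_liftSection s)]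
  simp only [mvfderiv_lift]
  exact map_sub (slitFib p) _ _

/-- A point of `L^* \ 0` over a given point of the base. -/
def pointOver (x : L.base) : L.slit :=
  ⟨⟨x, Trivialization.continuousLinearMapAt ℝ (trivializationAt ℝ L.fiber x) x⟩,
    (L.ne_zero_iff (FiberBundle.mem_baseSet_trivializationAt' x) _).2 (by
      rw [frame]
      erw [(trivializationAt ℝ L.fiber x).continuousLinearMapAt_symmL (R := ℝ)
        (FiberBundle.mem_baseSet_trivializationAt' x) 1]
      exact one_ne_zero)⟩

theorem exists_smul_eq {p q : L.slit} (h : p.1.1 = q.1.1) : ∃ t : ℝˣ, q = t • p := by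
  have hp := FiberBundle.mem_baseSet_trivializationAt' (F := ℝ) (E := L.fiber) p.1.1
  have hq : q.1.1 ∈ (trivializationAt ℝ L.fiber p.1.1).baseSet := h ▸ hp
  have hp0 := slitCoord_ne_zero hp
  have hq0 := slitCoord_ne_zero hq
  refine ⟨Units.mk0 _ (div_ne_zero hq0 hp0), slit_ext hq h.symm ?_⟩
  rw [slitCoord_smul, Units.val_mk0, div_mul_cancel₀ _ hp0]

theorem exists_eq_smul_pointOver (p : L.slit) : ∃ (x : L.base) (t : ℝˣ), p = t • pointOver x :=
  ⟨p.1.1, exists_smul_eq rfl⟩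

theorem lift_injective : Function.Injective (lift (L := L)) := by
  intro D D' h
  refine Subtype.ext (LinearMap.ext fun s => ContMDiffSection.ext fun x => ?_)
  have h1 := (slitGauge_lift D (pointOver x)).symm.trans (by rw [h, slitGauge_lift])
  exact congrArg (fun δ : L.gaugeFiber x => δ.1 s) h1

/-- The point `pointOver x` is chosen separately for each `x` and need not depend smoothly on it.
Whenever smoothness in `x` is needed, it is replaced by this local section of `L^* \ 0`, on which
the fibre coordinate is `1`. -/
theorem contMDiffAt_slitOfCoord_one (x₀ : L.base) :
    ContMDiffAt L.base.I L.dualModel ∞ (fun x => slitOfCoord x₀ (x, 1)) x₀ :=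
  ((contMDiffOn_slitOfCoord x₀).contMDiffAt ((isOpen_coordDomain x₀).mem_nhds
    (⟨FiberBundle.mem_baseSet_trivializationAt' x₀, one_ne_zero⟩ : (x₀, 1) ∈ coordDomain x₀))).comp
      x₀ (contMDiffAt_id.prodMk contMDiffAt_const)

theorem slitFib_slitOfCoord_one {x₀ x : L.base}
    (hx : x ∈ (trivializationAt ℝ L.fiber x₀).baseSet) (s : ∀ x, L.fiber x) :
    slitFib (slitOfCoord x₀ (x, 1)) (s _) = (trivializationAt ℝ L.fiber x₀ ⟨x, s x⟩).2 := by
  have h1 : slitCoord x₀ (slitOfCoord x₀ (x, 1)) = 1 := slitCoord_slitOfCoord hx one_ne_zero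
  have h2 : (slitOfCoord x₀ (x, 1)).1.1 = x := slitOfCoord_proj _ _
  generalize slitOfCoord x₀ (x, 1) = p at *
  subst h2
  conv_lhs => rw [L.frame_eq hx (s p.1.1)]
  rw [map_smul]
  exact (congrArg _ h1).trans (mul_one _)

/-- A smooth field on `L^* \ 0` which is invariant under `ℝˣ` is the lift of a derivation. -/
theorem exists_lift_eq_of_invariant {V : ∀ p : L.slit, TangentSpace L.dualModel p}
    (hV : L.slitMfd.IsSmoothField V)
    (hinv : ∀ (t : ℝˣ) (p : L.slit), slitGauge (t • p) (V (t • p)) = slitGauge p (V p)) :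
    ∃ D : L.Der, lift D = V := by
  -- By invariance any other point over `x` gives the same element `Δ x`. This freedom allows
  -- smoothness to be checked along the smooth local sections.
  let Δ : ∀ x : L.base, L.gaugeFiber x := fun x => slitGauge (pointOver x) (V (pointOver x))
  have hΔ : ∀ p : L.slit, slitGauge p (V p) = Δ p.1.1 := by
    intro p
    obtain ⟨x, t, rfl⟩ := exists_eq_smul_pointOver p
    exact hinv t _
  let X : ∀ x : L.base, TangentSpace L.base.I x := fun x =>
    mfderiv L.dualModel L.base.I slitProj (pointOver x) (V (pointOver x))
  have hΔX : ∀ x, IsSymbolAt (Δ x) (X x) := fun x => isSymbolAt_slitGauge _ _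
  have hX : ∀ p : L.slit, mfderiv L.dualModel L.base.I slitProj p (V p) = X p.1.1 := fun p =>
    (isSymbolAt_slitGauge p (V p)).unique (by rw [hΔ p]; exact hΔX _)
  have hXs : L.base.IsSmoothField X := by
    intro x₀
    have h1 := (contMDiff_slitProj (L := L)).contMDiff_tangentMap (m := ∞) (by simp)
    refine ((h1.comp hV).contMDiffAt.comp x₀ (contMDiffAt_slitOfCoord_one x₀)).congr_of_eventuallyEq
      (Filter.Eventually.of_forall fun x => ?_)
    have h2 : (⟨(slitOfCoord x₀ (x, 1)).1.1, X _⟩ : TangentBundle L.base.I L.base) = ⟨x, X x⟩ := by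
      rw [slitOfCoord_proj]
    refine h2.symm.trans ?_
    exact congrArg (TotalSpace.mk _) (hX _).symm
  have hs : ∀ s : L.Section, ContMDiff L.base.I (L.base.I.prod 𝓘(ℝ, ℝ)) ∞
      (fun x => (⟨x, (Δ x).1 s⟩ : TotalSpace ℝ L.fiber)) := by
    intro s x₀
    rw [contMDiffAt_section]
    have h1 : ContMDiff L.dualModel 𝓘(ℝ, ℝ) ∞
        (fun q => mvfderiv L.dualModel (liftSection s) q (V q)) :=
      hV.contMDiff_mvfderiv (contMDiff_liftSection s)
    refine (h1.contMDiffAt.comp x₀ (contMDiffAt_slitOfCoord_one x₀)).congr_of_eventuallyEq ?_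
    filter_upwards [(trivializationAt ℝ L.fiber x₀).open_baseSet.mem_nhds
      (FiberBundle.mem_baseSet_trivializationAt' x₀)] with x hx
    refine (slitFib_slitOfCoord_one hx fun y => (Δ y).1 s).symm.trans ?_
    rw [← hΔ, slitFib_slitGauge]
    rfl
  refine ⟨⟨{ toFun := fun s => ⟨fun x => (Δ x).1 s, hs s⟩
             map_add' := fun s s' => ContMDiffSection.ext fun x => map_add (Δ x).1 s s'
             map_smul' := fun c s => ContMDiffSection.ext fun x => map_smul (Δ x).1 c s },
    X, hXs, fun f s x => hΔX x f s⟩, ?_⟩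
  ext1 p
  apply (slitGauge_bijective p).1
  rw [slitGauge_lift, hΔ]
  rfl

end LineBundle

/-! ### Complex Atiyah structures and homogeneous complex structures -/

theorem ComplexStructure.ext_J {N : SmoothMfd.{u}} {J J' : ComplexStructure N}
    (h : ∀ p v, J.J p v = J'.J p v) : J = J' := by
  obtain ⟨J, _, _, _⟩ := J
  obtain ⟨J', _, _, _⟩ := J'
  obtain rfl : J = J' := funext fun p => ContinuousLinearMap.ext (h p)
  rfl

/-- A linear endomorphism of a tangent space as a continuous linear map. -/
def tangentEndomorphism {E H M : Type*} [NormedAddCommGroup E] [NormedSpace ℝ E]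
    [FiniteDimensional ℝ E] [TopologicalSpace H] {I : ModelWithCorners ℝ E H} [TopologicalSpace M]
    [ChartedSpace H M] {p : M} (T : TangentSpace I p →ₗ[ℝ] TangentSpace I p) :
    TangentSpace I p →L[ℝ] TangentSpace I p :=
  let T' : E →ₗ[ℝ] E := T
  (LinearMap.toContinuousLinearMap T' : E →L[ℝ] E)

theorem tangentEndomorphism_apply {E H M : Type*} [NormedAddCommGroup E] [NormedSpace ℝ E]
    [FiniteDimensional ℝ E] [TopologicalSpace H] {I : ModelWithCorners ℝ E H} [TopologicalSpace M]
    [ChartedSpace H M] {p : M} (T : TangentSpace I p →ₗ[ℝ] TangentSpace I p)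
    (v : TangentSpace I p) : tangentEndomorphism T v = T v := rfl

theorem ComplexAtiyahStructure.ext_toFun {L : LineBundle.{u}} {K K' : ComplexAtiyahStructure L}
    (h : ∀ x δ, K.toFun x δ = K'.toFun x δ) : K = K' := by
  obtain ⟨⟨K, _⟩, _, _⟩ := K
  obtain ⟨⟨K', _⟩, _, _⟩ := K'
  obtain rfl : K = K' := funext fun x => LinearMap.ext (h x)
  rfl

namespace LineBundle

variable {L : LineBundle.{u}}

/-- The endomorphism `J` of the tangent bundle of `L^* \ 0` corresponds to the endomorphism `K` of
the gauge algebroid. -/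
def Corresponds (K : ∀ x : L.base, L.gaugeFiber x →ₗ[ℝ] L.gaugeFiber x)
    (J : ∀ p : L.slit, TangentSpace L.dualModel p →L[ℝ] TangentSpace L.dualModel p) : Prop :=
  ∀ (p : L.slit) (w : TangentSpace L.dualModel p),
    slitGauge p (J p w) = K p.1.1 (slitGauge p w)

namespace Corresponds

variable {K : GaugeEndomorphism L}
  {J : ∀ p : L.slit, TangentSpace L.dualModel p →L[ℝ] TangentSpace L.dualModel p}

theorem map_lift (h : Corresponds K.toFun J) (D : L.Der) :
    (fun p => J p (lift D p)) = lift (K.onDer D) := by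
  ext1 p
  apply (slitGauge_bijective p).1
  rw [h, slitGauge_lift, slitGauge_lift, K.onDer_at]

theorem apply_lift (h : Corresponds K.toFun J) (D : L.Der) (p : L.slit) :
    J p (lift D p) = lift (K.onDer D) p := congrFun (h.map_lift D) p

/-- Lifting is additive, respects brackets and intertwines `K` with `J`, so it carries one torsion
to the other. Both directions of the integrability statement rest on this identity. -/
theorem lift_torsion (h : Corresponds K.toFun J) (D D' : L.Der) (p : L.slit) :
    lift (⁅K.onDer D, K.onDer D'⁆ - ⁅D, D'⁆ - K.onDer ⁅K.onDer D, D'⁆ - K.onDer ⁅D, K.onDer D'⁆) p =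
      nijenhuis J (lift D) (lift D') p := by
  rw [lift_sub, lift_sub, lift_sub, ← h.apply_lift, ← h.apply_lift, nijenhuis, h.map_lift,
    h.map_lift, lift_bracket, lift_bracket, lift_bracket, lift_bracket]

theorem spanningFamily (h : Corresponds K.toFun J) :
    SpanningFamily (I := L.dualModel) (Set.range (lift (L := L))) J where
  smooth := by
    rintro _ ⟨D, rfl⟩
    exact isSmoothField_lift D
  smooth_map := by
    rintro _ ⟨D, rfl⟩
    have h1 := isSmoothField_lift (K.onDer D)
    rw [← h.map_lift] at h1
    exact h1
  spans p v := by
    obtain ⟨D, hD⟩ := exists_lift_eq p v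
    exact ⟨_, ⟨D, rfl⟩, hD⟩

theorem sq (h : Corresponds K.toFun J)
    (hK : ∀ (x : L.base) (δ : L.gaugeFiber x), K.toFun x (K.toFun x δ) = -δ)
    (p : L.slit) (w : TangentSpace L.dualModel p) : J p (J p w) = -w := by
  apply (slitGauge_bijective p).1
  rw [h, h, hK, map_neg]

end Corresponds

/-- The endomorphism of the tangent bundle of `L^* \ 0` which corresponds to `K`. -/
def coneEndomorphism (K : ∀ x : L.base, L.gaugeFiber x →ₗ[ℝ] L.gaugeFiber x) (p : L.slit) :
    TangentSpace L.dualModel p →L[ℝ] TangentSpace L.dualModel p :=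
  let T : TangentSpace L.dualModel p →ₗ[ℝ] TangentSpace L.dualModel p :=
    (slitGaugeEquiv p).symm.toLinearMap ∘ₗ K p.1.1 ∘ₗ slitGauge p
  tangentEndomorphism T

theorem corresponds_coneEndomorphism (K : ∀ x : L.base, L.gaugeFiber x →ₗ[ℝ] L.gaugeFiber x) :
    Corresponds K (coneEndomorphism K) := by
  intro p w
  rw [coneEndomorphism, tangentEndomorphism_apply]
  exact slitGauge_slitGaugeEquiv_symm p _

/-- The complex structure on `L^* \ 0` defined by a complex Atiyah structure on `L`. -/
def cone (K : ComplexAtiyahStructure L) : ComplexStructure L.slitDual.total where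
  J := coneEndomorphism K.toFun
  smooth _ hV p := (corresponds_coneEndomorphism K.toFun).spanningFamily.contMDiffAt (hV p)
  sq := (corresponds_coneEndomorphism K.toFun).sq K.sq
  torsion V W hV hW p := by
    have h := corresponds_coneEndomorphism K.toFun
    -- Since lifts span the tangent spaces, only lifts need to be tested, and there the torsion is
    -- the lift of the torsion of `K`.
    refine h.spanningFamily.nijenhuis_eq_zero (h.sq K.sq) ?_ hV hW p
    rintro _ ⟨D, rfl⟩ _ ⟨D', rfl⟩ q
    rw [← h.lift_torsion, K.torsion]
    apply (slitGauge_bijective q).1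
    rw [slitGauge_lift, map_zero]
    rfl

/-- Every tangent vector is a value of a lift, so the condition on derivations amounts to a
pointwise one. Uniqueness in both directions and homogeneity then follow fibrewise. -/
theorem isLiftStructure_iff {K : ComplexAtiyahStructure L}
    {J : ComplexStructure L.slitDual.total} :
    IsLiftStructure K J ↔ Corresponds K.toFun J.J := by
  constructor
  · intro h p w
    obtain ⟨D, rfl⟩ := exists_lift_eq p w
    have h1 := isLift_iff.1 (h D (lift D) (isSmoothField_lift D) (isLift_lift D)) p
    rw [h1, slitGauge_lift, K.onDer_at]
  · intro h D V _ hDV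
    rw [isLift_iff] at hDV ⊢
    intro p
    rw [h, hDV, K.onDer_at]

theorem isLiftStructure_cone (K : ComplexAtiyahStructure L) : IsLiftStructure K (cone K) :=
  isLiftStructure_iff.2 (corresponds_coneEndomorphism K.toFun)

theorem IsLiftStructure.unique {K : ComplexAtiyahStructure L}
    {J J' : ComplexStructure L.slitDual.total} (h : IsLiftStructure K J)
    (h' : IsLiftStructure K J') : J = J' :=
  ComplexStructure.ext_J fun p w => (slitGauge_bijective p).1
    ((isLiftStructure_iff.1 h p w).trans (isLiftStructure_iff.1 h' p w).symm)

theorem IsLiftStructure.unique_atiyah {K K' : ComplexAtiyahStructure L}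
    {J : ComplexStructure L.slitDual.total} (h : IsLiftStructure K J)
    (h' : IsLiftStructure K' J) : K = K' :=
  ComplexAtiyahStructure.ext_toFun fun x δ => by
    obtain ⟨w, rfl⟩ := (slitGauge_bijective (pointOver x)).2 δ
    exact (isLiftStructure_iff.1 h _ w).symm.trans (isLiftStructure_iff.1 h' _ w)

theorem IsLiftStructure.isHomogeneous {K : ComplexAtiyahStructure L}
    {J : ComplexStructure L.slitDual.total} (h : IsLiftStructure K J) :
    J.IsHomogeneous (P := L.slitDual) := by
  intro t p w
  rw [isLiftStructure_iff] at h
  apply (slitGauge_bijective (t • p)).1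
  refine (slitGauge_smul t p _).trans ?_
  refine (h p w).trans ?_
  refine Eq.trans ?_ (h (t • p) _).symm
  exact congrArg (K.toFun p.1.1) (slitGauge_smul t p w).symm

/-- The endomorphism of the gauge algebroid defined by an endomorphism of the tangent bundle of
`L^* \ 0`. -/
def gaugeOfCone (J : ∀ p : L.slit, TangentSpace L.dualModel p →L[ℝ] TangentSpace L.dualModel p)
    (x : L.base) : L.gaugeFiber x →ₗ[ℝ] L.gaugeFiber x :=
  slitGauge (pointOver x) ∘ₗ (J (pointOver x)).toLinearMap ∘ₗ
    (slitGaugeEquiv (pointOver x)).symm.toLinearMap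

/-- The endomorphism `gaugeOfCone` is defined through one point of each fibre, where the
correspondence is immediate. Homogeneity of `J` and invariance of `slitGauge` spread it along the
orbit, which is the whole fibre. -/
theorem corresponds_gaugeOfCone {J : ComplexStructure L.slitDual.total}
    (hJ : J.IsHomogeneous (P := L.slitDual)) : Corresponds (gaugeOfCone J.J) J.J := by
  intro p w
  obtain ⟨x, t, rfl⟩ := exists_eq_smul_pointOver p
  obtain ⟨w', rfl⟩ : ∃ w' : TangentSpace L.dualModel (pointOver x),
      mfderiv L.dualModel L.dualModel (fun q : L.slit => t • q) (pointOver x) w' = w := by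
    refine ⟨(slitGaugeEquiv (pointOver x)).symm (slitGauge (t • pointOver x) w),
      (slitGauge_bijective (t • pointOver x)).1 ?_⟩
    exact (slitGauge_smul t _ _).trans (slitGauge_slitGaugeEquiv_symm (pointOver x) _)
  refine (congrArg (slitGauge (t • pointOver x)) (hJ t (pointOver x) w').symm).trans ?_
  refine (slitGauge_smul t _ _).trans ?_
  have h1 : gaugeOfCone J.J x (slitGauge (pointOver x) w') =
      slitGauge (pointOver x) (J.J (pointOver x) w') :=
    congrArg (fun z => slitGauge (pointOver x) (J.J (pointOver x) z))
      ((slitGaugeEquiv (pointOver x)).symm_apply_apply w')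
  exact h1.symm.trans (congrArg (gaugeOfCone J.J x) (slitGauge_smul t _ w').symm)

/-- The field `J D̃` is smooth and corresponds at every point to a value depending only on the base
point; hence it is an invariant field and so a lift. -/
theorem exists_der_gaugeOfCone {J : ComplexStructure L.slitDual.total}
    (hJ : J.IsHomogeneous (P := L.slitDual)) (D : L.Der) :
    ∃ D' : L.Der, ∀ x, evalDer D' x = gaugeOfCone J.J x (evalDer D x) := by
  have h1 : ∀ p : L.slit, slitGauge p (J.J p (lift D p)) =
      gaugeOfCone J.J p.1.1 (evalDer D p.1.1) := fun p => by
    rw [corresponds_gaugeOfCone hJ, slitGauge_lift]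
  obtain ⟨D', hD'⟩ := exists_lift_eq_of_invariant (V := fun p => J.J p (lift D p))
    (J.smooth _ (isSmoothField_lift D)) fun t p => (h1 (t • p)).trans (h1 p).symm
  refine ⟨D', fun x => ?_⟩
  have h2 := slitGauge_lift D' (pointOver x)
  rw [hD'] at h2
  exact h2.symm.trans (h1 _)

/-- The complex Atiyah structure defined by a homogeneous complex structure on `L^* \ 0`. -/
def atiyahOfCone (J : ComplexStructure L.slitDual.total)
    (hJ : J.IsHomogeneous (P := L.slitDual)) : ComplexAtiyahStructure L where
  toFun := gaugeOfCone J.J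
  smooth := exists_der_gaugeOfCone hJ
  sq x δ := by
    obtain ⟨w, rfl⟩ := (slitGauge_bijective (pointOver x)).2 δ
    have h := corresponds_gaugeOfCone hJ (pointOver x)
    refine (congrArg (gaugeOfCone J.J x) (h w).symm).trans ((h _).symm.trans ?_)
    rw [J.sq, map_neg]
    rfl
  torsion D D' := by
    -- The torsion of the descended structure lifts to the Nijenhuis torsion of `J` on lifts, which
    -- vanishes.
    apply lift_injective
    ext1 p
    refine ((corresponds_gaugeOfCone hJ : Corresponds (GaugeEndomorphism.toFun
      ⟨gaugeOfCone J.J, exists_der_gaugeOfCone hJ⟩) J.J).lift_torsion D D' p).trans ?_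
    refine (J.torsion _ _ (isSmoothField_lift D) (isSmoothField_lift D') p).trans ?_
    apply (slitGauge_bijective p).1
    rw [slitGauge_lift, map_zero]
    rfl

theorem isLiftStructure_atiyahOfCone {J : ComplexStructure L.slitDual.total}
    (hJ : J.IsHomogeneous (P := L.slitDual)) : IsLiftStructure (atiyahOfCone J hJ) J :=
  isLiftStructure_iff.2 (corresponds_gaugeOfCone hJ)

/-- A morphism of line bundles is compatible with complex Atiyah structures if and only if the
induced map is holomorphic. -/
theorem isHolomorphic_slitMap_iff {L₁ L₂ : LineBundle.{u}} {K₁ : ComplexAtiyahStructure L₁}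
    {K₂ : ComplexAtiyahStructure L₂} {J₁ : ComplexStructure L₁.slitDual.total}
    {J₂ : ComplexStructure L₂.slitDual.total} (h₁ : IsLiftStructure K₁ J₁)
    (h₂ : IsLiftStructure K₂ J₂) (F : Hom L₁ L₂) :
    IsHolomorphic J₁ J₂ F.slitMap ↔ ∀ (x : L₁.base) (δ : L₁.gaugeFiber x),
      F.gaugeMap x (K₁.toFun x δ) = K₂.toFun (F.base x) (F.gaugeMap x δ) := by
  rw [isLiftStructure_iff] at h₁ h₂
  have key : ∀ (p : L₁.slit) (w : TangentSpace L₁.dualModel p),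
      mfderiv L₁.dualModel L₂.dualModel F.slitMap p (J₁.J p w) =
        J₂.J (F.slitMap p) (mfderiv L₁.dualModel L₂.dualModel F.slitMap p w) ↔
      F.gaugeMap p.1.1 (K₁.toFun p.1.1 (slitGauge p w)) =
        K₂.toFun (F.base p.1.1) (F.gaugeMap p.1.1 (slitGauge p w)) := by
    intro p w
    have e1 : slitGauge (F.slitMap p) (mfderiv L₁.dualModel L₂.dualModel F.slitMap p (J₁.J p w)) =
        F.gaugeMap p.1.1 (K₁.toFun p.1.1 (slitGauge p w)) := by
      rw [slitGauge_slitMap, h₁]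
    have e2 : slitGauge (F.slitMap p)
        (J₂.J (F.slitMap p) (mfderiv L₁.dualModel L₂.dualModel F.slitMap p w)) =
        K₂.toFun (F.base p.1.1) (F.gaugeMap p.1.1 (slitGauge p w)) := by
      rw [h₂, slitGauge_slitMap]
      rfl
    rw [← e1, ← e2]
    exact (slitGauge_bijective (F.slitMap p)).1.eq_iff.symm
  constructor
  · intro h x δ
    obtain ⟨w, rfl⟩ := (slitGauge_bijective (pointOver x)).2 δ
    exact (key _ w).1 (h.2 _ w)
  · exact fun h => ⟨F.contMDiff_slitMap, fun p w => (key p w).2 (h _ _)⟩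

end LineBundle

/-! ### Line bundle maps and equivariant maps of slit duals -/

namespace LineBundle

/-- One point `ε` in each fibre suffices: the value of the map there gives the image of the base
point and `ε ∘ F_x⁻¹`, and `ε` can be cancelled since it is injective. -/
theorem Hom.slitMap_injective {L₁ L₂ : LineBundle.{u}} :
    Function.Injective (Hom.slitMap (L₁ := L₁) (L₂ := L₂)) := by
  rintro ⟨b, f, hb, hf⟩ ⟨b', f', hb', hf'⟩ h
  have h0 : ∀ x, slitMap ⟨b, f, hb, hf⟩ (pointOver x) = slitMap ⟨b', f', hb', hf'⟩ (pointOver x) :=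
    fun x => congrFun h _
  obtain rfl : b = b' := funext fun x => congrArg (fun q : L₂.slit => q.1.1) (h0 x)
  obtain rfl : f = f' := by
    funext x
    ext v
    have h1 := TotalSpace.mk_inj.1 (show TotalSpace.mk' (ℝ →L[ℝ] ℝ) (b x) (show L₂.dualFiber (b x) from
      (pointOver x).1.2.comp ((f x).symm : L₂.fiber (b x) →L[ℝ] L₁.fiber x)) =
      TotalSpace.mk' (ℝ →L[ℝ] ℝ) (b x) (show L₂.dualFiber (b x) from
        (pointOver x).1.2.comp ((f' x).symm : L₂.fiber (b x) →L[ℝ] L₁.fiber x)) from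
      congrArg Subtype.val (h0 x))
    have h2 : slitFib (pointOver x) ((f x).symm (f x v)) =
        slitFib (pointOver x) ((f' x).symm (f x v)) := congrArg (fun T => T (f x v)) h1
    have h3 := (slitFib (pointOver x)).injective h2
    rw [ContinuousLinearEquiv.symm_apply_apply] at h3
    conv_rhs => rw [h3]
    exact ((f' x).apply_symm_apply _).symm
  rfl

/-- A point of `L^* \ 0` as a continuous linear isomorphism from the fibre of `L` to `ℝ`. -/
def slitFibCLE {L : LineBundle.{u}} (p : L.slit) : L.fiber p.1.1 ≃L[ℝ] ℝ where
  toLinearEquiv := slitFib p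
  continuous_toFun := ContinuousLinearMap.continuous p.1.2
  continuous_invFun := by
    -- The inverse is `c ↦ c • p⁻¹(1)`; its continuity uses continuity of scalar multiplication in
    -- the fibre, inherited from `ℝ` through a trivialisation.
    have : ContinuousSMul ℝ (L.fiber p.1.1) :=
      (VectorBundle.continuousLinearEquivAt ℝ ℝ L.fiber p.1.1).continuousSMul
    have h1 : ∀ c : ℝ, (slitFib p).symm c = c • (slitFib p).symm 1 := fun c => by
      rw [← map_smul, smul_eq_mul, mul_one]
    exact (continuous_id.smul continuous_const).congr fun c => (h1 c).symm

theorem slitFib_eq_mul {L : LineBundle.{u}} {x₀ : L.base} {p : L.slit}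
    (h : p.1.1 ∈ (trivializationAt ℝ L.fiber x₀).baseSet) (v : L.fiber p.1.1) :
    slitFib p v = (trivializationAt ℝ L.fiber x₀ ⟨p.1.1, v⟩).2 * slitCoord x₀ p := by
  conv_lhs => rw [L.frame_eq h v]
  rw [map_smul]
  rfl

section Equivariant

variable {L₁ L₂ : LineBundle.{u}} {φ : L₁.slit → L₂.slit}

theorem proj_of_equivariant (hφe : ∀ (t : ℝˣ) (p : L₁.slit), φ (t • p) = t • φ p) {p q : L₁.slit}
    (h : p.1.1 = q.1.1) : (φ p).1.1 = (φ q).1.1 := by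
  obtain ⟨t, rfl⟩ := exists_smul_eq h
  rw [hφe]
  rfl

/-- The map on fibres corresponding to a map `L₁^* \ 0 → L₂^* \ 0`. -/
def fibOfSlitMap (φ : L₁.slit → L₂.slit) (x : L₁.base) :
    L₁.fiber x ≃L[ℝ] L₂.fiber (φ (pointOver x)).1.1 :=
  (slitFibCLE (pointOver x)).trans (slitFibCLE (φ (pointOver x))).symm

theorem slitFib_fibOfSlitMap (φ : L₁.slit → L₂.slit) (x : L₁.base) (v : L₁.fiber x) :
    slitFib (φ (pointOver x)) (fibOfSlitMap φ x v) = slitFib (pointOver x) v :=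
  (slitFibCLE (φ (pointOver x))).apply_symm_apply _

/-- The fibre map is `φ(p)⁻¹ ∘ p` with `p = pointOver x`. Equivariance lets `p` be replaced by any
`t p`, in particular by the value of a smooth local section. -/
theorem triv_fibOfSlitMap (hφe : ∀ (t : ℝˣ) (p : L₁.slit), φ (t • p) = t • φ p) {x₁ : L₂.base}
    {x : L₁.base} (hx : (φ (pointOver x)).1.1 ∈ (trivializationAt ℝ L₂.fiber x₁).baseSet)
    (t : ℝˣ) (v : L₁.fiber x) :
    (trivializationAt ℝ L₂.fiber x₁ ⟨_, fibOfSlitMap φ x v⟩).2 *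
      slitCoord x₁ (φ (t • pointOver x)) = t * slitFib (pointOver x) v := by
  rw [hφe, slitCoord_smul]
  have h1 := slitFib_eq_mul hx (fibOfSlitMap φ x v)
  rw [slitFib_fibOfSlitMap] at h1
  refine Eq.trans ?_ (congrArg (fun c => (t : ℝ) * c) h1.symm)
  ring

variable (hφ : ContMDiff L₁.dualModel L₂.dualModel ∞ φ)
  (hφe : ∀ (t : ℝˣ) (p : L₁.slit), φ (t • p) = t • φ p)

include hφ hφe in
theorem contMDiff_base_of_equivariant :
    ContMDiff L₁.base.I L₂.base.I ∞ (fun x => (φ (pointOver x)).1.1) := by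
  intro x₀
  refine (((contMDiff_slitProj.comp hφ).contMDiffAt).comp x₀
    (contMDiffAt_slitOfCoord_one x₀)).congr_of_eventuallyEq (Filter.Eventually.of_forall fun x => ?_)
  exact proj_of_equivariant hφe (slitOfCoord_proj x₀ (x, 1)).symm

-- Let `σ` be the local section of `L₁^* \ 0` on which the fibre coordinate is `1`. In local
-- coordinates the fibre map is multiplication by the inverse of the fibre coordinate of `φ(σ(x))`,
-- a smooth nowhere vanishing function.
include hφ hφe in
theorem contMDiff_fibOfSlitMap :
    ContMDiff (L₁.base.I.prod 𝓘(ℝ, ℝ)) (L₂.base.I.prod 𝓘(ℝ, ℝ)) ∞ (fun e : TotalSpace ℝ L₁.fiber =>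
      (⟨(φ (pointOver e.1)).1.1, fibOfSlitMap φ e.1 e.2⟩ : TotalSpace ℝ L₂.fiber)) := by
  intro e₀
  have hb := contMDiff_base_of_equivariant hφ hφe
  have hp : ContMDiff (L₁.base.I.prod 𝓘(ℝ, ℝ)) L₁.base.I ∞
    (fun e : TotalSpace ℝ L₁.fiber => e.1) := Bundle.contMDiff_proj L₁.fiber
  rw [contMDiffAt_totalSpace]
  refine ⟨hb.contMDiffAt.comp e₀ (hp e₀), ?_⟩
  have hx₀ := FiberBundle.mem_baseSet_trivializationAt' (F := ℝ) (E := L₁.fiber) e₀.1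
  have hx₁ := FiberBundle.mem_baseSet_trivializationAt' (F := ℝ) (E := L₂.fiber)
    (φ (pointOver e₀.1)).1.1
  set x₁ := (φ (pointOver e₀.1)).1.1 with hx₁e
  have hmem : (φ (slitOfCoord e₀.1 (e₀.1, 1))).1.1 ∈ (trivializationAt ℝ L₂.fiber x₁).baseSet := by
    rw [proj_of_equivariant hφe (q := pointOver e₀.1) (slitOfCoord_proj e₀.1 (e₀.1, 1))]
    exact hx₁
  have hc : ContMDiffAt L₁.base.I 𝓘(ℝ, ℝ) ∞
      (fun x => slitCoord x₁ (φ (slitOfCoord e₀.1 (x, 1)))) e₀.1 :=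
    (contMDiffAt_slitCoord hmem).comp e₀.1
      (hφ.contMDiffAt.comp e₀.1 (contMDiffAt_slitOfCoord_one e₀.1))
  have h1 : ContMDiffAt (L₁.base.I.prod 𝓘(ℝ, ℝ)) 𝓘(ℝ, ℝ) ∞
      (fun e => (trivializationAt ℝ L₁.fiber e₀.1 e).2) e₀ :=
    ((contMDiffAt_totalSpace (F := ℝ) (E := L₁.fiber)).1 contMDiffAt_id).2
  have h2 := (hc.inv₀ (slitCoord_ne_zero hmem)).comp e₀ (hp e₀)
  refine (h1.mul h2).congr_of_eventuallyEq ?_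
  filter_upwards [hp.continuous.continuousAt.eventually_mem
      ((trivializationAt ℝ L₁.fiber e₀.1).open_baseSet.mem_nhds hx₀),
    (hb.continuous.comp hp.continuous).continuousAt.eventually_mem
      ((trivializationAt ℝ L₂.fiber x₁).open_baseSet.mem_nhds hx₁)] with e he he'
  -- The factor `t` relates the reference point to the smooth local section. It drops out of the
  -- coordinate formula because that section has fibre coordinate `1`.
  obtain ⟨t, ht⟩ := exists_smul_eq (p := pointOver e.1) (q := slitOfCoord e₀.1 (e.1, 1))
    (slitOfCoord_proj e₀.1 (e.1, 1)).symm
  have h3 := triv_fibOfSlitMap hφe he' t e.2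
  have h4 : t * slitFib (pointOver e.1) e.2 = (trivializationAt ℝ L₁.fiber e₀.1 e).2 := by
    have h6 : slitCoord e₀.1 (t • pointOver e.1) = 1 := by
      rw [← ht, slitCoord_slitOfCoord he one_ne_zero]
    refine (congrArg (fun c => (t : ℝ) * c) (slitFib_eq_mul (p := pointOver e.1) he e.2)).trans ?_
    refine (mul_left_comm _ _ _).trans ?_
    rw [← slitCoord_smul, h6]
    exact mul_one _
  replace h3 := h3.trans h4
  rw [← ht] at h3
  have h5 : slitCoord x₁ (φ (slitOfCoord e₀.1 (e.1, 1))) ≠ 0 := by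
    refine slitCoord_ne_zero ?_
    rw [proj_of_equivariant hφe (q := pointOver e.1) (slitOfCoord_proj e₀.1 (e.1, 1))]
    exact he'
  exact (eq_mul_inv_iff_mul_eq₀ h5).2 h3

/-- The morphism of line bundles defined by a smooth equivariant map `L₁^* \ 0 → L₂^* \ 0`. -/
def homOfSlitMap : Hom L₁ L₂ where
  base x := (φ (pointOver x)).1.1
  fib := fibOfSlitMap φ
  smooth_base := contMDiff_base_of_equivariant hφ hφe
  smooth := contMDiff_fibOfSlitMap hφ hφe

/-- At a reference point, `p ∘ (φ(p)⁻¹ ∘ p)⁻¹ = φ(p)`; all other points follow by equivariance. -/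
theorem slitMap_homOfSlitMap : (homOfSlitMap hφ hφe).slitMap = φ := by
  ext1 p
  obtain ⟨x, t, rfl⟩ := exists_eq_smul_pointOver p
  rw [Hom.slitMap_smul, hφe]
  congr 1
  refine Subtype.ext (congrArg (TotalSpace.mk _) (ContinuousLinearMap.ext fun v => ?_))
  exact (slitFibCLE (pointOver x)).apply_symm_apply _

end Equivariant

end LineBundle

/-! ### The line bundle associated with a principal bundle -/

namespace HomogeneousManifold

variable (P : HomogeneousManifold.{u})

/-- A local trivialisation of the principal bundle near `y`. -/
def triv (y : P.base) : Trivialization ℝˣ P.proj := (P.locally_trivial y).choose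

theorem mem_triv (y : P.base) : y ∈ (P.triv y).baseSet := (P.locally_trivial y).choose_spec.1

theorem contMDiffOn_triv (y : P.base) :
    ContMDiffOn P.total.I (P.base.I.prod 𝓘(ℝ, ℝ)) ∞ (P.triv y) (P.triv y).source :=
  (P.locally_trivial y).choose_spec.2.1

theorem contMDiffOn_triv_symm (y : P.base) :
    ContMDiffOn (P.base.I.prod 𝓘(ℝ, ℝ)) P.total.I ∞ (P.triv y).toOpenPartialHomeomorph.symm
      (P.triv y).target :=
  (P.locally_trivial y).choose_spec.2.2.1

theorem triv_smul {y : P.base} {p : P.total} (hp : P.proj p ∈ (P.triv y).baseSet) (t : ℝˣ) :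
    P.triv y (t • p) = (P.proj p, t * (P.triv y p).2) :=
  (P.locally_trivial y).choose_spec.2.2.2 p ((P.triv y).mem_source.2 hp) t

/-- The local section of the principal bundle defined by a local trivialisation. -/
def sec (y x : P.base) : P.total := (P.triv y).toOpenPartialHomeomorph.symm (x, 1)

variable {P}

theorem proj_sec {y x : P.base} (hx : x ∈ (P.triv y).baseSet) : P.proj (P.sec y x) = x :=
  (P.triv y).proj_symm_apply' hx

theorem triv_sec {y x : P.base} (hx : x ∈ (P.triv y).baseSet) : P.triv y (P.sec y x) = (x, 1) :=
  (P.triv y).apply_symm_apply' hx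

theorem triv_smul_sec {y : P.base} {p : P.total} (hp : P.proj p ∈ (P.triv y).baseSet) :
    (P.triv y p).2 • P.sec y (P.proj p) = p := by
  have h1 := proj_sec hp
  have h2 := P.triv_smul (p := P.sec y (P.proj p)) (by rw [h1]; exact hp) (P.triv y p).2
  rw [triv_sec hp, h1, mul_one] at h2
  refine (P.triv y).injOn ?_ ((P.triv y).mem_source.2 hp) (h2.trans ?_)
  · rw [(P.triv y).mem_source, P.proj_smul, h1]
    exact hp
  · exact Prod.ext ((P.triv y).coe_fst' hp).symm rfl

variable (P) in
/-- The fibre at `x` of the line bundle associated with the principal bundle `P`: the homogeneous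
functions of degree `1` on the fibre of `P` at `x`, extended by zero. -/
def fiber (x : P.base) : Submodule ℝ (P.total → ℝ) where
  carrier := {f | (∀ (t : ℝˣ) (p : P.total), f (t • p) = t * f p) ∧ ∀ p, P.proj p ≠ x → f p = 0}
  zero_mem' := ⟨fun _ _ => (mul_zero _).symm, fun _ _ => rfl⟩
  add_mem' := by
    rintro f g ⟨hf, hf'⟩ ⟨hg, hg'⟩
    refine ⟨fun t p => ?_, fun p hp => ?_⟩
    · rw [Pi.add_apply, hf, hg, Pi.add_apply, mul_add]
    · rw [Pi.add_apply, hf' p hp, hg' p hp, add_zero]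
  smul_mem' := by
    rintro c f ⟨hf, hf'⟩
    refine ⟨fun t p => ?_, fun p hp => ?_⟩
    · rw [Pi.smul_apply, hf, Pi.smul_apply, smul_eq_mul, smul_eq_mul, mul_left_comm]
    · rw [Pi.smul_apply, hf' p hp, smul_zero]

/-- The fibre of `P` is a single orbit, so a homogeneous function on it is determined by its value
at `P.sec y x`. This value is the linear coordinate that trivialises the line bundle. -/
theorem fiber_apply {y x : P.base} (hx : x ∈ (P.triv y).baseSet) (f : P.fiber x) {p : P.total}
    (hp : P.proj p = x) : f.1 p = (P.triv y p).2 * f.1 (P.sec y x) := by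
  subst hp
  exact (congrArg f.1 (triv_smul_sec hx).symm).trans (f.2.1 _ _)

open Classical in
/-- The element of the fibre at `x` with a given coordinate. -/
def ofCoord (y x : P.base) (c : ℝ) : P.fiber x :=
  if hx : x ∈ (P.triv y).baseSet then
    ⟨fun p => if P.proj p = x then (P.triv y p).2 * c else 0, fun t p => by
      dsimp only
      by_cases hp : P.proj p = x
      · rw [if_pos ((P.proj_smul t p).trans hp), if_pos hp, P.triv_smul (hp ▸ hx), Units.val_mul,
          mul_assoc]
      · rw [if_neg fun h => hp ((P.proj_smul t p).symm.trans h), if_neg hp, mul_zero],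
      fun p hp => if_neg hp⟩
  else 0

theorem ofCoord_apply {y x : P.base} (hx : x ∈ (P.triv y).baseSet) (c : ℝ) {p : P.total}
    (hp : P.proj p = x) : (ofCoord y x c).1 p = (P.triv y p).2 * c := by
  rw [ofCoord, dif_pos hx]
  exact if_pos hp

theorem ofCoord_sec {y x : P.base} (hx : x ∈ (P.triv y).baseSet) (c : ℝ) :
    (ofCoord y x c).1 (P.sec y x) = c := by
  rw [ofCoord_apply hx c (proj_sec hx), triv_sec hx, Units.val_one, one_mul]

theorem fiber_ext {y x : P.base} (hx : x ∈ (P.triv y).baseSet) {f g : P.fiber x}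
    (h : f.1 (P.sec y x) = g.1 (P.sec y x)) : f = g := by
  refine Subtype.ext (funext fun p => ?_)
  by_cases hp : P.proj p = x
  · rw [fiber_apply hx f hp, fiber_apply hx g hp, h]
  · rw [f.2.2 p hp, g.2.2 p hp]

variable (P) in
/-- The local trivialisation of the associated line bundle. -/
def pretriv (y : P.base) :
    Pretrivialization ℝ (TotalSpace.proj : TotalSpace ℝ (fun x => P.fiber x) → P.base) where
  toFun z := (z.1, z.2.1 (P.sec y z.1))
  invFun z := ⟨z.1, ofCoord y z.1 z.2⟩
  source := TotalSpace.proj ⁻¹' (P.triv y).baseSet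
  target := (P.triv y).baseSet ×ˢ Set.univ
  map_source' z hz := ⟨hz, trivial⟩
  map_target' z hz := hz.1
  left_inv' := by
    rintro ⟨x, f⟩ hx
    exact congrArg (TotalSpace.mk x) (fiber_ext hx (ofCoord_sec hx _))
  right_inv' := by
    rintro ⟨x, c⟩ ⟨hx, -⟩
    exact Prod.ext rfl (ofCoord_sec hx c)
  open_target := (P.triv y).open_baseSet.prod isOpen_univ
  baseSet := (P.triv y).baseSet
  open_baseSet := (P.triv y).open_baseSet
  source_eq := rfl
  target_eq := rfl
  proj_toFun _ _ := rfl

theorem pretriv_symm {y x : P.base} (hx : x ∈ (P.triv y).baseSet) (c : ℝ) :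
    (P.pretriv y).symm x c = ofCoord y x c := by
  have h1 : x ∈ (P.pretriv y).baseSet := hx
  refine fiber_ext hx ?_
  have h2 := (P.pretriv y).apply_mk_symm h1 c
  exact (congrArg Prod.snd h2).trans (ofCoord_sec hx c).symm

/-- The transition functions of the associated line bundle. -/
def transition (y y' : P.base) (x : P.base) : ℝ →L[ℝ] ℝ :=
  ((P.triv y (P.sec y' x)).2 : ℝ) • ContinuousLinearMap.id ℝ ℝ

theorem contMDiffOn_transition (y y' : P.base) :
    ContMDiffOn P.base.I 𝓘(ℝ, ℝ →L[ℝ] ℝ) ∞ (transition y y')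
      ((P.triv y).baseSet ∩ (P.triv y').baseSet) := by
  have h1 : ContMDiffOn P.base.I P.total.I ∞ (P.sec y') (P.triv y').baseSet :=
    (P.contMDiffOn_triv_symm y').comp (contMDiffOn_id.prodMk contMDiffOn_const)
      fun x hx => (P.triv y').mem_target.2 hx
  have h2 : ContMDiffOn P.base.I (P.base.I.prod 𝓘(ℝ, ℝ)) ∞ (fun x => P.triv y (P.sec y' x))
      ((P.triv y).baseSet ∩ (P.triv y').baseSet) :=
    (P.contMDiffOn_triv y).comp (h1.mono Set.inter_subset_right) fun x hx => by
      rw [Set.mem_preimage, (P.triv y).mem_source, proj_sec hx.2]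
      exact hx.1
  have h3 : ContMDiffOn P.base.I 𝓘(ℝ, ℝ) ∞ (fun x => ((P.triv y (P.sec y' x)).2 : ℝ))
      ((P.triv y).baseSet ∩ (P.triv y').baseSet) :=
    (Units.contMDiff_val.comp contMDiff_snd).comp_contMDiffOn h2
  exact h3.smul contMDiffOn_const

theorem transition_apply {y y' x : P.base} (hx : x ∈ (P.triv y).baseSet ∩ (P.triv y').baseSet)
    (c : ℝ) : transition y y' x c = (P.pretriv y' ⟨x, (P.pretriv y).symm x c⟩).2 := by
  rw [pretriv_symm hx.1]
  exact (ofCoord_apply hx.1 c (proj_sec hx.2)).symm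

variable (P) in
/-- The prebundle structure of the associated line bundle. -/
def prebundle : VectorPrebundle ℝ ℝ (fun x => P.fiber x) where
  pretrivializationAtlas := Set.range P.pretriv
  pretrivialization_linear' := by
    rintro _ ⟨y, rfl⟩
    exact ⟨fun x _ => ⟨fun _ _ => rfl, fun _ _ => rfl⟩⟩
  pretrivializationAt := P.pretriv
  mem_base_pretrivializationAt := P.mem_triv
  pretrivialization_mem_atlas y := ⟨y, rfl⟩
  exists_coordChange := by
    rintro _ ⟨y, rfl⟩ _ ⟨y', rfl⟩
    exact ⟨transition y y', (contMDiffOn_transition y y').continuousOn,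
      fun x hx c => transition_apply hx c⟩
  totalSpaceMk_isInducing x := by
    have hx := P.mem_triv x
    -- The fibre carries the topology of pointwise convergence. It agrees with that of `ℝ` because,
    -- at each point, the function with coordinate `c` takes a value proportional to `c`.
    let h : P.fiber x ≃ₜ ℝ :=
      { toFun := fun f => f.1 (P.sec x x)
        invFun := ofCoord x x
        left_inv := fun f => fiber_ext hx (ofCoord_sec hx _)
        right_inv := fun c => ofCoord_sec hx c
        continuous_toFun := (continuous_apply _).comp continuous_subtype_val
        continuous_invFun := by
          refine Continuous.subtype_mk (p := fun f => f ∈ P.fiber x)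
            (f := fun c => (ofCoord x x c).1) (continuous_pi fun p => ?_) _
          by_cases hp : P.proj p = x
          · simp only [ofCoord_apply hx _ hp]
            exact continuous_const.mul continuous_id
          · simp only [(ofCoord x x _).2.2 p hp]
            exact continuous_const }
    have h1 : Topology.IsInducing fun c : ℝ => (x, c) := isInducing_prodMkRight x
    exact h1.comp h.isInducing

instance : P.prebundle.IsContMDiff P.base.I ∞ where
  exists_contMDiffCoordChange := by
    rintro _ ⟨y, rfl⟩ _ ⟨y', rfl⟩
    exact ⟨transition y y', contMDiffOn_transition y y', fun x hx c => transition_apply hx c⟩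

variable (P) in
/-- The line bundle associated with a homogeneous manifold. -/
def lineBundle : LineBundle.{u} :=
  letI := P.prebundle.totalSpaceTopology
  letI := P.prebundle.toFiberBundle
  letI := P.prebundle.toVectorBundle
  { base := P.base
    fiber := fun x => P.fiber x
    smooth := P.prebundle.contMDiffVectorBundle (n := ∞) (IB := P.base.I) }

/-! ### The identification of `P` with the slit dual of its line bundle -/

/-- The frame is the homogeneous function equal to `1` on the local section, which is the principal
coordinate itself. Consequently `toSlit` is the identity in local coordinates, whence its
equivariance, bijectivity and smoothness in both directions. -/
theorem frame_lineBundle {y x : P.base} (hx : x ∈ (P.triv y).baseSet) {p : P.total}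
    (hp : P.proj p = x) :
    (show P.fiber x from P.lineBundle.frame y x).1 p = (P.triv y p).2 := by
  have h1 := fiber_apply hx (P.lineBundle.frame y x) hp
  have h2 : (show P.fiber x from P.lineBundle.frame y x).1 (P.sec y x) = 1 :=
    P.lineBundle.triv_frame (x₀ := y) (x := x) hx
  exact h1.trans (by rw [h2, mul_one])

/-- Evaluation at a point of `P` as a linear form on the fibre of the line bundle. -/
def ev (p : P.total) : P.lineBundle.dualFiber (P.proj p) :=
  ({ toFun := fun f => f.1 p
     map_add' := fun _ _ => rfl
     map_smul' := fun _ _ => rfl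
     cont := (continuous_apply p).comp continuous_subtype_val } : P.fiber (P.proj p) →L[ℝ] ℝ)

/-- The map from `P` to the slit dual of its line bundle. -/
def toSlit (p : P.total) : P.lineBundle.slit :=
  ⟨⟨P.proj p, ev p⟩, (P.lineBundle.ne_zero_iff (x₀ := P.proj p) (P.mem_triv (P.proj p)) _).2
    fun h => Units.ne_zero _ ((frame_lineBundle (P.mem_triv (P.proj p)) rfl).symm.trans h)⟩

theorem slitCoord_toSlit {y : P.base} {p : P.total} (hp : P.proj p ∈ (P.triv y).baseSet) :
    LineBundle.slitCoord (L := P.lineBundle) y (toSlit p) = (P.triv y p).2 :=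
  frame_lineBundle hp rfl

theorem toSlit_smul (t : ℝˣ) (p : P.total) : toSlit (t • p) = t • toSlit p := by
  have hp := P.mem_triv (P.proj p)
  have hp' : P.proj (t • p) ∈ (P.triv (P.proj p)).baseSet := by rw [P.proj_smul]; exact hp
  refine LineBundle.slit_ext (x₀ := P.proj p) hp' (P.proj_smul t p) ?_
  have h1 := LineBundle.slitCoord_smul (L := P.lineBundle) (P.proj p) t (toSlit p)
  rw [slitCoord_toSlit hp] at h1
  refine (slitCoord_toSlit hp').trans (Eq.trans ?_ h1.symm)
  rw [P.triv_smul hp, Units.val_mul]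

theorem toSlit_injective : Function.Injective (toSlit (P := P)) := by
  intro p q h
  have hpq : P.proj p = P.proj q := congrArg (fun z : P.lineBundle.slit => z.1.1) h
  have hp := P.mem_triv (P.proj p)
  have hq : P.proj q ∈ (P.triv (P.proj p)).baseSet := hpq ▸ hp
  have h1 := congrArg (LineBundle.slitCoord (L := P.lineBundle) (P.proj p)) h
  rw [slitCoord_toSlit hp, slitCoord_toSlit hq, Units.val_inj] at h1
  have e1 := triv_smul_sec hp
  rw [h1, hpq] at e1
  rw [← hpq] at e1
  have e2 := triv_smul_sec hq
  rw [← hpq] at e2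
  exact e1.symm.trans e2

/-- The local inverse of `toSlit`. -/
def ofSlitLocal (y : P.base) (q : P.lineBundle.slit) : P.total :=
  (P.triv y).toOpenPartialHomeomorph.symm (q.1.1, LineBundle.slitUnit (L := P.lineBundle) y q)

theorem toSlit_ofSlitLocal {y : P.base} {q : P.lineBundle.slit}
    (hq : q.1.1 ∈ (P.triv y).baseSet) : toSlit (ofSlitLocal y q) = q := by
  have h1 : P.proj (ofSlitLocal y q) = q.1.1 := (P.triv y).proj_symm_apply' hq
  have h2 : P.triv y (ofSlitLocal y q) =
    (q.1.1, LineBundle.slitUnit (L := P.lineBundle) y q) := (P.triv y).apply_symm_apply' hq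
  have h3 : P.proj (ofSlitLocal y q) ∈ (P.triv y).baseSet := by rw [h1]; exact hq
  refine LineBundle.slit_ext (L := P.lineBundle) (x₀ := y) h3 h1 ?_
  rw [slitCoord_toSlit h3, h2]
  exact LineBundle.slitUnit_val hq

theorem toSlit_bijective : Function.Bijective (toSlit (P := P)) :=
  ⟨toSlit_injective, fun q => ⟨_, toSlit_ofSlitLocal (P.mem_triv q.1.1)⟩⟩

theorem contMDiff_toSlit :
    ContMDiff P.total.I P.lineBundle.dualModel ∞ (toSlit (P := P)) := by
  intro p
  have hp := P.mem_triv (P.proj p)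
  refine (LineBundle.slit_contMDiffAt_iff (L := P.lineBundle) (f := toSlit (P := P)) (y := p)
    (P.proj p) hp).2 ⟨P.smooth_proj p, ?_⟩
  have hs := (P.triv (P.proj p)).open_source.mem_nhds (((P.triv (P.proj p)).mem_source).2 hp)
  have h1 := (P.contMDiffOn_triv (P.proj p)).contMDiffAt hs
  refine ((Units.contMDiff_val.comp contMDiff_snd).contMDiffAt.comp p h1).congr_of_eventuallyEq ?_
  filter_upwards [hs] with q hq
  exact slitCoord_toSlit ((P.triv (P.proj p)).mem_source.1 hq)

/-- The inverse of `toSlit`. -/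
def ofSlit : P.lineBundle.slit → P.total := (Equiv.ofBijective _ (toSlit_bijective (P := P))).symm

theorem toSlit_ofSlit (q : P.lineBundle.slit) : toSlit (ofSlit q) = q :=
  (Equiv.ofBijective _ (toSlit_bijective (P := P))).apply_symm_apply q

theorem ofSlit_toSlit (p : P.total) : ofSlit (toSlit p) = p :=
  (Equiv.ofBijective _ (toSlit_bijective (P := P))).symm_apply_apply p

theorem ofSlit_smul (t : ℝˣ) (q : P.lineBundle.slit) : ofSlit (t • q) = t • ofSlit q :=
  toSlit_injective (by rw [toSlit_ofSlit, toSlit_smul, toSlit_ofSlit])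

theorem contMDiff_ofSlit :
    ContMDiff P.lineBundle.dualModel P.total.I ∞ (ofSlit (P := P)) := by
  intro q
  have hq := P.mem_triv q.1.1
  have hs := ((P.triv q.1.1).open_baseSet.preimage
    (LineBundle.contMDiff_slitProj (L := P.lineBundle)).continuous).mem_nhds hq
  have h1 := (LineBundle.contMDiffOn_slitUnit (L := P.lineBundle) q.1.1).contMDiffAt hs
  have h2 := (P.contMDiffOn_triv_symm q.1.1).contMDiffAt ((P.triv q.1.1).open_target.mem_nhds
    ((P.triv q.1.1).mem_target.2 hq :
      (q.1.1, LineBundle.slitUnit (L := P.lineBundle) q.1.1 q) ∈ (P.triv q.1.1).target))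
  refine (h2.comp q ((LineBundle.contMDiff_slitProj (L := P.lineBundle) q).prodMk
    h1)).congr_of_eventuallyEq ?_
  filter_upwards [hs] with z hz
  exact toSlit_injective ((toSlit_ofSlit z).trans (toSlit_ofSlitLocal hz).symm)

end HomogeneousManifold

/-! ### Transport of complex structures and essential surjectivity -/

/-- A complex structure can be transported along a diffeomorphism. -/
theorem ComplexStructure.exists_transport {N₁ N₂ : SmoothMfd.{u}} (J : ComplexStructure N₁)
    {Φ : N₁ → N₂} {Ψ : N₂ → N₁} (hΦ : ContMDiff N₁.I N₂.I ∞ Φ) (hΨ : ContMDiff N₂.I N₁.I ∞ Ψ)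
    (hΨΦ : ∀ p, Ψ (Φ p) = p) (hΦΨ : ∀ q, Φ (Ψ q) = q) :
    ∃ J' : ComplexStructure N₂, IsHolomorphic J J' Φ ∧ IsHolomorphic J' J Ψ := by
  have hΦd := hΦ.mdifferentiable (by simp)
  have hΨd := hΨ.mdifferentiable (by simp)
  have e1 : ∀ p (v : TangentSpace N₁.I p),
      mfderiv N₂.I N₁.I Ψ (Φ p) (mfderiv N₁.I N₂.I Φ p v) = v := by
    intro p v
    have h1 := mfderiv_comp p (hΨd (Φ p)) (hΦd p)
    have h2 : Ψ ∘ Φ = id := funext hΨΦ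
    rw [h2, mfderiv_id] at h1
    exact (congrArg (fun T : N₁.E →L[ℝ] N₁.E => T v) h1).symm
  have e2 : ∀ q (w : TangentSpace N₂.I q),
      mfderiv N₁.I N₂.I Φ (Ψ q) (mfderiv N₂.I N₁.I Ψ q w) = w := by
    intro q w
    have h1 := mfderiv_comp q (hΦd (Ψ q)) (hΨd q)
    have h2 : Φ ∘ Ψ = id := funext hΦΨ
    rw [h2, mfderiv_id] at h1
    exact (congrArg (fun T : N₂.E →L[ℝ] N₂.E => T w) h1).symm
  let J' : ∀ q : N₂, TangentSpace N₂.I q →L[ℝ] TangentSpace N₂.I q := fun q =>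
    (show N₁.E →L[ℝ] N₂.E from mfderiv N₁.I N₂.I Φ (Ψ q)) ∘L
      (show N₁.E →L[ℝ] N₁.E from J.J (Ψ q)) ∘L
        (show N₂.E →L[ℝ] N₁.E from mfderiv N₂.I N₁.I Ψ q)
  have hJ' : ∀ q (w : TangentSpace N₂.I q),
      J' q w = mfderiv N₁.I N₂.I Φ (Ψ q) (J.J (Ψ q) (mfderiv N₂.I N₁.I Ψ q w)) := fun _ _ => rfl
  have hrel : ∀ p (v : TangentSpace N₁.I p),
      mfderiv N₁.I N₂.I Φ p (J.J p v) = J' (Φ p) (mfderiv N₁.I N₂.I Φ p v) := by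
    intro p v
    rw [hJ', e1]
    -- `Ψ (Φ p)` equals `p` only propositionally; generalising over the second point, with values in
    -- the model space, avoids a cast between tangent spaces.
    have h1 : ∀ p' : N₁, p = p' → @Eq N₂.E (mfderiv N₁.I N₂.I Φ p (J.J p v))
        (mfderiv N₁.I N₂.I Φ p' (J.J p' (show N₁.E from v))) := by
      rintro _ rfl; rfl
    exact h1 _ (hΨΦ p).symm
  -- Every smooth field on `N₂` is `Φ`-related to one on `N₁`, its push-forward by `Ψ`. Smoothness
  -- of `J'` and vanishing of its torsion are thereby reduced to `J`, since brackets of related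
  -- fields are related.
  have hpull : ∀ V : ∀ q : N₂, TangentSpace N₂.I q, N₂.IsSmoothField V →
      ∃ U : ∀ p : N₁, TangentSpace N₁.I p, N₁.IsSmoothField U ∧
        ∀ p, mfderiv N₁.I N₂.I Φ p (U p) = V (Φ p) := by
    intro V hV
    refine ⟨fun p => (show N₁.E from mfderiv N₂.I N₁.I Ψ (Φ p) (V (Φ p))), ?_, fun p => ?_⟩
    · have h1 := ((hΨ.contMDiff_tangentMap (m := ∞) (by simp)).comp hV).comp hΦ
      refine h1.congr fun p => ?_
      exact TotalSpace.ext (hΨΦ p).symm HEq.rfl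
    · have h1 : ∀ p' : N₁, p = p' → ∀ v : N₁.E, @Eq N₂.E (mfderiv N₁.I N₂.I Φ p v)
          (mfderiv N₁.I N₂.I Φ p' v) := by
        rintro _ rfl _; rfl
      exact (h1 _ (hΨΦ p).symm _).trans (e2 (Φ p) (V (Φ p)))
  have hpush : ∀ (U : ∀ p : N₁, TangentSpace N₁.I p) (V : ∀ q : N₂, TangentSpace N₂.I q),
      N₁.IsSmoothField U → (∀ p, mfderiv N₁.I N₂.I Φ p (U p) = V (Φ p)) → N₂.IsSmoothField V := by
    intro U V hU hUV
    have h1 := ((hΦ.contMDiff_tangentMap (m := ∞) (by simp)).comp hU).comp hΨ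
    refine h1.congr fun q => ?_
    have h2 : (⟨Φ (Ψ q), V (Φ (Ψ q))⟩ : TangentBundle N₂.I N₂) = ⟨q, V q⟩ := by rw [hΦΨ]
    exact h2.symm.trans (congrArg (TotalSpace.mk _) (hUV (Ψ q)).symm)
  have hJrel : ∀ (U : ∀ p : N₁, TangentSpace N₁.I p) (V : ∀ q : N₂, TangentSpace N₂.I q),
      (∀ p, mfderiv N₁.I N₂.I Φ p (U p) = V (Φ p)) →
      ∀ p, mfderiv N₁.I N₂.I Φ p (J.J p (U p)) = J' (Φ p) (V (Φ p)) := by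
    intro U V h p
    rw [hrel, h]
  have hJs : ∀ V : ∀ q : N₂, TangentSpace N₂.I q, N₂.IsSmoothField V →
      N₂.IsSmoothField fun q => J' q (V q) := by
    intro V hV
    obtain ⟨U, hU, hUV⟩ := hpull V hV
    exact hpush _ _ (J.smooth U hU) (hJrel U V hUV)
  refine ⟨⟨J', hJs, fun q w => ?_, fun V W hV hW q => ?_⟩, ⟨hΦ, hrel⟩, ⟨hΨ, fun q w => ?_⟩⟩
  · obtain ⟨p, rfl⟩ : ∃ p, Φ p = q := ⟨_, hΦΨ q⟩
    obtain ⟨v, rfl⟩ : ∃ v : TangentSpace N₁.I p, mfderiv N₁.I N₂.I Φ p v = w := by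
      have := e2 (Φ p) w
      rw [hΨΦ] at this
      exact ⟨_, this⟩
    rw [← hrel, ← hrel, J.sq, map_neg]
  · obtain ⟨p, rfl⟩ : ∃ p, Φ p = q := ⟨_, hΦΨ q⟩
    obtain ⟨U, hU, hUV⟩ := hpull V hV
    obtain ⟨T, hT, hTW⟩ := hpull W hW
    have hJU := hJrel U V hUV
    have hJT := hJrel T W hTW
    rw [← mfderiv_mlieBracket hΦ (J.smooth U hU) (J.smooth T hT) (hJs V hV) (hJs W hW) hJU hJT,
      ← mfderiv_mlieBracket hΦ hU hT hV hW hUV hTW,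
      ← mfderiv_mlieBracket hΦ (J.smooth U hU) hT (hJs V hV) hW hJU hTW,
      ← mfderiv_mlieBracket hΦ hU (J.smooth T hT) hV (hJs W hW) hUV hJT,
      ← hrel, ← hrel, ← map_sub, ← map_sub, ← map_sub, J.torsion U T hU hT, map_zero]
  · have h1 : ∀ q' : N₂, q = q' → ∀ u : N₂.E, @Eq N₁.E (mfderiv N₂.I N₁.I Ψ q u)
        (mfderiv N₂.I N₁.I Ψ q' u) := by
      rintro _ rfl _; rfl
    exact (h1 _ (hΦΨ q).symm _).trans (e1 (Ψ q) (J.J (Ψ q) (mfderiv N₂.I N₁.I Ψ q w)))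

theorem HomogeneousManifold.contMDiff_smul (P : HomogeneousManifold.{u}) (t : ℝˣ) :
    ContMDiff P.total.I P.total.I ∞ fun p : P.total => t • p :=
  ContMDiffSMul.contMDiff_const_smul (I := 𝓘(ℝ, ℝ)) t

/-- Every homogeneous complex manifold is isomorphic to the slit dual of an odd complex
manifold. -/
theorem HomogeneousComplexManifold.exists_isHolomorphic_toSlit
    (P : HomogeneousComplexManifold.{u}) :
    ∃ K : ComplexAtiyahStructure P.toHomogeneousManifold.lineBundle,
      IsHolomorphic P.complex (LineBundle.cone K) HomogeneousManifold.toSlit ∧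
      IsHolomorphic (LineBundle.cone K) P.complex HomogeneousManifold.ofSlit := by
  obtain ⟨J, hto, hof⟩ := ComplexStructure.exists_transport P.complex
    (N₂ := P.toHomogeneousManifold.lineBundle.slitMfd)
    HomogeneousManifold.contMDiff_toSlit HomogeneousManifold.contMDiff_ofSlit
    HomogeneousManifold.ofSlit_toSlit HomogeneousManifold.toSlit_ofSlit
  have hJ : J.IsHomogeneous (P := P.toHomogeneousManifold.lineBundle.slitDual) := by
    intro t
    have h1 : IsHolomorphic P.complex P.complex fun p => t • p :=
      ⟨P.toHomogeneousManifold.contMDiff_smul t, P.homogeneous t⟩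
    have h2 : (fun q : P.toHomogeneousManifold.lineBundle.slit =>
        HomogeneousManifold.toSlit (t • HomogeneousManifold.ofSlit q)) = fun q => t • q := by
      funext q
      rw [HomogeneousManifold.toSlit_smul, HomogeneousManifold.toSlit_ofSlit]
    -- The action on the slit dual is the action on `P` conjugated by biholomorphic maps.
    have h3 : IsHolomorphic J J fun q => t • q := h2 ▸ hto.comp (h1.comp hof)
    exact h3.2
  -- The transported structure `J` is homogeneous, so it descends, and by uniqueness of lifts it is
  -- the structure that the functor assigns to the descended one.
  have hK := (LineBundle.isLiftStructure_cone _).unique (LineBundle.isLiftStructure_atiyahOfCone hJ)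
  refine ⟨LineBundle.atiyahOfCone J hJ, ?_, ?_⟩
  · rw [hK]; exact hto
  · rw [hK]; exact hof

end

/-! ### The theorem -/

theorem theorem7p3 :
    (∀ (L : LineBundle.{u}) (D : L.Der),
      ∃! V : ∀ p : L.slit, TangentSpace L.dualModel p,
        L.slitMfd.IsSmoothField V ∧ LineBundle.IsLift D V) ∧
    (∀ (L : LineBundle.{u}) (K : ComplexAtiyahStructure L),
      ∃! J : ComplexStructure L.slitDual.total, LineBundle.IsLiftStructure K J) ∧
    (∀ (L : LineBundle.{u}) (K : ComplexAtiyahStructure L) (J : ComplexStructure L.slitDual.total),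
      LineBundle.IsLiftStructure K J → J.IsHomogeneous (P := L.slitDual)) ∧
    (∀ (L : LineBundle.{u}) (J : ComplexStructure L.slitDual.total),
      J.IsHomogeneous (P := L.slitDual) →
        ∃! K : ComplexAtiyahStructure L, LineBundle.IsLiftStructure K J) ∧
    ∃ κ : ∀ L : LineBundle.{u}, ComplexAtiyahStructure L → ComplexStructure L.slitDual.total,
      (∀ (L : LineBundle.{u}) (K : ComplexAtiyahStructure L),
        LineBundle.IsLiftStructure K (κ L K)) ∧
      ∃ (hκ : ∀ (L : LineBundle.{u}) (K : ComplexAtiyahStructure L),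
          (κ L K).IsHomogeneous (P := L.slitDual))
        (hol : ∀ (X Y : OddComplexManifold.{u}) (F : X ⟶ Y),
          IsHolomorphic (κ X.line X.atiyah) (κ Y.line Y.atiyah) F.toHom.slitMap),
        (coneFunctor κ hκ hol).IsEquivalence := by
  refine ⟨fun L D => ⟨LineBundle.lift D, ⟨LineBundle.isSmoothField_lift D,
      LineBundle.isLift_lift D⟩, fun V h => h.2.eq_lift⟩,
    fun L K => ⟨LineBundle.cone K, LineBundle.isLiftStructure_cone K,
      fun J h => h.unique (LineBundle.isLiftStructure_cone K)⟩,
    fun L K J h => h.isHomogeneous,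
    fun L J hJ => ⟨LineBundle.atiyahOfCone J hJ, LineBundle.isLiftStructure_atiyahOfCone hJ,
      fun K h => h.unique_atiyah (LineBundle.isLiftStructure_atiyahOfCone hJ)⟩,
    fun _ K => LineBundle.cone K, fun _ K => LineBundle.isLiftStructure_cone K,
    fun _ K => (LineBundle.isLiftStructure_cone K).isHomogeneous,
    fun X Y F => (LineBundle.isHolomorphic_slitMap_iff (LineBundle.isLiftStructure_cone X.atiyah)
      (LineBundle.isLiftStructure_cone Y.atiyah) F.toHom).2 F.holomorphic, ?_⟩
  refine { faithful := ⟨fun {X Y F G} h => ?_⟩, full := ⟨fun {X Y} f => ?_⟩, essSurj := ⟨fun P => ?_⟩ }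
  · exact OddComplexManifold.Hom.ext (LineBundle.Hom.slitMap_injective
      (congrArg HomogeneousComplexManifold.Hom.toFun h))
  -- Fullness: smoothness and equivariance of `f` already give the bundle map, and holomorphy of `f`
  -- is what makes that map odd holomorphic.
  · have h1 := LineBundle.slitMap_homOfSlitMap f.holomorphic.1 f.equivariant
    refine ⟨⟨LineBundle.homOfSlitMap f.holomorphic.1 f.equivariant, ?_⟩,
      HomogeneousComplexManifold.Hom.ext h1⟩
    refine (LineBundle.isHolomorphic_slitMap_iff (LineBundle.isLiftStructure_cone X.atiyah)
      (LineBundle.isLiftStructure_cone Y.atiyah) _).1 ?_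
    rw [h1]
    exact f.holomorphic
  · obtain ⟨K, hto, hof⟩ := P.exists_isHolomorphic_toSlit
    exact ⟨⟨P.toHomogeneousManifold.lineBundle, K⟩,
      ⟨{ hom := ⟨HomogeneousManifold.ofSlit, hof, HomogeneousManifold.ofSlit_smul⟩
         inv := ⟨HomogeneousManifold.toSlit, hto, HomogeneousManifold.toSlit_smul⟩
         hom_inv_id := HomogeneousComplexManifold.Hom.ext
           (funext HomogeneousManifold.toSlit_ofSlit)
         inv_hom_id := HomogeneousComplexManifold.Hom.ext
           (funext HomogeneousManifold.ofSlit_toSlit) }⟩⟩
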